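/- **Setting.** A temporal bipartite graph $G$ has disjoint finite vertex layers $U$ and $L$ and a finite edge set $E\subseteq U\times L\times T$, where the timestamps $T$ lie in a linearly ordered abelian group. $E(x)$ is the set of edges adjacent to the vertex $x$, and edges may be read in either direction. For a threshold $\delta$, a *temporal butterfly* is a sequence $\langle e_1,e_2,e_3,e_4\rangle$ of edges of $G$ with $e_1.t<e_2.t<e_3.t<e_4.t$ and $e_4.t-e_1.t\le\delta$ whose underlying static edges are the four edges $\{a,b\}\times\{x,y\}$ of a $2\times2$ biclique ($a\ne b$ in $U$, $x\neq y$ in $L$). It is the union of two wedges (2-paths) from $a$ to $b$, and it has one of six types, determined by whether the time spans of the wedges are disjoint, cross, or nest, and by whether the wedges run in the same temporal direction. $C[0],\dots,C[5]$ are the numbers of butterflies of each type. For a vertex $u$ put $$|E^2(u)|=\sum_{(u,v,t)\in E(u)}|E(v)| .$$ **Algorithms.** Every $E(x)$ is stored as a chronologically sorted array, and ranges of timestamps in it are located by binary search. *STBC* updates one edge $e(u,v,t)$. It enumerates the wedges $u\!-\!x\!-\!w$ with $x\ne v$, $w\neq u$ and the wedges $u\!-\!v\!-\!w$ through $e$ with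 $w\ne u$, restricted to timestamps distinct from each other (and, other than for $e$ itself, from $t$) and pairwise at most $\delta$ apart. Into a hash map indexed by $w$ it puts, as forward and backward wedges, those of the first kind and those of the second kind. For every $w$ with both kinds present it sorts the wedges by first timestamp $t_s$ descending, then last timestamp $t_a$ ascending, and sweeps through them. Two size-augmented red-black trees per wedge list hold the $t_s$ and the $t_a$ of the wedges met so far; wedges with $t_a$ more than $\delta$ beyond the current $t_s$ are erased, the current wedge is matched by rank queries with the stored wedges of the other kind, and is then inserted. The result is subtracted from (deletion) or added to (insertion) the counts, and $e$ is deleted from or inserted into the graph. *STBC$^+$* updates a batch $B$ of distinct edges. Each edge $e(u,v,t)\in B$ is handled by a thread of its own, which does the same with only the edges of timestamps in $(t,t+\delta]$ (deletion) or $[t-\delta,t)$ (insertion), with two arrays per wedge list, sorted once on first use, and binary search in place of the trees. Batch edges are deleted after, respectively inserted before, all counting. **Cost model.** A step is a bounded number of elementary operations: comparisons and arithmetic on vertices, timestamps and counters, pointer moves, and accesses to an array cell or (idealised, as usual) to a hash-map entry. Loop iterations and function calls are charged; sorting, binary search and the red-black tree operations are carried out step by step. Space is the largest number of bounded-size records in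 use, including the stored edges. The cost of one edge in STBC$^+$ is that of its thread plus that of its own deletion from or insertion into the graph. **Theorem.** There is an absolute constant $c$ such that the following holds. Let $G$ be the graph before a deletion, respectively after an insertion, with edge set $E$, let $e(u,v,t)$ be the edge updated, where $u$ may be either endpoint, and let $|E|$ and $|E^2(u)|$ refer to $G$. 1. In STBC and in STBC$^+$, for deletion as well as for insertion, updating the edge $e(u,v,t)$ takes time at most $c\,|E^2(u)|\log|E^2(u)|$ whenever $|E^2(u)|\ge2$, that is, $O(|E^2(u)|\log|E^2(u)|)$. 2. In all these cases it uses space at most $c\,(|E|+|E^2(u)|)$. 3. STBC$^+$ counts every temporal butterfly at its minimum-timestamp edge (deletion), respectively at its maximum-timestamp edge (insertion): for every $e\in B$ and every type, the thread of $e$ finds exactly the number of temporal butterflies of $G$ of this type whose earliest, respectively latest, edge is $e$. 4. Suppose that no remaining edge $f\in E\setminus B$ has a timestamp smaller (deletion), respectively larger (insertion), than that of any edge of $B$. Then every temporal butterfly of $G$ that contains an edge of $B$ has exactly one edge $e\in B$ whose timestamp is minimum, respectively maximum, in the butterfly. Hence there is no double counting: STBC$^+$ decreases, respectively increases, each $C[i]$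 by exactly the number of temporal butterflies of type $i$ in $G$ that contain at least one edge of $B$. -/

import Mathlib

/-! # Temporal bipartite graphs and temporal butterflies -/

namespace TB

/-- A temporal edge `(up, low, time)` between an upper and a lower vertex. -/
@[ext] structure TEdge (V T : Type) where
  up : V
  low : V
  time : T
  deriving DecidableEq

/-- A temporal bipartite graph on the vertex set `V`: `upper x = true` means that `x` lies in the
upper layer `U`, `upper x = false` that it lies in the lower layer `L`. -/
structure TGraph (V T : Type) where
  upper : V → Bool
  edges : Finset (TEdge V T)
  bipartite : ∀ e ∈ edges, upper e.up = true ∧ upper e.low = false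

section Graph

variable {V T : Type}

/-- `(x, y, s)`, read in either direction, is an edge. -/
def TGraph.Adj (G : TGraph V T) (x y : V) (s : T) : Prop :=
  ⟨x, y, s⟩ ∈ G.edges ∨ ⟨y, x, s⟩ ∈ G.edges

variable [DecidableEq V] [DecidableEq T]

/-- The set `E(x)` of the temporal edges adjacent to `x`. -/
def TGraph.incident (G : TGraph V T) (x : V) : Finset (TEdge V T) :=
  G.edges.filter (fun e => e.up = x ∨ e.low = x)

/-- The endpoint of `e` opposite to its endpoint `x`. -/
def TEdge.other (e : TEdge V T) (x : V) : V := if e.up = x then e.low else e.up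

/-- `|E²(u)| = ∑_{(u,v,t) ∈ E(u)} |E(v)|`. -/
def TGraph.sqDeg (G : TGraph V T) (u : V) : ℕ :=
  ∑ e ∈ G.incident u, (G.incident (e.other u)).card

/-- The graph with a set of edges removed. -/
def TGraph.remove (G : TGraph V T) (F : Finset (TEdge V T)) : TGraph V T where
  upper := G.upper
  edges := G.edges \ F
  bipartite e he := G.bipartite e (Finset.mem_sdiff.1 he).1

end Graph

section Butterfly

variable {V T : Type} [AddCommGroup T] [LinearOrder T]

/-- A temporal butterfly of `G` with duration threshold `δ`: four edges in strictly increasing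
chronological order, of total duration at most `δ`, which form a `2 × 2` biclique. -/
def TGraph.IsButterfly (G : TGraph V T) (δ : T) (β : Fin 4 → TEdge V T) : Prop :=
  (∀ i, β i ∈ G.edges) ∧ StrictMono (fun i => (β i).time) ∧ (β 3).time - (β 0).time ≤ δ ∧
    ∃ a b x y : V, a ≠ b ∧ x ≠ y ∧
      Set.range (fun i => ((β i).up, (β i).low)) = {(a, x), (a, y), (b, x), (b, y)}

/-- The type `0, …, 5` of a temporal butterfly. Cut it into two wedges with upper end-vertices, and
let the start-vertex be the upper endpoint of the earliest edge. The wedge that holds the earliest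
edge is then forward. Its time span and that of the other wedge are disjoint (types `0`, `3`),
intersect properly (types `1`, `4`), or the first covers the second (types `2`, `5`); the other
wedge has the same direction (types `0`, `1`, `2`) or the opposite one (types `3`, `4`, `5`). -/
def butterflyType [DecidableEq V] (β : Fin 4 → TEdge V T) : Fin 6 :=
  if (β 1).low = (β 0).low then (if (β 2).up = (β 0).up then 0 else 3)
  else if (β 2).low = (β 0).low then (if (β 1).up = (β 0).up then 1 else 4)
  else (if (β 1).up = (β 0).up then 2 else 5)

/-- The number of temporal butterflies of type `i` with the property `P`. -/
noncomputable def TGraph.count [DecidableEq V] (G : TGraph V T) (δ : T) (i : Fin 6)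
    (P : (Fin 4 → TEdge V T) → Prop) : ℤ :=
  ({β | G.IsButterfly δ β ∧ butterflyType β = i ∧ P β}.ncard : ℤ)

end Butterfly

/-! # Cost model

Programs run in a state monad that meters them. One step of time pays for a bounded number of
elementary operations (comparison or arithmetic on vertices, timestamps and counters, following a
pointer, accessing one array cell, accessing one entry of a hash map). One cell of space is one
record of bounded size. Every loop iteration and every function call is paid for. -/

/-- Steps executed so far, cells in use now, and the largest number of cells ever in use. -/
structure Meter where
  time : ℕ
  live : ℕ
  peak : ℕ

/-- The meter at the start of a run during which `w` cells are occupied already. -/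
def Meter.start (w : ℕ) : Meter := ⟨0, w, w⟩

/-- The meter of two consecutive runs. -/
def Meter.andThen (m₁ m₂ : Meter) : Meter := ⟨m₁.time + m₂.time, m₂.live, max m₁.peak m₂.peak⟩

/-- Metered programs. -/
abbrev Cost : Type → Type := StateM Meter

/-- Spend `n` steps. -/
def tick (n : ℕ) : Cost Unit :=
  modify fun m => ⟨m.time + n, m.live, m.peak⟩

/-- Occupy `n` new cells. -/
def alloc (n : ℕ) : Cost Unit :=
  modify fun m => ⟨m.time, m.live + n, max m.peak (m.live + n)⟩

/-- Release `n` cells. -/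
def release (n : ℕ) : Cost Unit :=
  modify fun m => ⟨m.time, m.live - n, m.peak⟩

section Basic

variable {α β : Type}

/-- A function call that is not a tail call: one step, and one stack cell while it runs. -/
def call (p : Cost α) : Cost α := do
  tick 1
  alloc 1
  let a ← p
  release 1
  return a

/-- Loop over a sequence. -/
def forEach (l : List α) (body : β → α → Cost β) (init : β) : Cost β := do
  tick 1
  l.foldlM (fun b a => do tick 1; body b a) init

/-- Binary search between the positions `lo` and `hi` for the first entry that violates `p`;
`p` holds on an initial segment of the array. -/
def bsearch (arr : Array α) (p : α → Bool) (lo hi : ℕ) : Cost ℕ := do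
  tick 1
  if lo < hi then
    match arr[(lo + hi) / 2]? with
    | some a => if p a then bsearch arr p ((lo + hi) / 2 + 1) hi else bsearch arr p lo ((lo + hi) / 2)
    | none => return lo
  else
    return lo
termination_by hi - lo
decreasing_by all_goals omega

/-- The stretch of a sorted array behind the entries that satisfy `before` and up to the last entry
that satisfies `upTo`, found by two binary searches. It is a view into the array; iterating over it
is paid for by the loop. -/
def window (arr : Array α) (before upTo : α → Bool) : Cost (List α) := do
  let lo ← bsearch arr before 0 arr.size
  let hi ← bsearch arr upTo 0 arr.size
  return (arr.toList.drop lo).take (hi - lo)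

/-- Merge two sorted sequences. -/
def merge (le : α → α → Bool) : List α → List α → Cost (List α)
  | [], bs => do
    tick (bs.length + 1)
    return bs
  | a :: as, [] => do
    tick (as.length + 2)
    return a :: as
  | a :: as, b :: bs => do
    tick 1
    if le a b then
      let r ← merge le as (b :: bs)
      return a :: r
    else
      let r ← merge le (a :: as) bs
      return b :: r
termination_by as bs => as.length + bs.length

/-- Merge sort, with a buffer as long as the input. -/
def msort (le : α → α → Bool) (l : List α) : Cost (List α) := do
  tick (l.length + 1)
  if l.length ≤ 1 then
    return l
  else
    alloc l.length
    let a ← call (msort le (l.take (l.length / 2)))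
    let b ← call (msort le (l.drop (l.length / 2)))
    let r ← merge le a b
    release l.length
    return r
termination_by l.length
decreasing_by all_goals (simp only [List.length_take, List.length_drop]; omega)

end Basic

/-! # Hash maps -/

/-- A hash map: its keys, listed without repetition, and its entries. -/
structure HMap (V β : Type) where
  keys : List V
  find : V → Option β

namespace HMap

variable {V β : Type} [DecidableEq V]

def empty : HMap V β := ⟨[], fun _ => none⟩

def get (H : HMap V β) (w : V) : Cost (Option β) := do
  tick 1
  return H.find w

/-- Apply `f` to the entry of the key `w`, which is first created as `new` if it is missing. -/
def modify (H : HMap V β) (w : V) (new : β) (f : β → β) : Cost (HMap V β) := do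
  tick 1
  match H.find w with
  | some b => return ⟨H.keys, Function.update H.find w (some (f b))⟩
  | none =>
    alloc 1
    return ⟨w :: H.keys, Function.update H.find w (some (f new))⟩

end HMap

/-! # Red-black trees, with subtree sizes stored in the nodes, as ordered multisets -/

inductive Color where
  | red
  | black

inductive RBT (α : Type) where
  | nil : RBT α
  | node (c : Color) (n : ℕ) (l : RBT α) (a : α) (r : RBT α) : RBT α

namespace RBT

open Color

variable {α : Type}

/-- The stored number of elements. -/
def size : RBT α → ℕ
  | nil => 0
  | node _ n _ _ _ => n

/-- The number of nodes, counted structurally; used in termination arguments only. -/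
def nodes : RBT α → ℕ
  | nil => 0
  | node _ _ l _ r => l.nodes + r.nodes + 1

/-- Build a node and compute the size stored in it. -/
def mk (c : Color) (l : RBT α) (a : α) (r : RBT α) : RBT α :=
  node c (l.size + r.size + 1) l a r

/-- A black node whose left subtree may start with two red nodes in a row. -/
def balance1 : RBT α → α → RBT α → RBT α
  | node red _ (node red _ a x b) y c, z, d => mk red (mk black a x b) y (mk black c z d)
  | node red _ a x (node red _ b y c), z, d => mk red (mk black a x b) y (mk black c z d)
  | a, x, b => mk black a x b

/-- A black node whose right subtree may start with two red nodes in a row. -/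
def balance2 : RBT α → α → RBT α → RBT α
  | a, x, node red _ b y (node red _ c z d) => mk red (mk black a x b) y (mk black c z d)
  | a, x, node red _ (node red _ b y c) z d => mk red (mk black a x b) y (mk black c z d)
  | a, x, b => mk black a x b

def setBlack : RBT α → RBT α
  | nil => nil
  | node _ n l a r => node black n l a r

def setRed : RBT α → RBT α
  | nil => nil
  | node _ n l a r => node red n l a r

/-- Rebalance a node whose left subtree has lost one black level. -/
def balLeft (l : RBT α) (v : α) (r : RBT α) : RBT α :=
  match l with
  | node red _ a x b => mk red (mk black a x b) v r
  | l => match r with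
    | node black _ a y b => balance2 l v (mk red a y b)
    | node red _ (node black _ a y b) z c => mk red (mk black l v a) y (balance2 b z (setRed c))
    | r => mk red l v r

/-- Rebalance a node whose right subtree has lost one black level. -/
def balRight (l : RBT α) (v : α) (r : RBT α) : RBT α :=
  match r with
  | node red _ b y c => mk red l v (mk black b y c)
  | r => match l with
    | node black _ a x b => balance1 (mk red a x b) v r
    | node red _ a x (node black _ b y c) => mk red (balance1 (setRed a) x b) y (mk black c v r)
    | l => mk red l v r

/-- Join two trees of the same black height. -/
def join : RBT α → RBT α → Cost (RBT α)
  | nil, t => return t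
  | node c n a x b, nil => return node c n a x b
  | node red _ a x b, node red _ c y d => do
    match ← call (join b c) with
    | node red _ b' z c' => return mk red (mk red a x b') z (mk red c' y d)
    | bc => return mk red a x (mk red bc y d)
  | node black _ a x b, node black _ c y d => do
    match ← call (join b c) with
    | node red _ b' z c' => return mk red (mk black a x b') z (mk black c' y d)
    | bc => return balLeft a x (mk black bc y d)
  | node black k a x b, node red _ c y d => do
    let t ← call (join (node black k a x b) c)
    return mk red t y d
  | node red _ a x b, node black k c y d => do
    let t ← call (join b (node black k c y d))
    return mk red a x t
termination_by s t => s.nodes + t.nodes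
decreasing_by all_goals (simp only [nodes]; omega)

/-- The last element. -/
def back : RBT α → Cost (Option α)
  | nil => do
    tick 1
    return none
  | node _ _ _ a nil => do
    tick 1
    return some a
  | node _ _ _ _ (node c n l b r) => do
    tick 1
    back (node c n l b r)

/-- The number of elements that satisfy `p`, which holds on an initial segment. -/
def countWhile (p : α → Bool) : RBT α → Cost ℕ
  | nil => do
    tick 1
    return 0
  | node _ _ l a r => do
    if p a then
      let k ← call (countWhile p r)
      return l.size + 1 + k
    else
      call (countWhile p l)

variable [LinearOrder α]

def ins (x : α) : RBT α → Cost (RBT α)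
  | nil => do
    alloc 1
    return mk red nil x nil
  | node red _ l y r => do
    if x < y then
      let l' ← call (ins x l)
      return mk red l' y r
    else
      let r' ← call (ins x r)
      return mk red l y r'
  | node black _ l y r => do
    if x < y then
      let l' ← call (ins x l)
      return balance1 l' y r
    else
      let r' ← call (ins x r)
      return balance2 l y r'

/-- Insert `x`. -/
def insert (x : α) (t : RBT α) : Cost (RBT α) := do
  let t' ← call (ins x t)
  return t'.setBlack

def del (x : α) : RBT α → Cost (RBT α)
  | nil => return nil
  | node _ _ l y r => do
    if x < y then
      let l' ← call (del x l)
      match l with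
      | node black _ _ _ _ => return balLeft l' y r
      | _ => return mk red l' y r
    else if y < x then
      let r' ← call (del x r)
      match r with
      | node black _ _ _ _ => return balRight l y r'
      | _ => return mk red l y r'
    else
      release 1
      call (join l r)

/-- Erase one occurrence of `x`. -/
def erase (x : α) (t : RBT α) : Cost (RBT α) := do
  let t' ← call (del x t)
  return t'.setBlack

end RBT

/-! # Storage of the graph -/

section Store

variable {V T : Type}

/-- For every vertex `x` the array of the edges in `E(x)`, as pairs (neighbour, timestamp). -/
abbrev Store (V T : Type) := V → Array (V × T)

/-- The number of cells that the stored edges occupy. -/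
def Store.words [Fintype V] (S : Store V T) : ℕ := ∑ x, (S x).size

/-- `S` stores the graph `G`: every `E(x)` is listed once, in chronological order. -/
def Store.Represents [LinearOrder T] (S : Store V T) (G : TGraph V T) : Prop :=
  ∀ x, (S x).toList.Pairwise (fun p q => p.2 ≤ q.2) ∧ (S x).toList.Nodup ∧
    ∀ y s, (y, s) ∈ (S x).toList ↔ G.Adj x y s

/-- The edge `e(u, v, t)` of an update. Either endpoint may be the start-vertex `u`. -/
structure Req (V T : Type) where
  u : V
  v : V
  t : T

/-- The undirected edge meant by an update. -/
def Req.edge (upper : V → Bool) (r : Req V T) : TEdge V T :=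
  if upper r.u then ⟨r.u, r.v, r.t⟩ else ⟨r.v, r.u, r.t⟩

/-- The edges of a batch of updates. -/
def batch (upper : V → Bool) (B : List (Req V T)) : List (TEdge V T) := B.map (Req.edge upper)

variable [DecidableEq V] [LinearOrder T]

/-- Remove an entry from the array of `x`: one pass that compares and shifts. -/
def removeEntry (x : V) (p : V × T) (S : Store V T) : Cost (Store V T) := do
  tick ((S x).size + 1)
  release 1
  return Function.update S x ((S x).toList.erase p).toArray

/-- Add an entry to the array of `x` at its chronological place: one pass that compares and
shifts. -/
def addEntry (x : V) (p : V × T) (S : Store V T) : Cost (Store V T) := do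
  tick ((S x).size + 1)
  alloc 1
  return Function.update S x ((S x).toList.orderedInsert (fun p q => p.2 ≤ q.2) p).toArray

/-- Delete `e` from the graph. -/
def deleteEdge (r : Req V T) (S : Store V T) : Cost (Store V T) := do
  let S' ← removeEntry r.u (r.v, r.t) S
  removeEntry r.v (r.u, r.t) S'

/-- Insert `e` into the graph. -/
def insertEdge (r : Req V T) (S : Store V T) : Cost (Store V T) := do
  let S' ← addEntry r.u (r.v, r.t) S
  addEntry r.v (r.u, r.t) S'

end Store

/-! # Counters -/

/-- The counts `C[0], …, C[5]`. -/
abbrev Counts := Fin 6 → ℤ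

/-- The type conversion `i ⊕ l` between the two layers (`l = true` stands for `1`):
`0 ↔ 1`, `2 ↔ 3`, `4 ↔ 5`. -/
def convType (l : Bool) (i : Fin 6) : Fin 6 := if l then ![1, 0, 3, 2, 5, 4] i else i

/-- `C[i ⊕ l] += k`. -/
def bump (l : Bool) (i : Fin 6) (k : ℤ) (C : Counts) : Cost Counts := do
  tick 1
  return Function.update C (convType l i) (C (convType l i) + k)

/-! # The streaming algorithm STBC -/

section STBC

variable {V T : Type}

/-- Wedges with one start-vertex and one end-vertex, as pairs `(t_s, t_a)` with `t_s < t_a`: the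
forward ones in `A` and the backward ones, with their timestamps swapped, in `D`. -/
structure WedgeSet (T : Type) where
  A : List (T × T) := []
  D : List (T × T) := []

/-- The two wedge sets of an end-vertex: the wedges whose middle-vertex is the endpoint `v` of the
updated edge, and those with any other middle-vertex. -/
structure WedgePair (T : Type) where
  other : WedgeSet T := {}
  mid : WedgeSet T := {}

/-- The twin red-black trees: `TS` holds the `t_s` of wedges, and `TA` the wedges
themselves with key `t_a` (ties are broken by `t_s`), as pairs `(t_a, t_s)`. -/
structure Twin (T : Type) where
  TS : RBT T := .nil
  TA : RBT (T ×ₗ T) := .nil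

variable [LinearOrder T]

def WedgeSet.add (s : WedgeSet T) (t₁ t₂ : T) : WedgeSet T :=
  if t₁ < t₂ then { s with A := (t₁, t₂) :: s.A }
  else if t₂ < t₁ then { s with D := (t₂, t₁) :: s.D }
  else s

/-- Append to `H[w]` the wedge with timestamps `t₁`, `t₂`; `isMid` tells whether its middle-vertex
is `v`. -/
def addWedge [DecidableEq V] (w : V) (isMid : Bool) (t₁ t₂ : T) (H : HMap V (WedgePair T)) :
    Cost (HMap V (WedgePair T)) := do
  alloc 1
  H.modify w {} fun s =>
    if isMid then { s with mid := s.mid.add t₁ t₂ } else { s with other := s.other.add t₁ t₂ }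

/-- `TS.count(> x)`, `TS.count(≥ x)`, `TA.count(> x)` and `TA.count(< x)`. -/
def Twin.countTSgt (h : Twin T) (x : T) : Cost ℤ := do
  let k ← h.TS.countWhile (fun s => decide (s ≤ x))
  return (h.TS.size : ℤ) - k

def Twin.countTSge (h : Twin T) (x : T) : Cost ℤ := do
  let k ← h.TS.countWhile (fun s => decide (s < x))
  return (h.TS.size : ℤ) - k

def Twin.countTAgt (h : Twin T) (x : T) : Cost ℤ := do
  let k ← h.TA.countWhile (fun w => decide ((ofLex w).1 ≤ x))
  return (h.TA.size : ℤ) - k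

def Twin.countTAlt (h : Twin T) (x : T) : Cost ℤ := do
  let k ← h.TA.countWhile (fun w => decide ((ofLex w).1 < x))
  return (k : ℤ)

/-- `Insert`. -/
def Twin.insert (h : Twin T) (w : T × T) : Cost (Twin T) := do
  let TS ← h.TS.insert w.1
  let TA ← h.TA.insert (toLex (w.2, w.1))
  return ⟨TS, TA⟩

/-- `Delete`: erase wedges from both trees as long as the last wedge `w` in `TA` has
`w.t_a > bound`. The loop runs at most as often as there are elements in `TA`. -/
def Twin.deleteLoop (bound : T) : ℕ → Twin T → Cost (Twin T)
  | 0, h => return h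
  | n + 1, h => do
    tick 1
    match ← h.TA.back with
    | none => return h
    | some w =>
      if bound < (ofLex w).1 then
        let TA ← h.TA.erase w
        let TS ← h.TS.erase (ofLex w).2
        Twin.deleteLoop bound n ⟨TS, TA⟩
      else
        return h

def Twin.delete (bound : T) (h : Twin T) : Cost (Twin T) := do
  tick 1
  Twin.deleteLoop bound h.TA.size h

/-- `Query`: combine the wedge `w` with the stored wedges of the same direction and of the opposite
direction, all of which start later than `w`. -/
def query (l : Bool) (same opp : Twin T) (C : Counts) (w : T × T) : Cost Counts := do
  let C ← bump l 0 (← same.countTSgt w.2) C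
  let C ← bump l 1 ((← same.countTAgt w.2) - (← same.countTSge w.2)) C
  let C ← bump l 2 (← same.countTAlt w.2) C
  let C ← bump l 3 (← opp.countTSgt w.2) C
  let C ← bump l 4 ((← opp.countTAgt w.2) - (← opp.countTSge w.2)) C
  bump l 5 (← opp.countTAlt w.2) C

/-- The four sorted wedge lists `A_i, D_i, A_j, D_j` behind their current pointers. -/
structure Quad (T : Type) where
  Ai : List (T × T)
  Di : List (T × T)
  Aj : List (T × T)
  Dj : List (T × T)

/-- The twin trees that belong to `A_i, D_i, A_j, D_j`. -/
structure Trees (T : Type) where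
  Ai : Twin T := {}
  Di : Twin T := {}
  Aj : Twin T := {}
  Dj : Twin T := {}

def Quad.length (q : Quad T) : ℕ := q.Ai.length + q.Di.length + q.Aj.length + q.Dj.length

/-- The largest `t_s` at the four pointers. -/
def Quad.maxStart (q : Quad T) : Option T :=
  ([q.Ai.head?, q.Di.head?, q.Aj.head?, q.Dj.head?].filterMap (Option.map Prod.fst)).max?

/-- The wedges with `t_s = m` at the pointers, which one round processes. -/
def Quad.now (q : Quad T) (m : T) : Quad T :=
  ⟨q.Ai.takeWhile (fun w => decide (w.1 = m)), q.Di.takeWhile (fun w => decide (w.1 = m)),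
    q.Aj.takeWhile (fun w => decide (w.1 = m)), q.Dj.takeWhile (fun w => decide (w.1 = m))⟩

/-- The wedges left after that round. -/
def Quad.later (q : Quad T) (m : T) : Quad T :=
  ⟨q.Ai.dropWhile (fun w => decide (w.1 = m)), q.Di.dropWhile (fun w => decide (w.1 = m)),
    q.Aj.dropWhile (fun w => decide (w.1 = m)), q.Dj.dropWhile (fun w => decide (w.1 = m))⟩

theorem length_dropWhile_lt {m : T} {l : List (T × T)} (h : l.head?.map Prod.fst = some m) :
    (l.dropWhile (fun w => decide (w.1 = m))).length < l.length := by
  cases l with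
  | nil => simp at h
  | cons a l =>
    simp only [List.head?_cons, Option.map_some, Option.some.injEq] at h
    simp only [List.dropWhile_cons, h, decide_true, if_true, List.length_cons]
    exact Nat.lt_succ_of_le (List.dropWhile_sublist _).length_le

theorem Quad.length_later_lt {q : Quad T} {m : T} (h : q.maxStart = some m) :
    (q.later m).length < q.length := by
  have hm := List.max?_mem h
  have le (l : List (T × T)) :
      (l.dropWhile (fun w => decide (w.1 = m))).length ≤ l.length :=
    (List.dropWhile_sublist _).length_le
  have h1 := le q.Ai
  have h2 := le q.Di
  have h3 := le q.Aj
  have h4 := le q.Dj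
  simp only [List.mem_filterMap, List.mem_cons, List.not_mem_nil, or_false] at hm
  obtain ⟨o, ho, hom⟩ := hm
  simp only [Quad.later, Quad.length]
  rcases ho with rfl | rfl | rfl | rfl
  all_goals
    have h5 := length_dropWhile_lt hom
    omega

variable [AddCommGroup T]

/-- The loop of `SetCross`: in the order of increasing wedge priority, all wedges with the same
`t_s` are queried against the later wedges of the other set, and are then inserted. -/
def setCrossLoop (l : Bool) (δ : T) (q : Quad T) (h : Trees T) (C : Counts) :
    Cost (Trees T × Counts) := do
  tick 1
  match hm : q.maxStart with
  | none => return (h, C)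
  | some m =>
    let hAi ← h.Ai.delete (m + δ)
    let hDi ← h.Di.delete (m + δ)
    let hAj ← h.Aj.delete (m + δ)
    let hDj ← h.Dj.delete (m + δ)
    let C ← forEach (q.now m).Ai (query l hAj hDj) C
    let C ← forEach (q.now m).Di (query l hDj hAj) C
    let C ← forEach (q.now m).Aj (query l hAi hDi) C
    let C ← forEach (q.now m).Dj (query l hDi hAi) C
    let hAi ← forEach (q.now m).Ai Twin.insert hAi
    let hDi ← forEach (q.now m).Di Twin.insert hDi
    let hAj ← forEach (q.now m).Aj Twin.insert hAj
    let hDj ← forEach (q.now m).Dj Twin.insert hDj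
    setCrossLoop l δ (q.later m) ⟨hAi, hDi, hAj, hDj⟩ C
termination_by q.length
decreasing_by exact Quad.length_later_lt hm

/-- Dispose of a pair of trees. -/
def Twin.dispose (h : Twin T) : Cost Unit := do
  tick (h.TS.size + h.TA.size + 1)
  release (h.TS.size + h.TA.size)

/-- `SetCross`: count the butterflies made of one wedge from each of the two sets, whose lists are
sorted by wedge priority. -/
def setCross (l : Bool) (δ : T) (Si Sj : WedgeSet T) : Cost Counts := do
  let (h, C) ← setCrossLoop l δ ⟨Si.A, Si.D, Sj.A, Sj.D⟩ {} 0
  h.Ai.dispose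
  h.Di.dispose
  h.Aj.dispose
  h.Dj.dispose
  return C

/-- The order of increasing wedge priority: `t_s` descending, then `t_a` ascending. -/
def wedgeLe (w₁ w₂ : T × T) : Bool :=
  decide (w₂.1 < w₁.1 ∨ (w₁.1 = w₂.1 ∧ w₁.2 ≤ w₂.2))

def WedgeSet.sort (s : WedgeSet T) : Cost (WedgeSet T) := do
  let A ← call (msort wedgeLe s.A)
  let D ← call (msort wedgeLe s.D)
  return ⟨A, D⟩

def WedgeSet.isEmpty (s : WedgeSet T) : Bool := s.A.isEmpty && s.D.isEmpty

variable [DecidableEq V]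

/-- The enumeration of the wedges in STBC. -/
def stbcWedges (S : Store V T) (δ : T) (r : Req V T) : Cost (HMap V (WedgePair T)) := do
  let es ← window (S r.u) (fun p => decide (p.2 < r.t - δ)) (fun p => decide (p.2 ≤ r.t + δ))
  let H ← forEach es (fun H e => do
    if e.1 ≠ r.v ∧ e.2 ≠ r.t then
      let fs ← window (S e.1) (fun p => decide (p.2 < max r.t e.2 - δ))
        (fun p => decide (p.2 ≤ min r.t e.2 + δ))
      forEach fs (fun H f =>
        if f.1 ≠ r.u ∧ f.2 ≠ r.t ∧ f.2 ≠ e.2 then addWedge f.1 false e.2 f.2 H else pure H) H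
    else
      return H) HMap.empty
  let fs ← window (S r.v) (fun p => decide (p.2 < r.t - δ)) (fun p => decide (p.2 ≤ r.t + δ))
  forEach fs (fun H f =>
    if f.1 ≠ r.u ∧ f.2 ≠ r.t then addWedge f.1 true r.t f.2 H else pure H) H

/-- The counting part of STBC: the numbers of butterflies on `e(u, v, t)`. -/
def stbcCount (upper : V → Bool) (S : Store V T) (δ : T) (r : Req V T) : Cost Counts := do
  let H ← stbcWedges S δ r
  forEach H.keys (fun C w => do
    match ← H.get w with
    | none => return C
    | some s =>
      if s.other.isEmpty || s.mid.isEmpty then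
        return C
      else
        let other ← s.other.sort
        let mid ← s.mid.sort
        let D ← setCross (!upper r.u) δ other mid
        tick 6
        return C + D) 0

/-- STBC, deletion of the edge `e`. -/
def stbcDelete (upper : V → Bool) (δ : T) (r : Req V T) (S : Store V T) (C : Counts) :
    Cost (Store V T × Counts) := do
  let D ← stbcCount upper S δ r
  tick 6
  let S' ← deleteEdge r S
  return (S', C - D)

/-- STBC, insertion of the edge `e`. -/
def stbcInsert (upper : V → Bool) (δ : T) (r : Req V T) (S : Store V T) (C : Counts) :
    Cost (Store V T × Counts) := do
  let D ← stbcCount upper S δ r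
  tick 6
  let S' ← insertEdge r S
  return (S', C + D)

end STBC

/-! # The parallel streaming algorithm STBC⁺ -/

section STBCPlus

variable {V T : Type}

/-- The arrays of the `t_s` and of the `t_a` of a set of wedges. -/
structure TimeArrays (T : Type) where
  VS : Array T := #[]
  VA : Array T := #[]

/-- An entry `H[w]` of STBC⁺: forward wedges, backward wedges, and whether it is sorted already. -/
structure PlusEntry (T : Type) where
  A : TimeArrays T := {}
  D : TimeArrays T := {}
  sorted : Bool := false

/-- Whether a batch of edges is deleted or inserted. -/
inductive Mode where
  | delete
  | insert

variable [LinearOrder T]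

def TimeArrays.push (a : TimeArrays T) (ts ta : T) : TimeArrays T := ⟨a.VS.push ts, a.VA.push ta⟩

def sortArray (a : Array T) : Cost (Array T) := do
  tick (a.size + 1)
  let l ← call (msort (fun x y => decide (x ≤ y)) a.toList)
  return l.toArray

def TimeArrays.sort (a : TimeArrays T) : Cost (TimeArrays T) := do
  let VS ← sortArray a.VS
  let VA ← sortArray a.VA
  return ⟨VS, VA⟩

def PlusEntry.sort (s : PlusEntry T) : Cost (PlusEntry T) := do
  let A ← s.A.sort
  let D ← s.D.sort
  return ⟨A, D, true⟩

/-- The numbers of entries `< x`, `≤ x`, `≥ x` and `> x` of a sorted array. -/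
def countLt (a : Array T) (x : T) : Cost ℤ := do
  let k ← bsearch a (fun s => decide (s < x)) 0 a.size
  return (k : ℤ)

def countLe (a : Array T) (x : T) : Cost ℤ := do
  let k ← bsearch a (fun s => decide (s ≤ x)) 0 a.size
  return (k : ℤ)

def countGe (a : Array T) (x : T) : Cost ℤ := do
  let k ← countLt a x
  return (a.size : ℤ) - k

def countGt (a : Array T) (x : T) : Cost ℤ := do
  let k ← countLe a x
  return (a.size : ℤ) - k

/-- `Query` for a wedge `(t, t')` whose first timestamp `t` is earlier than all others. -/
def queryMin (l : Bool) (same opp : TimeArrays T) (t' : T) (C : Counts) : Cost Counts := do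
  let C ← bump l 0 (← countGt same.VS t') C
  let C ← bump l 1 ((← countGt same.VA t') - (← countGe same.VS t')) C
  let C ← bump l 2 (← countLt same.VA t') C
  let C ← bump l 3 (← countGt opp.VS t') C
  let C ← bump l 4 ((← countGt opp.VA t') - (← countGe opp.VS t')) C
  bump l 5 (← countLt opp.VA t') C

/-- The mirror image of `queryMin` under reversal of time, for a wedge `(t', t)` whose second
timestamp `t` is later than all others. -/
def queryMax (l : Bool) (same opp : TimeArrays T) (t' : T) (C : Counts) : Cost Counts := do
  let C ← bump l 0 (← countLt same.VA t') C
  let C ← bump l 1 ((← countLt same.VS t') - (← countLe same.VA t')) C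
  let C ← bump l 2 (← countGt same.VS t') C
  let C ← bump l 3 (← countLt opp.VA t') C
  let C ← bump l 4 ((← countLt opp.VS t') - (← countLe opp.VA t')) C
  bump l 5 (← countGt opp.VS t') C

variable [DecidableEq V]

/-- Append the wedge with timestamps `t₁`, `t₂` to the arrays of `H[w]`. -/
def addWedgePlus (w : V) (t₁ t₂ : T) (H : HMap V (PlusEntry T)) : Cost (HMap V (PlusEntry T)) := do
  tick 1
  if t₁ < t₂ then
    alloc 2
    H.modify w {} fun s => { s with A := s.A.push t₁ t₂ }
  else if t₂ < t₁ then
    alloc 2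
    H.modify w {} fun s => { s with D := s.D.push t₂ t₁ }
  else
    return H

variable [AddCommGroup T]

/-- The part of `E(x)` in the traversal range: `(t, t + δ]` for deletion, `[t - δ, t)` for
insertion. -/
def plusWindow (mode : Mode) (S : Store V T) (δ t : T) (x : V) : Cost (List (V × T)) :=
  match mode with
  | .delete => window (S x) (fun p => decide (p.2 ≤ t)) (fun p => decide (p.2 ≤ t + δ))
  | .insert => window (S x) (fun p => decide (p.2 < t - δ)) (fun p => decide (p.2 < t))

/-- The work of STBC⁺ on one edge `e(u, v, t)` of the batch, done by one thread. -/
def plusCount (mode : Mode) (upper : V → Bool) (S : Store V T) (δ : T) (r : Req V T) :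
    Cost Counts := do
  let es ← plusWindow mode S δ r.t r.u
  let H ← forEach es (fun H e => do
    if e.1 ≠ r.v then
      let fs ← plusWindow mode S δ r.t e.1
      forEach fs (fun H f => if f.1 ≠ r.u then addWedgePlus f.1 e.2 f.2 H else pure H) H
    else
      return H) HMap.empty
  let fs ← plusWindow mode S δ r.t r.v
  let (_, C) ← forEach fs (fun (H, C) f => do
    if f.1 ≠ r.u then
      match ← H.get f.1 with
      | none => return (H, C)
      | some s =>
        let s' ← if s.sorted then pure s else s.sort
        let H' ← H.modify f.1 {} (fun _ => s')
        let C' ← match mode with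
          | .delete => queryMin (!upper r.u) s'.A s'.D f.2 C
          | .insert => queryMax (!upper r.u) s'.D s'.A f.2 C
        return (H', C')
    else
      return (H, C)) (H, (0 : Counts))
  tick 6
  return C

/-- What STBC⁺ does for one edge of a batch: the numbers by which it changes the counts, and the
cost, which is that of its thread and that of its deletion from, or insertion into, the graph. -/
structure EdgeRun where
  contrib : Counts
  meter : Meter

/-- Update the stored graph by the edges of a batch, one after the other. -/
def updateGraph [Fintype V] (op : Req V T → Store V T → Cost (Store V T)) :
    Store V T → List (Req V T) → Store V T × List Meter
  | S, [] => (S, [])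
  | S, r :: rs =>
    let a := (op r S).run (Meter.start S.words)
    let b := updateGraph op a.1 rs
    (b.1, a.2 :: b.2)

/-- The outcome of a batch update. -/
structure BatchResult (V T : Type) where
  counts : Counts
  store : Store V T
  runs : List EdgeRun

/-- STBC⁺, deletion of a batch: every edge is counted by a thread of its own in the full graph, and
the edges are deleted afterwards. -/
def stbcPlusDelete [Fintype V] (upper : V → Bool) (δ : T) (B : List (Req V T)) (S : Store V T)
    (C : Counts) : BatchResult V T :=
  let threads := B.map fun r => (plusCount .delete upper S δ r).run (Meter.start S.words)
  let upd := updateGraph deleteEdge S B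
  ⟨threads.foldl (fun C a => C - a.1) C, upd.1,
    List.zipWith (fun a m => ⟨a.1, a.2.andThen m⟩) threads upd.2⟩

/-- STBC⁺, insertion of a batch: all edges are inserted beforehand, and every edge is then counted
by a thread of its own. -/
def stbcPlusInsert [Fintype V] (upper : V → Bool) (δ : T) (B : List (Req V T)) (S : Store V T)
    (C : Counts) : BatchResult V T :=
  let upd := updateGraph insertEdge S B
  let threads := B.map fun r => (plusCount .insert upper upd.1 δ r).run (Meter.start upd.1.words)
  ⟨threads.foldl (fun C a => C + a.1) C, upd.1,
    List.zipWith (fun a m => ⟨a.1, m.andThen a.2⟩) threads upd.2⟩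

end STBCPlus

/-! # The bounds -/

/-- Time at most `c · n log n` (for `n ≥ 2`, as `log 1 = 0`) and space at most `c (|E| + n)`. -/
def Meter.Within (m : Meter) (c : ℝ) (edges n : ℕ) : Prop :=
  (2 ≤ n → (m.time : ℝ) ≤ c * (n * Real.log n)) ∧ (m.peak : ℝ) ≤ c * (edges + n)

end TB

/-! Cost. Programs are analysed by Hoare triples `Spec` with a time bound and two space budgets, one
for the peak and one for what is left behind. Put n = |E²(u)|. Everything rests on one count: an
entry (x, t₁) of E(u) leads to at most |E(x)| wedges u-x-w, so there are at most n of these; and as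
e itself lies in E(u), |E(v)| is a summand of n and bounds the number of wedges through e. Hence the
enumeration takes O(n) steps, a binary search in E(x) being paid for by |E(x)| ≥ 1. The O(n) wedges
are then sorted and handled by rank queries and tree operations of O(log n) each, the logarithm
being measured by `unit`. The depth of a red-black tree is bounded as usual: a black height k forces
at least 2^k - 1 elements, and a path is at most about twice as long as the black height.

Two costs are amortised. In the sweep of STBC a single round may erase many wedges, but each wedge
is erased at most once, so its insertion prepays the erasure (`Twin.deleteLoop_spec`,
`setCrossLoop_spec`). This is why a pure cost bound needs the search order of the trees: `erase`
must really remove the element that `back` has returned. In STBC⁺ each entry of the hash map is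
sorted at most once, and the potential `unsortedTotal` pays for it (`plusQueries_spec`). The
resulting bounds are `stbcCount_spec` and `plusCount_spec`.

Counting. A butterfly whose earliest edge is e = uv consists of e, a wedge ux, xw and an edge vw.
Given e, it is determined by x, w and the three other timestamps, and the order of these has six
possibilities, which are the six types (after a conversion if u is a lower vertex). For a given edge
vw with timestamp t' one therefore counts the spans of stored wedges to w that lie behind t',
contain t', or lie before t', separately for both directions. The arrays of starts and ends suffice
although they forget which start belongs to which end: the spans containing t' are those that end
after t' minus those that start at or after t'. The pairs of a wedge and an edge at v that are
counted correspond bijectively to the butterflies (`setOf_butterfly_eq_image`,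
`sum_numMatches_eq_count`). Insertion is the mirror image under reversal of time.

Batches. If no remaining edge is earlier than a batch edge, then a butterfly that meets the batch
has its first edge in the batch, because its timestamps are strictly increasing (`first_mem`,
`last_mem`). So summing over the batch edges as first edges counts each such butterfly once. -/

namespace TB

/-! ### A program logic for time and space -/

/-- Hoare triples for metered programs: the run of `p` needs at most `s` cells on top of those that
are live at its start, leaves at most `a` cells more, and its value and its running time (or an
upper bound of it) satisfy `Q`. -/
def Spec {α : Type} (p : Cost α) (s a : ℕ) (Q : α → ℕ → Prop) : Prop :=
  ∀ m : Meter, ∃ t, Q (p.run m).1 t ∧ (p.run m).2.time ≤ m.time + t ∧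
    (p.run m).2.live ≤ m.live + a ∧ (p.run m).2.peak ≤ max m.peak (m.live + s)

namespace Spec

variable {α β : Type} {s a s₁ a₁ : ℕ}

theorem mono {p : Cost α} {Q R : α → ℕ → Prop} (h : Spec p s₁ a₁ Q) (hs : s₁ ≤ s) (ha : a₁ ≤ a)
    (hQ : ∀ x t, Q x t → R x t) : Spec p s a R := by
  intro m
  obtain ⟨t, h1, h2, h3, h4⟩ := h m
  exact ⟨t, hQ _ _ h1, h2, by omega, by omega⟩

theorem weaken {p : Cost α} {Q R : α → ℕ → Prop} (h : Spec p s a Q)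
    (hQ : ∀ x t, Q x t → R x t) : Spec p s a R :=
  h.mono le_rfl le_rfl hQ

theorem ret {x : α} {Q : α → ℕ → Prop} (h : Q x 0) : Spec (pure x) s a Q := by
  intro m
  exact ⟨0, h, le_rfl, Nat.le_add_right _ _, le_max_left _ _⟩

/-- The cells that `p` leaves behind reduce both budgets of the continuation. Since subtraction is
truncated, `a₁ ≤ s` and `a₁ ≤ a` are needed to keep the reduced budgets honest. -/
theorem bind {p : Cost α} {f : α → Cost β} {Q : α → ℕ → Prop} {R : β → ℕ → Prop}
    (h : Spec p s₁ a₁ Q) (hs : s₁ ≤ s) (ha : a₁ ≤ a) (has : a₁ ≤ s)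
    (hf : ∀ x t, Q x t → Spec (f x) (s - a₁) (a - a₁) (fun y t' => R y (t + t'))) :
    Spec (p >>= f) s a R := by
  intro m
  obtain ⟨t, h1, h2, h3, h4⟩ := h m
  obtain ⟨t', k1, k2, k3, k4⟩ := hf _ _ h1 (p.run m).2
  refine ⟨t + t', ?_, ?_, ?_, ?_⟩ <;> rw [StateT.run_bind]
  · exact k1
  · change ((f (p.run m).1).run (p.run m).2).2.time ≤ _
    omega
  · change ((f (p.run m).1).run (p.run m).2).2.live ≤ _
    omega
  · change ((f (p.run m).1).run (p.run m).2).2.peak ≤ _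
    omega

/-- Sequencing with a first program that does not allocate. -/
theorem bind₀ {p : Cost α} {f : α → Cost β} {Q : α → ℕ → Prop} {R : β → ℕ → Prop}
    (h : Spec p s₁ 0 Q) (hs : s₁ ≤ s)
    (hf : ∀ x t, Q x t → Spec (f x) s a (fun y t' => R y (t + t'))) :
    Spec (p >>= f) s a R :=
  bind h hs (Nat.zero_le _) (Nat.zero_le _) hf

theorem tick (n : ℕ) : Spec (tick n) 0 0 (fun _ t => t = n) := by
  intro m
  exact ⟨n, rfl, le_rfl, le_rfl, le_max_left _ _⟩

theorem alloc (n : ℕ) : Spec (alloc n) n n (fun _ t => t = 0) := by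
  intro m
  exact ⟨0, rfl, le_rfl, le_rfl, le_rfl⟩

theorem release (n : ℕ) : Spec (release n) 0 0 (fun _ t => t = 0) := by
  intro m
  exact ⟨0, rfl, le_rfl, Nat.sub_le _ _, le_max_left _ _⟩

theorem tick_bind {n : ℕ} {f : Unit → Cost β} {R : β → ℕ → Prop}
    (hf : Spec (f ()) s a (fun y t => R y (n + t))) : Spec (TB.tick n >>= f) s a R :=
  bind₀ (tick n) (Nat.zero_le _) (by rintro _ _ rfl; exact hf)

theorem alloc_bind {n : ℕ} {f : Unit → Cost β} {R : β → ℕ → Prop} (hs : n ≤ s) (ha : n ≤ a)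
    (hf : Spec (f ()) (s - n) (a - n) R) : Spec (TB.alloc n >>= f) s a R :=
  bind (alloc n) hs ha hs (by
    rintro _ _ rfl
    exact hf.weaken (by intro _ _ h; rwa [Nat.zero_add]))

theorem release_bind {n : ℕ} {f : Unit → Cost β} {R : β → ℕ → Prop}
    (hf : Spec (f ()) s a R) : Spec (TB.release n >>= f) s a R :=
  bind₀ (release n) (Nat.zero_le _) (by
    rintro _ _ rfl
    exact hf.weaken (by intro _ _ h; rwa [Nat.zero_add]))

/-- Cells that are released at the end. -/
theorem bracket {n : ℕ} {p : Cost α} {Q : α → ℕ → Prop} (h : Spec p s (a + n) Q) :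
    Spec (p >>= fun r => TB.release n >>= fun _ => pure r) s a Q := by
  intro m
  obtain ⟨t, h1, h2, h3, h4⟩ := h m
  refine ⟨t, h1, h2, ?_, h4⟩
  change (p.run m).2.live - n ≤ _
  omega

/-- The stack cell raises the peak only; its release at the end keeps the leftover at `a`. -/
theorem call {p : Cost α} {Q : α → ℕ → Prop} (h : Spec p s a Q) :
    Spec (call p) (s + 1) a (fun x t => ∃ t', t = t' + 1 ∧ Q x t') := by
  intro m
  obtain ⟨t, h1, h2, h3, h4⟩ := h ⟨m.time + 1, m.live + 1, max m.peak (m.live + 1)⟩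
  refine ⟨t + 1, ⟨t, rfl, h1⟩, ?_, ?_, ?_⟩
  · refine le_trans h2 (le_of_eq ?_)
    change m.time + 1 + t = _
    omega
  · refine le_trans (Nat.sub_le_sub_right h3 1) ?_
    change m.live + 1 + a - 1 ≤ _
    omega
  · refine le_trans h4 ?_
    change max (max m.peak (m.live + 1)) (m.live + 1 + s) ≤ _
    omega

/-- A loop that maintains an invariant of the sequence processed so far, the current value and
the time spent. -/
theorem forEach_inv {l : List α} {body : β → α → Cost β} {init : β} {A : α → ℕ}
    (I : List α → β → ℕ → Prop) (h0 : I [] init 1)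
    (hb : ∀ pre x post b t, l = pre ++ x :: post → I pre b t →
      Spec (body b x) (s₁ + A x) (A x) (fun b' t' => I (pre ++ [x]) b' (t + 1 + t')))
    (hs : s₁ + (l.map A).sum ≤ s) (ha : (l.map A).sum ≤ a) :
    Spec (forEach l body init) s a (fun b t => I l b t) := by
  -- Induction on the part of the sequence still to come, with the processed part as a ghost
  -- variable. The leftovers `A` of the iterations add up, while the scratch space `s₁` is reused by
  -- each of them.
  have key : ∀ (post pre : List α) (b : β) (t : ℕ), l = pre ++ post → I pre b t →
      Spec (post.foldlM (fun b a => do TB.tick 1; body b a) b)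
        (s₁ + (post.map A).sum) (post.map A).sum (fun b t' => I l b (t + t')) := by
    intro post
    induction post with
    | nil =>
      intro pre b t hl hI
      rw [List.foldlM_nil]
      refine ret ?_
      rw [List.append_nil] at hl
      rw [hl]
      exact hI
    | cons x post ih =>
      intro pre b t hl hI
      rw [List.foldlM_cons, bind_assoc]
      simp only [List.map_cons, List.sum_cons]
      refine tick_bind ?_
      refine bind (hb pre x post b t hl hI) (by omega) (by omega) (by omega) ?_
      intro b' t' hI'
      refine (ih (pre ++ [x]) b' (t + 1 + t') (by simp [hl]) hI').mono (by omega) (by omega) ?_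
      intro b'' t'' h
      have : t + (1 + (t' + t'')) = t + 1 + t' + t'' := by omega
      rwa [this]
  refine tick_bind ?_
  exact (key l [] init 1 rfl h0).mono hs ha (fun _ _ h => h)

/-- A loop whose body satisfies time bounds that do not depend on the loop state. -/
theorem forEach {l : List α} {body : β → α → Cost β} {init : β} {A τ : α → ℕ}
    (I : List α → β → Prop) (h0 : I [] init)
    (hb : ∀ pre x post b, l = pre ++ x :: post → I pre b →
      Spec (body b x) (s₁ + A x) (A x) (fun b' t' => I (pre ++ [x]) b' ∧ t' ≤ τ x))
    (hs : s₁ + (l.map A).sum ≤ s) (ha : (l.map A).sum ≤ a) :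
    Spec (forEach l body init) s a
      (fun b t => I l b ∧ t ≤ 1 + (l.map fun x => τ x + 1).sum) := by
  refine forEach_inv (fun pre b t => I pre b ∧ t ≤ 1 + (pre.map fun x => τ x + 1).sum)
    ⟨h0, by simp⟩ ?_ hs ha
  rintro pre x post b t hl ⟨hI, ht⟩
  refine (hb pre x post b hl hI).weaken ?_
  rintro b' t' ⟨h1, h2⟩
  refine ⟨h1, ?_⟩
  simp only [List.map_append, List.map_cons, List.map_nil, List.sum_append, List.sum_cons,
    List.sum_nil]
  omega

end Spec

/-! ### Binary search -/

section Search

variable {α : Type}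

theorem bsearch_spec (arr : Array α) (p : α → Bool) (s a : ℕ) (lo hi : ℕ) :
    Spec (bsearch arr p lo hi) s a (fun _ t => t ≤ Nat.log 2 (hi - lo) + 2) := by
  induction h : hi - lo using Nat.strong_induction_on generalizing lo hi with
  | _ n ih =>
    rw [bsearch]
    refine Spec.tick_bind ?_
    split_ifs with hlt
    -- A half of size at least 1 lowers the logarithm by one. An empty half need not, as `Nat.log 2
    -- 0 = Nat.log 2 1 = 0`; a search in it takes a single step, by `hempty`.
    · have hlog : 1 ≤ n → ∀ k ≤ n / 2, Nat.log 2 k + 1 ≤ Nat.log 2 n + (if k = 0 then 1 else 0) := by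
        intro hn k hk
        split_ifs with hk0
        · subst hk0; simp
        · have h2 : Nat.log 2 k ≤ Nat.log 2 (n / 2) := Nat.log_mono_right hk
          rw [Nat.log_div_base] at h2
          have : 0 < Nat.log 2 n := Nat.log_pos (by norm_num) (by omega)
          omega
      have hempty : ∀ lo hi, hi - lo = 0 → Spec (bsearch arr p lo hi) s a (fun _ t => t ≤ 1) := by
        intro lo hi h
        rw [bsearch]
        refine Spec.tick_bind ?_
        rw [if_neg (by omega)]
        exact Spec.ret le_rfl
      have step : ∀ lo' hi', hi' - lo' ≤ n / 2 →
          Spec (bsearch arr p lo' hi') s a (fun _ t => 1 + t ≤ Nat.log 2 n + 2) := by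
        intro lo' hi' hle
        by_cases h0 : hi' - lo' = 0
        · exact (hempty lo' hi' h0).weaken (by intros; omega)
        · refine (ih (hi' - lo') (by omega) lo' hi' rfl).weaken ?_
          intro _ t ht
          have := hlog (by omega) _ hle
          rw [if_neg h0] at this
          omega
      split
      · split_ifs
        · exact step _ _ (by omega)
        · exact step _ _ (by omega)
      · exact Spec.ret (by omega)
    · exact Spec.ret (by omega)

/-- The entries with `p` form an initial segment, whose length must be `countP`. This turns
positions found by binary search into numbers of entries. -/
theorem countP_take_drop {p : α → Bool} {l : List α} (h : l.Pairwise fun x y => p y → p x) :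
    ∀ i (hi : i < l.length), p l[i] = true ↔ i < l.countP p := by
  induction l with
  | nil => intro i hi; simp at hi
  | cons x l ih =>
    rw [List.pairwise_cons] at h
    intro i hi
    by_cases hx : p x
    · rw [List.countP_cons_of_pos hx]
      cases i with
      | zero => simp [hx]
      | succ i =>
        rw [List.getElem_cons_succ, ih h.2 i (by simpa using hi)]
        omega
    · have h0 : (x :: l).countP p = 0 := by
        rw [List.countP_eq_zero]
        intro y hy
        rcases List.mem_cons.1 hy with rfl | hy
        · exact hx
        · exact fun hp => hx (h.1 y hy hp)
      rw [h0]
      cases i with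
      | zero => simp [hx]
      | succ i =>
        simp only [List.getElem_cons_succ, Nat.not_lt_zero, iff_false]
        exact fun hp => hx (h.1 _ (List.getElem_mem _) hp)

/-- Loop invariant: the number of entries with `p` stays between `lo` and `hi`. -/
theorem bsearch_value (arr : Array α) (p : α → Bool)
    (h : arr.toList.Pairwise fun x y => p y → p x) (lo hi : ℕ) (h1 : lo ≤ arr.toList.countP p)
    (h2 : arr.toList.countP p ≤ hi) (h3 : hi ≤ arr.size) (m : Meter) :
    ((bsearch arr p lo hi).run m).1 = arr.toList.countP p := by
  induction hn : hi - lo using Nat.strong_induction_on generalizing lo hi m with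
  | _ n ih =>
    rw [bsearch, StateT.run_bind]
    by_cases hlt : lo < hi
    · have hmid : (lo + hi) / 2 < arr.size := by omega
      have key := countP_take_drop h ((lo + hi) / 2) (by simpa using hmid)
      simp only [Array.getElem_toList] at key
      simp only [hlt, if_true, Array.getElem?_eq_getElem hmid]
      by_cases hp : p arr[(lo + hi) / 2]
      · have := key.1 hp
        rw [if_pos hp]
        exact ih _ (by omega) _ _ (by omega) (by omega) (by omega) _ rfl
      · have := mt key.2 hp
        rw [if_neg hp]
        exact ih _ (by omega) _ _ (by omega) (by omega) (by omega) _ rfl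
    · simp only [hlt, if_false]
      change lo = _
      omega

theorem Spec.and_value {p : Cost α} {s a : ℕ} {Q : α → ℕ → Prop} {P : α → Prop} (h : Spec p s a Q)
    (hP : ∀ m, P (p.run m).1) : Spec p s a (fun x t => P x ∧ Q x t) := by
  intro m
  obtain ⟨t, h1, h2⟩ := h m
  exact ⟨t, ⟨hP m, h1⟩, h2⟩

theorem bsearch_full_spec (arr : Array α) (p : α → Bool)
    (h : arr.toList.Pairwise fun x y => p y → p x) (s a : ℕ) :
    Spec (bsearch arr p 0 arr.size) s a
      (fun k t => k = arr.toList.countP p ∧ t ≤ Nat.log 2 arr.size + 2) :=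
  (bsearch_spec arr p s a 0 arr.size).and_value fun m =>
    bsearch_value arr p h 0 arr.size (Nat.zero_le _)
      (by simpa using List.countP_le_length (l := arr.toList)) le_rfl m

/-- Any two positions cut out a sublist, whether or not the array is sorted. This is all that the
cost of STBC depends on; `window_mem_spec` adds what counting requires. -/
theorem window_spec (arr : Array α) (before upTo : α → Bool) (s a : ℕ) :
    Spec (window arr before upTo) s a
      (fun l t => l.Sublist arr.toList ∧ t ≤ 2 * Nat.log 2 arr.size + 4) := by
  refine Spec.bind₀ (bsearch_spec arr before s 0 0 arr.size) le_rfl ?_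
  intro lo t ht
  refine Spec.bind₀ (bsearch_spec arr upTo s 0 0 arr.size) le_rfl ?_
  intro hi t' ht'
  refine Spec.ret ⟨(List.take_sublist _ _).trans (List.drop_sublist _ _), ?_⟩
  rw [Nat.sub_zero] at ht ht'
  omega

theorem window_mem_spec (arr : Array α) (before upTo : α → Bool) (s a : ℕ)
    (hb : arr.toList.Pairwise fun x y => before y → before x)
    (hu : arr.toList.Pairwise fun x y => upTo y → upTo x) :
    Spec (window arr before upTo) s a
      (fun l t => l.Sublist arr.toList ∧
        (∀ x, x ∈ l ↔ x ∈ arr.toList ∧ before x = false ∧ upTo x = true) ∧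
        t ≤ 2 * Nat.log 2 arr.size + 4) := by
  refine Spec.bind₀ (bsearch_full_spec arr before hb s 0) le_rfl ?_
  rintro lo t ⟨rfl, ht⟩
  refine Spec.bind₀ (bsearch_full_spec arr upTo hu s 0) le_rfl ?_
  rintro hi t' ⟨rfl, ht'⟩
  refine Spec.ret ⟨(List.take_sublist _ _).trans (List.drop_sublist _ _), ?_, by omega⟩
  intro x
  constructor
  · intro hx
    obtain ⟨i, hi, rfl⟩ := List.mem_iff_getElem.1 hx
    rw [List.getElem_take, List.getElem_drop]
    simp only [List.length_take, List.length_drop] at hi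
    refine ⟨List.getElem_mem _, ?_, ?_⟩
    · rw [← Bool.not_eq_true, countP_take_drop hb]
      omega
    · rw [countP_take_drop hu]
      omega
  · rintro ⟨hx, h1, h2⟩
    obtain ⟨i, hi, rfl⟩ := List.mem_iff_getElem.1 hx
    rw [← Bool.not_eq_true, countP_take_drop hb] at h1
    rw [countP_take_drop hu] at h2
    rw [List.mem_iff_getElem]
    refine ⟨i - arr.toList.countP before, ?_, ?_⟩
    · simp only [List.length_take, List.length_drop]
      omega
    · rw [List.getElem_take, List.getElem_drop]
      congr 1
      omega

end Search

/-! ### Merge sort -/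

section Sorting

variable {α : Type}

/-- The order axioms for `le` are hypotheses of the sortedness claim alone, so that the same triple
serves where only length and cost are of interest, as for the wedge lists of STBC. -/
theorem merge_spec (le : α → α → Bool) (as bs : List α) (s : ℕ) :
    Spec (merge le as bs) s 0 (fun r t => r.Perm (as ++ bs) ∧ t ≤ as.length + bs.length + 2 ∧
      ((∀ x y, le x y ∨ le y x) → (∀ x y z, le x y → le y z → le x z) →
        as.Pairwise (fun x y => le x y) → bs.Pairwise (fun x y => le x y) →
        r.Pairwise (fun x y => le x y))) := by
  induction as, bs using merge.induct with
  | case1 bs =>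
    rw [merge]
    refine Spec.tick_bind (Spec.ret ⟨List.Perm.refl _, ?_, fun _ _ _ h => h⟩)
    simp only [List.length_nil]
    omega
  | case2 x as =>
    rw [merge]
    refine Spec.tick_bind (Spec.ret ⟨by simp, ?_, fun _ _ h _ => h⟩)
    simp only [List.length_nil, List.length_cons]
    omega
  | case3 x as y bs ih₁ ih₂ =>
    rw [merge]
    refine Spec.tick_bind ?_
    split_ifs with hle
    · refine Spec.bind₀ ih₁ le_rfl ?_
      rintro r t ⟨h1, h2, h3⟩
      refine Spec.ret ⟨h1.cons x, ?_, ?_⟩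
      · simp only [List.length_cons] at h2 ⊢
        omega
      · intro ht htr ha hb
        refine List.pairwise_cons.2 ⟨?_, h3 ht htr (List.pairwise_cons.1 ha).2 hb⟩
        intro z hz
        rw [h1.mem_iff, List.mem_append, List.mem_cons] at hz
        rcases hz with hz | rfl | hz
        · exact (List.pairwise_cons.1 ha).1 z hz
        · exact hle
        · exact htr _ _ _ hle ((List.pairwise_cons.1 hb).1 z hz)
    · refine Spec.bind₀ ih₂ le_rfl ?_
      rintro r t ⟨h1, h2, h3⟩
      refine Spec.ret ⟨?_, ?_, ?_⟩
      · exact (h1.cons y).trans List.perm_middle.symm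
      · simp only [List.length_cons] at h2 ⊢
        omega
      · intro ht htr ha hb
        have hyx : le y x := (ht x y).resolve_left hle
        refine List.pairwise_cons.2 ⟨?_, h3 ht htr ha (List.pairwise_cons.1 hb).2⟩
        intro z hz
        rw [h1.mem_iff, List.mem_append, List.mem_cons] at hz
        rcases hz with (rfl | hz) | hz
        · exact hyx
        · exact htr _ _ _ hyx ((List.pairwise_cons.1 ha).1 z hz)
        · exact (List.pairwise_cons.1 hb).1 z hz

/-- `Nat.clog` drops by exactly one when passing to the larger half ⌈n/2⌉, so each level of the
recursion has 6n steps to spend beyond the linear term. In space, a buffer of n cells, one stack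
cell and 4(⌈n/2⌉ - 1) cells for a half fit into 4(n - 1) cells for n ≥ 2; the two halves are sorted
one after the other. -/
theorem msort_spec (le : α → α → Bool) (l : List α) :
    Spec (msort le l) (4 * (l.length - 1)) 0 (fun r t => r.Perm l ∧
      t ≤ 6 * (l.length * Nat.clog 2 l.length) + l.length + 1 ∧
      ((∀ x y, le x y ∨ le y x) → (∀ x y z, le x y → le y z → le x z) →
        r.Pairwise (fun x y => le x y))) := by
  induction hn : l.length using Nat.strong_induction_on generalizing l with
  | _ n ih =>
    rw [msort]
    refine Spec.tick_bind ?_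
    rw [hn]
    split_ifs with h1
    · refine Spec.ret ⟨List.Perm.refl _, by omega, fun _ _ => ?_⟩
      match l, hn with
      | [], _ => exact List.Pairwise.nil
      | [x], _ => exact List.pairwise_singleton _ _
      | x :: y :: l, hn =>
        simp only [List.length_cons] at hn
        omega
    · have hc : Nat.clog 2 n = Nat.clog 2 ((n + 1) / 2) + 1 := by
        exact Nat.clog_of_two_le (by norm_num) (by omega)
      have hA := ih (n / 2) (by omega) (l.take (n / 2)) (by simp; omega)
      have hB := ih (n - n / 2) (by omega) (l.drop (n / 2)) (by simp; omega)
      -- The buffer counts as left behind by the program up to the merge; `bracket` then gives it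
      -- back. The initial n + 1 steps are added to `t` by hand.
      have := Spec.bracket (n := n) (s := 4 * (n - 1)) (a := 0)
        (p := alloc n >>= fun _ => call (msort le (l.take (n / 2))) >>= fun a =>
          call (msort le (l.drop (n / 2))) >>= fun b => merge le a b)
        (Q := fun r t => r.Perm l ∧
          n + 1 + t ≤ 6 * (n * Nat.clog 2 n) + n + 1 ∧
          ((∀ x y, le x y ∨ le y x) → (∀ x y z, le x y → le y z → le x z) →
            r.Pairwise (fun x y => le x y))) ?_
      · simpa only [bind_assoc] using this
      · refine Spec.alloc_bind (by omega) (by omega) ?_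
        refine Spec.bind₀ hA.call (by omega) ?_
        rintro as _ ⟨t, rfl, hp1, ht1, hs1⟩
        refine Spec.bind₀ hB.call (by omega) ?_
        rintro bs _ ⟨t', rfl, hp2, ht2, hs2⟩
        refine (merge_spec le as bs _).mono le_rfl (Nat.zero_le _) ?_
        rintro r t'' ⟨hp3, ht3, hs3⟩
        refine ⟨?_, ?_, fun h1 h2 => hs3 h1 h2 (hs1 h1 h2) (hs2 h1 h2)⟩
        · refine hp3.trans ((hp1.append hp2).trans ?_)
          rw [List.take_append_drop]
        · have e1 : as.length = n / 2 := by rw [hp1.length_eq]; simp; omega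
          have e2 : bs.length = n - n / 2 := by rw [hp2.length_eq]; simp; omega
          rw [e1, e2] at ht3
          have c1 : Nat.clog 2 (n / 2) ≤ Nat.clog 2 ((n + 1) / 2) := Nat.clog_mono_right 2 (by omega)
          have c2 : n - n / 2 = (n + 1) / 2 := by omega
          rw [c2] at ht2 ht3
          rw [hc]
          generalize Nat.clog 2 ((n + 1) / 2) = k at *
          generalize Nat.clog 2 (n / 2) = k' at *
          have d1 : n / 2 * k' ≤ n / 2 * k := Nat.mul_le_mul_left _ c1
          have d2 : n / 2 * k + (n + 1) / 2 * k = n * k := by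
            rw [← Nat.add_mul]; congr 1; omega
          have d3 : n * (k + 1) = n * k + n := by ring
          omega

end Sorting

/-! ### Red-black trees -/

namespace RBT

open Color

variable {α : Type}

/-- The elements in symmetric order. -/
def toList : RBT α → List α
  | nil => []
  | node _ _ l a r => l.toList ++ a :: r.toList

/-- The length of the longest path from the root. -/
def depth : RBT α → ℕ
  | nil => 0
  | node _ _ l _ r => max l.depth r.depth + 1

/-- The stored sizes are correct. -/
def Sized : RBT α → Prop
  | nil => True
  | node _ n l _ r => n = l.toList.length + r.toList.length + 1 ∧ l.Sized ∧ r.Sized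

/-- The red-black invariant, for a tree whose root has colour `c` and whose black height is `n`. -/
inductive Balanced : RBT α → Color → ℕ → Prop
  | nil : Balanced nil black 0
  | red {l r : RBT α} {k n : ℕ} {a : α} :
      Balanced l black n → Balanced r black n → Balanced (node red k l a r) red n
  | black {l r : RBT α} {k n : ℕ} {a : α} {c₁ c₂ : Color} :
      Balanced l c₁ n → Balanced r c₂ n → Balanced (node black k l a r) black (n + 1)

/-- A tree that is balanced except that, if `p` holds, its root and the children of its root may
be red. -/
inductive RedRed (p : Prop) : RBT α → ℕ → Prop
  | balanced {t : RBT α} {c : Color} {n : ℕ} : Balanced t c n → RedRed p t n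
  | redred {l r : RBT α} {k n : ℕ} {a : α} {c₁ c₂ : Color} :
      p → Balanced l c₁ n → Balanced r c₂ n → RedRed p (node red k l a r) n

theorem RedRed.of_false {p : Prop} {t : RBT α} {n : ℕ} (hp : ¬p) : RedRed p t n → ∃ c, Balanced t c n
  | .balanced h => ⟨_, h⟩
  | .redred h .. => absurd h hp

theorem RedRed.of_red {p : Prop} {l r : RBT α} {k n : ℕ} {a : α} :
    RedRed p (node red k l a r) n → ∃ c₁ c₂, Balanced l c₁ n ∧ Balanced r c₂ n
  | .balanced (.red hl hr) => ⟨_, _, hl, hr⟩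
  | .redred _ hl hr => ⟨_, _, hl, hr⟩

theorem RedRed.imp {p q : Prop} {t : RBT α} {n : ℕ} (h : p → q) : RedRed p t n → RedRed q t n
  | .balanced h => .balanced h
  | .redred hp hl hr => .redred (h hp) hl hr

theorem Sized.size_eq {t : RBT α} (h : t.Sized) : t.size = t.toList.length := by
  cases t with
  | nil => rfl
  | node c n l a r =>
    simp only [size, h.1, toList, List.length_append, List.length_cons]
    omega

@[simp] theorem toList_mk (c : Color) (l r : RBT α) (a : α) :
    (mk c l a r).toList = l.toList ++ a :: r.toList := rfl

theorem Sized.mk {c : Color} {l r : RBT α} {a : α} (hl : l.Sized) (hr : r.Sized) :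
    (mk c l a r).Sized :=
  ⟨by rw [hl.size_eq, hr.size_eq], hl, hr⟩

@[simp] theorem toList_setBlack (t : RBT α) : t.setBlack.toList = t.toList := by
  cases t <;> rfl

@[simp] theorem toList_setRed (t : RBT α) : t.setRed.toList = t.toList := by
  cases t <;> rfl

theorem Sized.setBlack {t : RBT α} (h : t.Sized) : t.setBlack.Sized := by
  cases t <;> exact h

theorem Sized.setRed {t : RBT α} (h : t.Sized) : t.setRed.Sized := by
  cases t <;> exact h

@[simp] theorem toList_balance1 (l r : RBT α) (a : α) :
    (balance1 l a r).toList = l.toList ++ a :: r.toList := by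
  unfold balance1
  split <;> simp [toList]

@[simp] theorem toList_balance2 (l r : RBT α) (a : α) :
    (balance2 l a r).toList = l.toList ++ a :: r.toList := by
  unfold balance2
  split <;> simp [toList]

theorem Sized.balance1 {l r : RBT α} {a : α} (hl : l.Sized) (hr : r.Sized) :
    (balance1 l a r).Sized := by
  unfold RBT.balance1
  split
  · exact (hl.2.1.2.1.mk hl.2.1.2.2).mk (hl.2.2.mk hr)
  · exact (hl.2.1.mk hl.2.2.2.1).mk (hl.2.2.2.2.mk hr)
  · exact hl.mk hr

theorem Sized.balance2 {l r : RBT α} {a : α} (hl : l.Sized) (hr : r.Sized) :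
    (balance2 l a r).Sized := by
  unfold RBT.balance2
  split
  · exact (hl.mk hr.2.1).mk (hr.2.2.2.1.mk hr.2.2.2.2)
  · exact (hl.mk hr.2.1.2.1).mk (hr.2.1.2.2.mk hr.2.2)
  · exact hl.mk hr

/-- The only possible violation is a red root of `l` with a red child. The rotation makes that a red
node with two black children, which is balanced whatever the colour of its parent. -/
theorem RedRed.balance1 {p : Prop} {l r : RBT α} {a : α} {c : Color} {n : ℕ} (hl : l.RedRed p n)
    (hr : r.Balanced c n) : ∃ c, (balance1 l a r).Balanced c (n + 1) := by
  unfold RBT.balance1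
  split
  · cases hl with
    | balanced h => cases h with | red h _ => cases h
    | redred _ h1 h2 => cases h1 with | red h3 h4 => exact ⟨_, .red (.black h3 h4) (.black h2 hr)⟩
  · cases hl with
    | balanced h => cases h with | red _ h => cases h
    | redred _ h1 h2 => cases h2 with | red h3 h4 => exact ⟨_, .red (.black h1 h3) (.black h4 hr)⟩
  · next H1 H2 =>
    cases hl with
    | balanced h => exact ⟨_, .black h hr⟩
    | redred _ h1 h2 =>
      cases h1 with
      | red => exact absurd rfl (H1 _ _ _ _ _ _ _)
      | nil =>
        cases h2 with
        | red => exact absurd rfl (H2 _ _ _ _ _ _ _)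
        | nil => exact ⟨_, .black (.red .nil .nil) hr⟩
      | black h3 h4 =>
        cases h2 with
        | red => exact absurd rfl (H2 _ _ _ _ _ _ _)
        | black h5 h6 => exact ⟨_, .black (.red (.black h3 h4) (.black h5 h6)) hr⟩

theorem RedRed.balance2 {p : Prop} {l r : RBT α} {a : α} {c : Color} {n : ℕ} (hl : l.Balanced c n)
    (hr : r.RedRed p n) : ∃ c, (balance2 l a r).Balanced c (n + 1) := by
  unfold RBT.balance2
  split
  · cases hr with
    | balanced h => cases h with | red _ h => cases h
    | redred _ h1 h2 => cases h2 with | red h3 h4 => exact ⟨_, .red (.black hl h1) (.black h3 h4)⟩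
  · cases hr with
    | balanced h => cases h with | red h _ => cases h
    | redred _ h1 h2 => cases h1 with | red h3 h4 => exact ⟨_, .red (.black hl h3) (.black h4 h2)⟩
  · next H1 H2 =>
    cases hr with
    | balanced h => exact ⟨_, .black hl h⟩
    | redred _ h1 h2 =>
      cases h1 with
      | red => exact absurd rfl (H2 _ _ _ _ _ _ _)
      | nil =>
        cases h2 with
        | red => exact absurd rfl (H1 _ _ _ _ _ _ _)
        | nil => exact ⟨_, .black hl (.red .nil .nil)⟩
      | black h3 h4 =>
        cases h2 with
        | red => exact absurd rfl (H1 _ _ _ _ _ _ _)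
        | black h5 h6 => exact ⟨_, .black hl (.red (.black h3 h4) (.black h5 h6))⟩

@[simp] theorem toList_balLeft (l r : RBT α) (a : α) :
    (balLeft l a r).toList = l.toList ++ a :: r.toList := by
  unfold balLeft
  split
  · simp [toList]
  · split <;> simp [toList]

@[simp] theorem toList_balRight (l r : RBT α) (a : α) :
    (balRight l a r).toList = l.toList ++ a :: r.toList := by
  unfold balRight
  split
  · simp [toList]
  · split <;> simp [toList]

theorem Sized.balLeft {l r : RBT α} {a : α} (hl : l.Sized) (hr : r.Sized) :
    (balLeft l a r).Sized := by
  unfold RBT.balLeft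
  split
  · exact (hl.2.1.mk hl.2.2).mk hr
  · split
    · exact hl.balance2 (hr.2.1.mk hr.2.2)
    · exact (hl.mk hr.2.1.2.1).mk (hr.2.1.2.2.balance2 hr.2.2.setRed)
    · exact hl.mk hr

theorem Sized.balRight {l r : RBT α} {a : α} (hl : l.Sized) (hr : r.Sized) :
    (balRight l a r).Sized := by
  unfold RBT.balRight
  split
  · exact hl.mk (hr.2.1.mk hr.2.2)
  · split
    · exact (hl.2.1.mk hl.2.2).balance1 hr
    · exact (hl.2.1.setRed.balance1 hl.2.2.2.1).mk (hl.2.2.2.2.mk hr)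
    · exact hl.mk hr

/-- The left side lacks one black level. If its root is red, blackening it makes up for this.
Otherwise a black sibling is reddened, which lowers the right side too; a red sibling has a black
left child, which is not `nil` since its black height is positive, and a rotation brings it up. Two
red nodes in a row can remain at the root only if the sibling was red, which cannot happen below a
red parent. -/
theorem RedRed.balLeft {l r : RBT α} {a : α} {c : Color} {n : ℕ} (hl : l.RedRed True n)
    (hr : r.Balanced c (n + 1)) : (balLeft l a r).RedRed (c = red) (n + 1) := by
  unfold RBT.balLeft
  split
  · obtain ⟨_, _, h1, h2⟩ := hl.of_red
    cases c with
    | red => exact .redred rfl (.black h1 h2) hr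
    | black => exact .balanced (.red (.black h1 h2) hr)
  · next H =>
    cases hl with
    | redred => exact absurd rfl (H _ _ _ _)
    | balanced hl =>
      cases hr with
      | black h1 h2 =>
        obtain ⟨_, h⟩ := RedRed.balance2 (a := a) hl (RedRed.redred (k := _) (a := _) trivial h1 h2)
        exact .balanced h
      | red h1 h2 =>
        cases h1 with
        | black h3 h4 =>
          cases h2 with
          | black h5 h6 =>
            obtain ⟨_, h⟩ := RedRed.balance2 h4 (.redred trivial h5 h6)
            exact .redred rfl (.black hl h3) h

theorem RedRed.balRight {l r : RBT α} {a : α} {c : Color} {n : ℕ} (hl : l.Balanced c (n + 1))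
    (hr : r.RedRed True n) : (balRight l a r).RedRed (c = red) (n + 1) := by
  unfold RBT.balRight
  split
  · obtain ⟨_, _, h1, h2⟩ := hr.of_red
    cases c with
    | red => exact .redred rfl hl (.black h1 h2)
    | black => exact .balanced (.red hl (.black h1 h2))
  · next H =>
    cases hr with
    | redred => exact absurd rfl (H _ _ _ _)
    | balanced hr =>
      cases hl with
      | black h1 h2 =>
        obtain ⟨_, h⟩ := RedRed.balance1 (a := a) (RedRed.redred (k := _) (a := _) trivial h1 h2) hr
        exact .balanced h
      | red h1 h2 =>
        cases h2 with
        | black h3 h4 =>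
          cases h1 with
          | black h5 h6 =>
            obtain ⟨_, h⟩ := RedRed.balance1 (.redred trivial h5 h6) h3
            exact .redred rfl h (.black h4 hr)

theorem RedRed.setBlack {p : Prop} {t : RBT α} {n : ℕ} :
    RedRed p t n → ∃ c n, Balanced t.setBlack c n
  | .balanced .nil => ⟨_, _, .nil⟩
  | .balanced (.red hl hr) => ⟨_, _, .black hl hr⟩
  | .balanced (.black hl hr) => ⟨_, _, .black hl hr⟩
  | .redred _ hl hr => ⟨_, _, .black hl hr⟩

theorem Balanced.depth_le {t : RBT α} {c : Color} {n : ℕ} (h : Balanced t c n) :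
    t.depth ≤ 2 * n + 1 ∧ (c = Color.black → t.depth ≤ 2 * n) := by
  induction h with
  | nil => simp [depth]
  | red _ _ h1 h2 =>
    have := h1.2 rfl
    have := h2.2 rfl
    exact ⟨by simp only [depth]; omega, nofun⟩
  | black _ _ h1 h2 =>
    have := h1.1
    have := h2.1
    exact ⟨by simp only [depth]; omega, fun _ => by simp only [depth]; omega⟩

theorem Balanced.two_pow_le {t : RBT α} {c : Color} {n : ℕ} (h : Balanced t c n) :
    2 ^ n ≤ t.toList.length + 1 := by
  induction h with
  | nil => simp [toList]
  | red _ _ h1 h2 =>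
    simp only [toList, List.length_append, List.length_cons]
    omega
  | black _ _ h1 h2 =>
    simp only [toList, List.length_append, List.length_cons, pow_succ]
    omega

/-- Red nodes have black children, so the depth is at most 2n + 1 for black height n, and 2^n is at
most the number of elements plus one. -/
theorem Balanced.depth_le_log {t : RBT α} {c : Color} {n N : ℕ} (h : Balanced t c n)
    (hN : t.toList.length ≤ N) : t.depth ≤ 2 * Nat.log 2 (N + 1) + 1 := by
  have h1 := h.depth_le.1
  have h2 : n ≤ Nat.log 2 (N + 1) :=
    Nat.le_log_of_pow_le (by norm_num) (h.two_pow_le.trans (by omega))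
  omega

/-- Each call descends by a level in at least one of the trees, which bounds time and stack by the
sum of the depths. The children of red nodes are black, so joining the inner subtrees of two red
roots gives a balanced tree; the violation that the result may carry is excluded when both roots are
black. -/
theorem join_spec (s t : RBT α) : Spec (join s t) (s.depth + t.depth) 0 (fun r τ =>
    r.toList = s.toList ++ t.toList ∧ (s.Sized → t.Sized → r.Sized) ∧
    (∀ c₁ c₂ n, Balanced s c₁ n → Balanced t c₂ n →
      RedRed (c₁ = black → c₂ ≠ black) r n) ∧
    τ ≤ s.depth + t.depth) := by
  induction hk : s.nodes + t.nodes using Nat.strong_induction_on generalizing s t with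
  | _ k ih =>
  match s, t with
  | nil, t =>
    rw [join]
    exact Spec.ret ⟨rfl, fun _ h => h, fun _ _ _ _ h => .balanced h, Nat.zero_le _⟩
  | node c n a x b, nil =>
    rw [join]
    exact Spec.ret ⟨by simp [toList], fun h _ => h, fun _ _ _ h _ => .balanced h, Nat.zero_le _⟩
  | node red _ a x b, node red _ c y d =>
    rw [join]
    refine Spec.bind₀ (ih _ (by simp only [nodes] at hk; omega) b c rfl).call
      (by simp only [depth]; omega) ?_
    rintro r _ ⟨τ, rfl, h1, h2, h3, h4⟩
    split
    · refine Spec.ret ⟨?_, ?_, ?_, ?_⟩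
      · simp only [toList] at h1
        simp only [toList, toList_mk, List.append_assoc, List.cons_append]
        rw [← List.append_assoc b.toList, ← h1]
        simp
      · intro hs ht
        have := h2 hs.2.2 ht.2.1
        exact (hs.2.1.mk this.2.1).mk (this.2.2.mk ht.2.2)
      · rintro _ _ n (_ | ⟨ha, hb⟩ | _) (_ | ⟨hc, hd⟩ | _)
        obtain ⟨_, h⟩ := (h3 _ _ _ hb hc).of_false (fun h => h rfl rfl)
        cases h with
        | red h5 h6 => exact .redred (by simp) (.red ha h5) (.red h6 hd)
      · simp only [depth]
        omega
    · next H =>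
      refine Spec.ret ⟨?_, ?_, ?_, ?_⟩
      · simp [toList, h1]
      · intro hs ht
        exact hs.2.1.mk ((h2 hs.2.2 ht.2.1).mk ht.2.2)
      · rintro _ _ n (_ | ⟨ha, hb⟩ | _) (_ | ⟨hc, hd⟩ | _)
        obtain ⟨c, h⟩ := (h3 _ _ _ hb hc).of_false (fun h => h rfl rfl)
        cases c with
        | red => cases h with | red => exact absurd rfl (H _ _ _ _)
        | black => exact .redred (by simp) ha (.red h hd)
      · simp only [depth]
        omega
  | node black _ a x b, node black _ c y d =>
    rw [join]
    refine Spec.bind₀ (ih _ (by simp only [nodes] at hk; omega) b c rfl).call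
      (by simp only [depth]; omega) ?_
    rintro r _ ⟨τ, rfl, h1, h2, h3, h4⟩
    split
    · refine Spec.ret ⟨?_, ?_, ?_, ?_⟩
      · simp only [toList] at h1
        simp only [toList, toList_mk, List.append_assoc, List.cons_append]
        rw [← List.append_assoc b.toList, ← h1]
        simp
      · intro hs ht
        have := h2 hs.2.2 ht.2.1
        exact (hs.2.1.mk this.2.1).mk (this.2.2.mk ht.2.2)
      · rintro _ _ n (_ | _ | ⟨ha, hb⟩) (_ | _ | ⟨hc, hd⟩)
        obtain ⟨_, _, h5, h6⟩ := (h3 _ _ _ hb hc).of_red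
        exact .balanced (.red (.black ha h5) (.black h6 hd))
      · simp only [depth]
        omega
    · next H =>
      refine Spec.ret ⟨?_, ?_, ?_, ?_⟩
      · simp [toList, h1]
      · intro hs ht
        exact hs.2.1.balLeft ((h2 hs.2.2 ht.2.1).mk ht.2.2)
      · rintro _ _ n (_ | _ | ⟨ha, hb⟩) (_ | _ | ⟨hc, hd⟩)
        have h := h3 _ _ _ hb hc
        cases h with
        | redred => exact absurd rfl (H _ _ _ _)
        | balanced h =>
          exact ((RedRed.balanced ha).balLeft (.black h hd)).imp (by simp)
      · simp only [depth]
        omega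
  | node black k a x b, node red _ c y d =>
    rw [join]
    refine Spec.bind₀ (ih _ (by simp only [nodes] at hk ⊢; omega) (node black k a x b) c rfl).call
      (by simp only [depth]; omega) ?_
    rintro r _ ⟨τ, rfl, h1, h2, h3, h4⟩
    refine Spec.ret ⟨?_, ?_, ?_, ?_⟩
    · simp [toList, h1]
    · intro hs ht
      exact (h2 hs ht.2.1).mk ht.2.2
    · rintro _ _ n hs (_ | ⟨hc, hd⟩ | _)
      have hs' := hs
      cases hs' with
      | black =>
        obtain ⟨c, h⟩ := (h3 _ _ _ hs hc).of_false (fun h => h rfl rfl)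
        exact .redred (by simp) h hd
    · simp only [depth] at h4 ⊢
      omega
  | node red _ a x b, node black k c y d =>
    rw [join]
    refine Spec.bind₀ (ih _ (by simp only [nodes] at hk ⊢; omega) b (node black k c y d) rfl).call
      (by simp only [depth]; omega) ?_
    rintro r _ ⟨τ, rfl, h1, h2, h3, h4⟩
    refine Spec.ret ⟨?_, ?_, ?_, ?_⟩
    · simp [toList, h1]
    · intro hs ht
      exact hs.2.1.mk (h2 hs.2.2 ht)
    · rintro _ _ n (_ | ⟨ha, hb⟩ | _) ht
      have ht' := ht
      cases ht' with
      | black =>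
        obtain ⟨c, h⟩ := (h3 _ _ _ hb ht).of_false (fun h => h rfl rfl)
        exact .redred (by simp) ha h
    · simp only [depth] at h4 ⊢
      omega

theorem back_spec (t : RBT α) (s : ℕ) :
    Spec (back t) s 0 (fun r τ => r = t.toList.getLast? ∧ τ ≤ t.depth + 1) := by
  induction t with
  | nil =>
    rw [back]
    exact Spec.tick_bind (Spec.ret ⟨rfl, by omega⟩)
  | node c n l a r _ ih =>
    cases r with
    | nil =>
      rw [back]
      refine Spec.tick_bind (Spec.ret ⟨?_, by omega⟩)
      simp [toList]
    | node c' n' l' b r' =>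
      rw [back]
      refine Spec.tick_bind (ih.weaken ?_)
      rintro x τ ⟨rfl, h⟩
      refine ⟨?_, by simp only [depth] at h ⊢; omega⟩
      simp [toList, List.getLast?_append, List.getLast?_cons]

/-- The search follows one path, because the left subtree is counted through its stored size. -/
theorem countWhile_spec (p : α → Bool) (t : RBT α) :
    Spec (countWhile p t) t.depth 0 (fun _ τ => τ ≤ t.depth + 1) := by
  induction t with
  | nil =>
    rw [countWhile]
    exact Spec.tick_bind (Spec.ret (by omega))
  | node c n l a r ihl ihr =>
    rw [countWhile]
    split_ifs
    · refine Spec.bind₀ ihr.call (by simp only [depth]; omega) ?_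
      rintro k _ ⟨τ, rfl, h⟩
      exact Spec.ret (by simp only [depth]; omega)
    · refine ihl.call.mono (by simp only [depth]; omega) le_rfl ?_
      rintro k _ ⟨τ, rfl, h⟩
      simp only [depth]
      omega

variable [LinearOrder α]

/-- A red root may end up with a red child, but a black root never does, since it rebalances. Hence
the violation is tied to `c = red` and is repaired by the next black ancestor, or by `setBlack` at
the top. -/
theorem ins_spec (x : α) (t : RBT α) : Spec (ins x t) (t.depth + 1) 1 (fun r τ =>
    r.toList.Perm (x :: t.toList) ∧
    (t.toList.Pairwise (· ≤ ·) → r.toList.Pairwise (· ≤ ·)) ∧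
    (t.Sized → r.Sized) ∧ (∀ c n, Balanced t c n → RedRed (c = red) r n) ∧ τ ≤ t.depth) := by
  have sorted_left : ∀ {l l' r : List α} {y : α}, l'.Perm (x :: l) → x < y →
      (l.Pairwise (· ≤ ·) → l'.Pairwise (· ≤ ·)) → (l ++ y :: r).Pairwise (· ≤ ·) →
      (l' ++ y :: r).Pairwise (· ≤ ·) := by
    intro l l' r y hp hx hl h
    rw [List.pairwise_append] at h ⊢
    refine ⟨hl h.1, h.2.1, ?_⟩
    intro z hz w hw
    rw [hp.mem_iff, List.mem_cons] at hz
    rcases hz with rfl | hz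
    · rcases List.mem_cons.1 hw with rfl | hw
      · exact hx.le
      · exact hx.le.trans ((List.pairwise_cons.1 h.2.1).1 w hw)
    · exact h.2.2 z hz w hw
  have sorted_right : ∀ {l r r' : List α} {y : α}, r'.Perm (x :: r) → ¬x < y →
      (r.Pairwise (· ≤ ·) → r'.Pairwise (· ≤ ·)) → (l ++ y :: r).Pairwise (· ≤ ·) →
      (l ++ y :: r').Pairwise (· ≤ ·) := by
    intro l r r' y hp hx hr h
    rw [List.pairwise_append, List.pairwise_cons] at h ⊢
    refine ⟨h.1, ⟨?_, hr h.2.1.2⟩, ?_⟩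
    · intro z hz
      rw [hp.mem_iff, List.mem_cons] at hz
      rcases hz with rfl | hz
      · exact not_lt.1 hx
      · exact h.2.1.1 z hz
    · intro z hz w hw
      have hzy := h.2.2 z hz y List.mem_cons_self
      rcases List.mem_cons.1 hw with rfl | hw
      · exact hzy
      · rw [hp.mem_iff, List.mem_cons] at hw
        rcases hw with rfl | hw
        · exact hzy.trans (not_lt.1 hx)
        · exact h.2.2 z hz w (List.mem_cons_of_mem _ hw)
  have perm_left : ∀ {l l' r : List α} {y : α}, l'.Perm (x :: l) →
      (l' ++ y :: r).Perm (x :: (l ++ y :: r)) := fun hp => hp.append_right _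
  have perm_right : ∀ {l r r' : List α} {y : α}, r'.Perm (x :: r) →
      (l ++ y :: r').Perm (x :: (l ++ y :: r)) := by
    intro l r r' y hp
    refine (((hp.cons y).trans (List.Perm.swap x y r)).append_left l).trans List.perm_middle
  induction t with
  | nil =>
    rw [ins]
    refine Spec.alloc_bind (by omega) le_rfl (Spec.ret ⟨.refl _, fun _ => ?_, fun _ => ?_, ?_, ?_⟩)
    · exact List.pairwise_singleton _ _
    · exact Sized.mk trivial trivial
    · rintro _ _ (_ | _ | _)
      exact .balanced (.red .nil .nil)
    · exact Nat.zero_le _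
  | node c k l y r ihl ihr =>
    cases c with
    | red =>
      rw [ins]
      split_ifs with hx
      · refine Spec.bind ihl.call (by simp only [depth]; omega) le_rfl (by omega) ?_
        rintro l' _ ⟨τ, rfl, h1, h2, h3, h4, h5⟩
        refine Spec.ret ⟨perm_left h1, sorted_left h1 hx h2, fun hs => ?_, ?_, ?_⟩
        · exact (h3 hs.2.1).mk hs.2.2
        · rintro _ n (_ | ⟨ha, hb⟩ | _)
          obtain ⟨_, h⟩ := (h4 _ _ ha).of_false (by simp)
          exact .redred rfl h hb
        · simp only [depth]
          omega
      · refine Spec.bind ihr.call (by simp only [depth]; omega) le_rfl (by omega) ?_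
        rintro r' _ ⟨τ, rfl, h1, h2, h3, h4, h5⟩
        refine Spec.ret ⟨perm_right h1, sorted_right h1 hx h2, fun hs => ?_, ?_, ?_⟩
        · exact hs.2.1.mk (h3 hs.2.2)
        · rintro _ n (_ | ⟨ha, hb⟩ | _)
          obtain ⟨_, h⟩ := (h4 _ _ hb).of_false (by simp)
          exact .redred rfl ha h
        · simp only [depth]
          omega
    | black =>
      rw [ins]
      split_ifs with hx
      · refine Spec.bind ihl.call (by simp only [depth]; omega) le_rfl (by omega) ?_
        rintro l' _ ⟨τ, rfl, h1, h2, h3, h4, h5⟩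
        refine Spec.ret ⟨?_, ?_, fun hs => ?_, ?_, ?_⟩
        · rw [toList_balance1]
          exact perm_left h1
        · rw [toList_balance1]
          exact sorted_left h1 hx h2
        · exact (h3 hs.2.1).balance1 hs.2.2
        · rintro _ n (_ | _ | ⟨ha, hb⟩)
          obtain ⟨_, h⟩ := (h4 _ _ ha).balance1 (a := y) hb
          exact .balanced h
        · simp only [depth]
          omega
      · refine Spec.bind ihr.call (by simp only [depth]; omega) le_rfl (by omega) ?_
        rintro r' _ ⟨τ, rfl, h1, h2, h3, h4, h5⟩
        refine Spec.ret ⟨?_, ?_, fun hs => ?_, ?_, ?_⟩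
        · rw [toList_balance2]
          exact perm_right h1
        · rw [toList_balance2]
          exact sorted_right h1 hx h2
        · exact hs.2.1.balance2 (h3 hs.2.2)
        · rintro _ n (_ | _ | ⟨ha, hb⟩)
          obtain ⟨_, h⟩ := RedRed.balance2 (a := y) ha (h4 _ _ hb)
          exact .balanced h
        · simp only [depth]
          omega

/-- What deletion does to the balance: a black root costs one black level. -/
def DelProp (t r : RBT α) (n : ℕ) : Prop :=
  match t with
  | node black _ _ _ _ => ∃ n', n = n' + 1 ∧ RedRed True r n'
  | _ => ∃ c, Balanced r c n

/-- A descent of at most the depth is followed by one join of two subtrees, which costs at most the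
sum of their depths; together this stays within twice the depth. The claim on the length uses the
search order: it shows that `x` lies in the subtree that is searched. -/
theorem del_spec (x : α) (t : RBT α) : Spec (del x t) (2 * t.depth) 0 (fun r τ =>
    r.toList.Sublist t.toList ∧
    (t.toList.Pairwise (· ≤ ·) → x ∈ t.toList → r.toList.length + 1 = t.toList.length) ∧
    (t.Sized → r.Sized) ∧ (∀ c n, Balanced t c n → DelProp t r n) ∧ τ ≤ 2 * t.depth) := by
  induction t with
  | nil =>
    rw [del]
    refine Spec.ret ⟨.refl _, fun _ h => by simp [toList] at h, fun h => h, ?_, Nat.zero_le _⟩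
    exact fun c n h => ⟨c, h⟩
  | node c k l y r ihl ihr =>
    have length_left : ∀ {l' : RBT α}, x < y →
        (l.toList.Pairwise (· ≤ ·) → x ∈ l.toList → l'.toList.length + 1 = l.toList.length) →
        (node c k l y r).toList.Pairwise (· ≤ ·) → x ∈ (node c k l y r).toList →
        (l'.toList ++ y :: r.toList).length + 1 = (node c k l y r).toList.length := by
      intro l' hx h2 hs hm
      simp only [toList, List.pairwise_append, List.pairwise_cons] at hs
      simp only [toList, List.mem_append, List.mem_cons] at hm
      have hl : x ∈ l.toList := by
        rcases hm with h | rfl | h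
        · exact h
        · exact absurd hx (lt_irrefl _)
        · exact absurd (hs.2.1.1 x h) (not_le.2 hx)
      have := h2 hs.1 hl
      simp only [toList, List.length_append, List.length_cons]
      omega
    have length_right : ∀ {r' : RBT α}, y < x →
        (r.toList.Pairwise (· ≤ ·) → x ∈ r.toList → r'.toList.length + 1 = r.toList.length) →
        (node c k l y r).toList.Pairwise (· ≤ ·) → x ∈ (node c k l y r).toList →
        (l.toList ++ y :: r'.toList).length + 1 = (node c k l y r).toList.length := by
      intro r' hx h2 hs hm
      simp only [toList, List.pairwise_append, List.pairwise_cons] at hs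
      simp only [toList, List.mem_append, List.mem_cons] at hm
      have hr : x ∈ r.toList := by
        rcases hm with h | rfl | h
        · exact absurd (hs.2.2 x h y List.mem_cons_self) (not_le.2 hx)
        · exact absurd hx (lt_irrefl _)
        · exact h
      have := h2 hs.2.1.2 hr
      simp only [toList, List.length_append, List.length_cons]
      omega
    rw [del]
    split_ifs with hx hx'
    · refine Spec.bind₀ ihl.call (by simp only [depth]; omega) ?_
      rintro l' _ ⟨τ, rfl, h1, h2, h3, h4, h5⟩
      split
      · refine Spec.ret ⟨?_, ?_, fun hs => (h3 hs.2.1).balLeft hs.2.2, ?_, ?_⟩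
        · rw [toList_balLeft]
          exact h1.append_right _
        · rw [toList_balLeft]
          exact length_left hx h2
        · rintro _ n (_ | ⟨ha, hb⟩ | ⟨ha, hb⟩)
          · obtain ⟨n', rfl, h⟩ := h4 _ _ ha
            exact (h.balLeft hb).of_false (by simp)
          · obtain ⟨n', rfl, h⟩ := h4 _ _ ha
            exact ⟨_, rfl, (h.balLeft hb).imp (by simp)⟩
        · simp only [depth] at h5 ⊢
          omega
      · next H =>
        refine Spec.ret ⟨h1.append_right _, length_left hx h2, fun hs => (h3 hs.2.1).mk hs.2.2,
          ?_, ?_⟩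
        · rintro _ n (_ | ⟨ha, hb⟩ | ⟨ha, hb⟩)
          -- A red node has black children. The left child is not a black node by `H`, so it is
          -- `nil`; the black height is then 0 and the right child is `nil` as well.
          · cases ha with
            | nil =>
              cases hb with
              | nil =>
                obtain ⟨c, h⟩ := h4 _ _ .nil
                cases l' with
                | nil => exact ⟨_, .red .nil .nil⟩
                | node => simp [toList] at h1
            | black => exact absurd rfl (H _ _ _ _)
          · cases ha with
            | nil =>
              obtain ⟨c, h⟩ := h4 _ _ .nil
              exact ⟨_, rfl, .redred trivial h hb⟩
            | black => exact absurd rfl (H _ _ _ _)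
            | red h6 h7 =>
              obtain ⟨c, h⟩ := h4 _ _ (.red h6 h7)
              exact ⟨_, rfl, .redred trivial h hb⟩
        · simp only [depth] at h5 ⊢
          omega
    · refine Spec.bind₀ ihr.call (by simp only [depth]; omega) ?_
      rintro r' _ ⟨τ, rfl, h1, h2, h3, h4, h5⟩
      split
      · refine Spec.ret ⟨?_, ?_, fun hs => hs.2.1.balRight (h3 hs.2.2), ?_, ?_⟩
        · rw [toList_balRight]
          exact (h1.cons_cons _).append_left _
        · rw [toList_balRight]
          exact length_right hx' h2
        · rintro _ n (_ | ⟨ha, hb⟩ | ⟨ha, hb⟩)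
          · obtain ⟨n', rfl, h⟩ := h4 _ _ hb
            exact (RedRed.balRight ha h).of_false (by simp)
          · obtain ⟨n', rfl, h⟩ := h4 _ _ hb
            exact ⟨_, rfl, (RedRed.balRight ha h).imp (by simp)⟩
        · simp only [depth] at h5 ⊢
          omega
      · next H =>
        refine Spec.ret ⟨(h1.cons_cons _).append_left _, length_right hx' h2,
          fun hs => hs.2.1.mk (h3 hs.2.2), ?_, ?_⟩
        · rintro _ n (_ | ⟨ha, hb⟩ | ⟨ha, hb⟩)
          · cases hb with
            | nil =>
              cases ha with
              | nil =>
                obtain ⟨c, h⟩ := h4 _ _ .nil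
                cases r' with
                | nil => exact ⟨_, .red .nil .nil⟩
                | node => simp [toList] at h1
            | black => exact absurd rfl (H _ _ _ _)
          · cases hb with
            | nil =>
              obtain ⟨c, h⟩ := h4 _ _ .nil
              exact ⟨_, rfl, .redred trivial ha h⟩
            | black => exact absurd rfl (H _ _ _ _)
            | red h6 h7 =>
              obtain ⟨c, h⟩ := h4 _ _ (.red h6 h7)
              exact ⟨_, rfl, .redred trivial ha h⟩
        · simp only [depth] at h5 ⊢
          omega
    · refine Spec.release_bind ((join_spec l r).call.mono (by simp only [depth]; omega) le_rfl ?_)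
      rintro t' _ ⟨τ, rfl, h1, h2, h3, h4⟩
      refine ⟨?_, fun _ _ => ?_, fun hs => h2 hs.2.1 hs.2.2, ?_, ?_⟩
      · rw [h1]
        exact (List.sublist_cons_self _ _).append_left _
      · rw [h1]
        simp only [toList, List.length_append, List.length_cons]
        omega
      · rintro _ n (_ | ⟨ha, hb⟩ | ⟨ha, hb⟩)
        · exact (h3 _ _ _ ha hb).of_false (fun h => h rfl rfl)
        · exact ⟨_, rfl, (h3 _ _ _ ha hb).imp fun _ => trivial⟩
      · simp only [depth]
        omega

/-- A well-formed tree with at most `N` elements. -/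
structure Good (t : RBT α) (N : ℕ) : Prop where
  sized : t.Sized
  balanced : ∃ c n, Balanced t c n
  sorted : t.toList.Pairwise (· ≤ ·)
  le : t.toList.length ≤ N

/-- The unit in which the cost of operations on trees of at most `N` elements is measured. -/
def unit (N : ℕ) : ℕ := Nat.log 2 (N + 1) + 1

theorem Good.nil (N : ℕ) : Good (nil : RBT α) N :=
  ⟨trivial, ⟨_, _, .nil⟩, List.Pairwise.nil, Nat.zero_le _⟩

theorem Good.size_eq {t : RBT α} {N : ℕ} (h : Good t N) : t.size = t.toList.length :=
  h.sized.size_eq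

theorem Good.mono {t : RBT α} {N M : ℕ} (h : Good t N) (hNM : N ≤ M) : Good t M :=
  ⟨h.sized, h.balanced, h.sorted, h.le.trans hNM⟩

/-- From here on every tree operation is measured in multiples of `unit N`, which is at least 1 and
so also absorbs constant costs. -/
theorem Good.depth_le {t : RBT α} {N : ℕ} (h : Good t N) : t.depth + 1 ≤ 2 * unit N := by
  obtain ⟨c, n, hb⟩ := h.balanced
  have := hb.depth_le_log h.le
  unfold unit
  omega

theorem unit_mono {N M : ℕ} (h : N ≤ M) : unit N ≤ unit M :=
  Nat.add_le_add_right (Nat.log_mono_right (by omega)) 1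

theorem insert_spec {N : ℕ} {t : RBT α} (x : α) (h : Good t N) :
    Spec (insert x t) (2 * unit N + 1) 1 (fun r τ => Good r (N + 1) ∧
      r.toList.length = t.toList.length + 1 ∧ τ ≤ 2 * unit N) := by
  have hd := h.depth_le
  refine Spec.bind (ins_spec x t).call (by omega) le_rfl (by omega) ?_
  rintro r _ ⟨τ, rfl, h1, h2, h3, h4, h5⟩
  obtain ⟨c, n, hb⟩ := h.balanced
  have hlen : r.toList.length = t.toList.length + 1 := h1.length_eq
  have := h.le
  refine Spec.ret ⟨⟨(h3 h.sized).setBlack, (h4 c n hb).setBlack, ?_, ?_⟩, ?_, by omega⟩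
  · rw [toList_setBlack]
    exact h2 h.sorted
  · rw [toList_setBlack]
    omega
  · rw [toList_setBlack]
    omega

/-- The exact drop in length for a stored element is what the amortisation of `Twin.deleteLoop`
consumes; for an arbitrary element the length merely does not grow. -/
theorem erase_spec {N : ℕ} {t : RBT α} (x : α) (h : Good t N) :
    Spec (erase x t) (4 * unit N) 0 (fun r τ => Good r N ∧
      r.toList.length ≤ t.toList.length ∧
      (x ∈ t.toList → r.toList.length + 1 = t.toList.length) ∧ τ ≤ 4 * unit N) := by
  have hd := h.depth_le
  refine Spec.bind₀ (del_spec x t).call (by omega) ?_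
  rintro r _ ⟨τ, rfl, h1, h2, h3, h4, h5⟩
  obtain ⟨c, n, hb⟩ := h.balanced
  have := h1.length_le
  refine Spec.ret ⟨⟨(h3 h.sized).setBlack, ?_, ?_, ?_⟩, ?_, ?_, by omega⟩
  · have := h4 c n hb
    unfold DelProp at this
    split at this
    · obtain ⟨_, _, h⟩ := this
      exact h.setBlack
    · obtain ⟨_, h⟩ := this
      exact (RedRed.balanced (p := True) h).setBlack
  · rw [toList_setBlack]
    exact h.sorted.sublist h1
  · rw [toList_setBlack]
    exact this.trans h.le
  · rw [toList_setBlack]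
    exact this
  · rw [toList_setBlack]
    exact h2 h.sorted

end RBT

open RBT (unit)

/-! ### The sweep of STBC with its twin trees -/

section Trees

variable {T : Type} [LinearOrder T]

/-- Both trees are well-formed and have at most `N` elements. -/
structure Twin.Good (h : Twin T) (N : ℕ) : Prop where
  ts : h.TS.Good N
  ta : h.TA.Good N

theorem Twin.Good.mono {h : Twin T} {N M : ℕ} (hg : h.Good N) (hNM : N ≤ M) : h.Good M :=
  ⟨hg.ts.mono hNM, hg.ta.mono hNM⟩

theorem Twin.good_empty (N : ℕ) : ({} : Twin T).Good N := ⟨.nil N, .nil N⟩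

/-- The number of stored wedges. -/
def Twin.card (h : Twin T) : ℕ := h.TA.toList.length

theorem unit_pos (N : ℕ) : 1 ≤ unit N := Nat.le_add_left 1 _

variable {N U : ℕ}

theorem Twin.insert_spec {h : Twin T} (w : T × T) (hg : h.Good N) (hU : unit N ≤ U) :
    Spec (h.insert w) (2 * U + 2) 2 (fun h' τ => h'.Good (N + 1) ∧ h'.card = h.card + 1 ∧
      τ ≤ U * 4) := by
  refine Spec.bind (RBT.insert_spec w.1 hg.ts) (by omega) (by omega) (by omega) ?_
  rintro TS τ ⟨h1, -, h3⟩
  refine Spec.bind (RBT.insert_spec (toLex (w.2, w.1)) hg.ta) (by omega) (by omega) (by omega) ?_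
  rintro TA τ' ⟨k1, k2, k3⟩
  exact Spec.ret ⟨⟨h1, k1⟩, k2, by omega⟩

theorem Twin.insert_loop_spec {h : Twin T} (ws : List (T × T)) (hg : h.Good N)
    (hU : unit (N + ws.length) ≤ U) :
    Spec (forEach ws Twin.insert h) (2 * U + 2 + 2 * ws.length) (2 * ws.length)
      (fun h' τ => h'.Good (N + ws.length) ∧ h'.card = h.card + ws.length ∧
        τ ≤ U * (5 * ws.length + 1)) := by
  have hU1 : 1 ≤ U := (unit_pos _).trans hU
  refine (Spec.forEach (s₁ := 2 * U + 2) (A := fun _ => 2) (τ := fun _ => U * 4)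
    (fun pre h' => h'.Good (N + pre.length) ∧ h'.card = h.card + pre.length) ⟨hg, rfl⟩ ?_
    ?_ ?_).weaken ?_
  · rintro pre x post b hl ⟨h1, h2⟩
    have hle : unit (N + pre.length) ≤ U := by
      refine (RBT.unit_mono ?_).trans hU
      rw [hl, List.length_append]
      omega
    refine (Twin.insert_spec x h1 hle).mono (by omega) le_rfl ?_
    rintro h' t ⟨k1, k2, k3⟩
    simp only [List.length_append, List.length_cons, List.length_nil]
    exact ⟨⟨k1, by omega⟩, k3⟩
  · simp only [List.map_const', List.sum_replicate, smul_eq_mul]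
    omega
  · simp only [List.map_const', List.sum_replicate, smul_eq_mul]
    omega
  · rintro h' t ⟨⟨h1, h2⟩, h3⟩
    refine ⟨h1, h2, ?_⟩
    simp only [List.map_const', List.sum_replicate, smul_eq_mul] at h3
    nlinarith

/-- Amortisation with potential 11U per stored wedge. A successful round takes one step, at most 2U
for `back` and 4U for each erasure, and is paid for by the wedge that disappears from `TA`; the
final round is the extra 11U. -/
theorem Twin.deleteLoop_spec (bound : T) (k : ℕ) {h : Twin T} (hg : h.Good N) (hU : unit N ≤ U) :
    Spec (Twin.deleteLoop bound k h) (4 * U) 0 (fun h' τ => h'.Good N ∧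
      τ + U * (11 * h'.card) ≤ U * (11 * h.card + 11)) := by
  have hU1 : 1 ≤ U := (unit_pos _).trans hU
  induction k generalizing h with
  | zero =>
    rw [deleteLoop]
    exact Spec.ret ⟨hg, by rw [Nat.zero_add]; exact Nat.mul_le_mul_left _ (by omega)⟩
  | succ k ih =>
    rw [deleteLoop]
    refine Spec.tick_bind ?_
    have hd := hg.ta.depth_le
    refine Spec.bind₀ (RBT.back_spec h.TA (4 * U)) le_rfl ?_
    rintro o τ ⟨ho, h1⟩
    split
    · exact Spec.ret ⟨hg, by nlinarith⟩
    · next w =>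
      -- So its erasure shortens `TA`. Nothing of the kind is needed for `TS`, as `card` refers to
      -- `TA` only.
      have hw : w ∈ h.TA.toList := List.mem_of_getLast? ho.symm
      split_ifs
      · refine Spec.bind₀ (RBT.erase_spec w hg.ta) (by omega) ?_
        rintro TA τ₁ ⟨a1, -, a3, a4⟩
        refine Spec.bind₀ (RBT.erase_spec (ofLex w).2 hg.ts) (by omega) ?_
        rintro TS τ₂ ⟨b1, -, -, b4⟩
        refine (ih (h := ⟨TS, TA⟩) ⟨b1, a1⟩).weaken ?_
        rintro h' τ₃ ⟨c1, c2⟩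
        refine ⟨c1, ?_⟩
        have e : h.card = Twin.card ⟨TS, TA⟩ + 1 := (a3 hw).symm
        rw [e]
        nlinarith
      · exact Spec.ret ⟨hg, by nlinarith⟩

theorem Twin.delete_spec (bound : T) {h : Twin T} (hg : h.Good N) (hU : unit N ≤ U) :
    Spec (h.delete bound) (4 * U) 0 (fun h' τ => h'.Good N ∧
      τ + U * (11 * h'.card) ≤ U * (11 * h.card + 12)) := by
  have hU1 : 1 ≤ U := (unit_pos _).trans hU
  refine Spec.tick_bind ((Twin.deleteLoop_spec bound _ hg hU).weaken ?_)
  rintro h' τ ⟨h1, h2⟩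
  exact ⟨h1, by nlinarith⟩

theorem Twin.dispose_spec {h : Twin T} (hg : h.Good N) (s : ℕ) :
    Spec h.dispose s 0 (fun _ τ => τ ≤ 2 * N + 1) := by
  refine Spec.tick_bind ((Spec.release _).mono (Nat.zero_le _) le_rfl ?_)
  rintro _ τ rfl
  have h1 := hg.ts.le
  have h2 := hg.ta.le
  rw [hg.ts.size_eq, hg.ta.size_eq]
  omega

theorem countTSgt_spec {h : Twin T} (x : T) (hg : h.Good N) (hU : unit N ≤ U) :
    Spec (h.countTSgt x) (2 * U) 0 (fun _ τ => τ ≤ 2 * U) := by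
  have := hg.ts.depth_le
  exact Spec.bind₀ (RBT.countWhile_spec _ _) (by omega) fun _ _ _ => Spec.ret (by omega)

theorem countTSge_spec {h : Twin T} (x : T) (hg : h.Good N) (hU : unit N ≤ U) :
    Spec (h.countTSge x) (2 * U) 0 (fun _ τ => τ ≤ 2 * U) := by
  have := hg.ts.depth_le
  exact Spec.bind₀ (RBT.countWhile_spec _ _) (by omega) fun _ _ _ => Spec.ret (by omega)

theorem countTAgt_spec {h : Twin T} (x : T) (hg : h.Good N) (hU : unit N ≤ U) :
    Spec (h.countTAgt x) (2 * U) 0 (fun _ τ => τ ≤ 2 * U) := by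
  have := hg.ta.depth_le
  exact Spec.bind₀ (RBT.countWhile_spec _ _) (by omega) fun _ _ _ => Spec.ret (by omega)

theorem countTAlt_spec {h : Twin T} (x : T) (hg : h.Good N) (hU : unit N ≤ U) :
    Spec (h.countTAlt x) (2 * U) 0 (fun _ τ => τ ≤ 2 * U) := by
  have := hg.ta.depth_le
  exact Spec.bind₀ (RBT.countWhile_spec _ _) (by omega) fun _ _ _ => Spec.ret (by omega)

theorem bump_spec (l : Bool) (i : Fin 6) (k : ℤ) (C : Counts) (s : ℕ) :
    Spec (bump l i k C) s 0 (fun C' τ =>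
      C' = Function.update C (convType l i) (C (convType l i) + k) ∧ τ = 1) :=
  Spec.tick_bind (Spec.ret ⟨rfl, rfl⟩)

theorem query_spec (l : Bool) {same opp : Twin T} (C : Counts) (w : T × T) (hs : same.Good N)
    (ho : opp.Good N) (hU : unit N ≤ U) :
    Spec (query l same opp C w) (2 * U) 0 (fun _ τ => τ ≤ U * 22) := by
  have hU1 : 1 ≤ U := (unit_pos _).trans hU
  refine Spec.bind₀ (countTSgt_spec w.2 hs hU) le_rfl fun _ t1 h1 => ?_
  refine Spec.bind₀ (bump_spec _ _ _ _ _) le_rfl fun _ t2 ⟨_, h2⟩ => ?_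
  refine Spec.bind₀ (countTAgt_spec w.2 hs hU) le_rfl fun _ t3 h3 => ?_
  refine Spec.bind₀ (countTSge_spec w.2 hs hU) le_rfl fun _ t4 h4 => ?_
  refine Spec.bind₀ (bump_spec _ _ _ _ _) le_rfl fun _ t5 ⟨_, h5⟩ => ?_
  refine Spec.bind₀ (countTAlt_spec w.2 hs hU) le_rfl fun _ t6 h6 => ?_
  refine Spec.bind₀ (bump_spec _ _ _ _ _) le_rfl fun _ t7 ⟨_, h7⟩ => ?_
  refine Spec.bind₀ (countTSgt_spec w.2 ho hU) le_rfl fun _ t8 h8 => ?_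
  refine Spec.bind₀ (bump_spec _ _ _ _ _) le_rfl fun _ t9 ⟨_, h9⟩ => ?_
  refine Spec.bind₀ (countTAgt_spec w.2 ho hU) le_rfl fun _ t10 h10 => ?_
  refine Spec.bind₀ (countTSge_spec w.2 ho hU) le_rfl fun _ t11 h11 => ?_
  refine Spec.bind₀ (bump_spec _ _ _ _ _) le_rfl fun _ t12 ⟨_, h12⟩ => ?_
  refine Spec.bind₀ (countTAlt_spec w.2 ho hU) le_rfl fun _ t13 h13 => ?_
  refine (bump_spec _ _ _ _ _).weaken fun _ t14 ⟨_, h14⟩ => ?_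
  omega

theorem query_loop_spec (l : Bool) {same opp : Twin T} (C : Counts) (ws : List (T × T))
    (hs : same.Good N) (ho : opp.Good N) (hU : unit N ≤ U) :
    Spec (forEach ws (query l same opp) C) (2 * U) 0
      (fun _ τ => τ ≤ U * (23 * ws.length + 1)) := by
  have hU1 : 1 ≤ U := (unit_pos _).trans hU
  refine (Spec.forEach (s₁ := 2 * U) (A := fun _ => 0) (τ := fun _ => U * 22)
    (fun _ _ => True) trivial ?_ ?_ ?_).weaken ?_
  · intro pre x post b _ _
    exact (query_spec l b x hs ho hU).weaken fun _ _ h => ⟨trivial, h⟩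
  · simp
  · simp
  · rintro h' t ⟨-, h3⟩
    simp only [List.map_const', List.sum_replicate, smul_eq_mul] at h3
    nlinarith

theorem clog_le_unit (n : ℕ) : Nat.clog 2 n ≤ unit n := by
  unfold unit
  rw [Nat.clog_le_iff_le_pow (by norm_num)]
  have := Nat.lt_pow_succ_log_self (b := 2) (by norm_num) (n + 1)
  exact (Nat.le_succ n).trans this.le

theorem msort_unit_spec {α : Type} (le : α → α → Bool) (l : List α) (hU : unit l.length ≤ U) :
    Spec (call (msort le l)) (4 * l.length + 1) 0 (fun r τ => r.Perm l ∧
      τ ≤ U * (7 * l.length + 2) ∧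
      ((∀ x y, le x y ∨ le y x) → (∀ x y z, le x y → le y z → le x z) →
        r.Pairwise (fun x y => le x y))) := by
  have hU1 : 1 ≤ U := (unit_pos _).trans hU
  refine (msort_spec le l).call.mono (by omega) le_rfl ?_
  rintro r _ ⟨t, rfl, h1, h2, h3⟩
  refine ⟨h1, ?_, h3⟩
  have hc := Nat.mul_le_mul_left l.length ((clog_le_unit l.length).trans hU)
  have hUN : l.length ≤ U * l.length := Nat.le_mul_of_pos_left _ hU1
  have : l.length * U = U * l.length := Nat.mul_comm _ _
  linarith

theorem WedgeSet.sort_spec (s : WedgeSet T) (hU : unit (s.A.length + s.D.length) ≤ U) :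
    Spec s.sort (4 * (s.A.length + s.D.length) + 1) 0 (fun r τ =>
      r.A.length = s.A.length ∧ r.D.length = s.D.length ∧
      τ ≤ U * (7 * (s.A.length + s.D.length) + 4)) := by
  refine Spec.bind₀ (msort_unit_spec _ s.A ((RBT.unit_mono (by omega)).trans hU)) (by omega) ?_
  rintro A t1 ⟨a1, a2, -⟩
  refine Spec.bind₀ (msort_unit_spec _ s.D ((RBT.unit_mono (by omega)).trans hU)) (by omega) ?_
  rintro D t2 ⟨b1, b2, -⟩
  exact Spec.ret ⟨a1.length_eq, b1.length_eq, by linarith⟩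

/-- All trees are well-formed and have at most `N` elements. -/
structure Trees.Good (h : Trees T) (N : ℕ) : Prop where
  Ai : h.Ai.Good N
  Di : h.Di.Good N
  Aj : h.Aj.Good N
  Dj : h.Dj.Good N

/-- The number of stored wedges. -/
def Trees.card (h : Trees T) : ℕ := h.Ai.card + h.Di.card + h.Aj.card + h.Dj.card

theorem Quad.now_add_later (q : Quad T) (m : T) :
    (q.now m).length + (q.later m).length = q.length := by
  have key (l : List (T × T)) : (l.takeWhile (fun w => decide (w.1 = m))).length +
      (l.dropWhile (fun w => decide (w.1 = m))).length = l.length := by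
    rw [← List.length_append, List.takeWhile_append_dropWhile]
  have h1 := key q.Ai
  have h2 := key q.Di
  have h3 := key q.Aj
  have h4 := key q.Dj
  simp only [Quad.now, Quad.later, Quad.length]
  omega

variable [AddCommGroup T]

/-- A wedge of the current round costs 23U for its query and 5U for its insertion, and deposits 11U
for its later erasure. The fixed cost of a round, at most 57U for four deletions, eight loop starts
and a step, is charged to one of its wedges, which exists because `m` is attained at some pointer.
In space each wedge occupies one node in either tree of its twin; the bound does not credit erased
nodes. -/
theorem setCrossLoop_spec (l : Bool) (δ : T) (q : Quad T) (h : Trees T) (C : Counts)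
    (hg : h.Good N) (hU : unit (N + q.length) ≤ U) :
    Spec (setCrossLoop l δ q h C) (2 * q.length + (4 * U + 2)) (2 * q.length) (fun r τ =>
      r.1.Good (N + q.length) ∧ τ ≤ U * (11 * h.card) + U * (100 * q.length) + 1) := by
  have hU1 : 1 ≤ U := (unit_pos _).trans hU
  induction hn : q.length using Nat.strong_induction_on generalizing q h C N with
  | _ n ih =>
    rw [setCrossLoop]
    refine Spec.tick_bind ?_
    split
    · refine Spec.ret ⟨?_, by omega⟩
      exact ⟨hg.Ai.mono (by omega), hg.Di.mono (by omega), hg.Aj.mono (by omega),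
        hg.Dj.mono (by omega)⟩
    · next m hm =>
      have hlt := Quad.length_later_lt hm
      have hsum := q.now_add_later m
      have hU0 : unit N ≤ U := (RBT.unit_mono (by omega)).trans hU
      obtain ⟨Ai, Di, Aj, Dj⟩ := h
      obtain ⟨g1, g2, g3, g4⟩ := hg
      simp only at g1 g2 g3 g4 ⊢
      refine Spec.bind₀ (Twin.delete_spec _ g1 hU0) (by omega) fun Ai' t1 ⟨d1, e1⟩ => ?_
      refine Spec.bind₀ (Twin.delete_spec _ g2 hU0) (by omega) fun Di' t2 ⟨d2, e2⟩ => ?_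
      refine Spec.bind₀ (Twin.delete_spec _ g3 hU0) (by omega) fun Aj' t3 ⟨d3, e3⟩ => ?_
      refine Spec.bind₀ (Twin.delete_spec _ g4 hU0) (by omega) fun Dj' t4 ⟨d4, e4⟩ => ?_
      refine Spec.bind₀ (query_loop_spec l _ _ d3 d4 hU0) (by omega) fun _ t5 e5 => ?_
      refine Spec.bind₀ (query_loop_spec l _ _ d4 d3 hU0) (by omega) fun _ t6 e6 => ?_
      refine Spec.bind₀ (query_loop_spec l _ _ d1 d2 hU0) (by omega) fun _ t7 e7 => ?_
      refine Spec.bind₀ (query_loop_spec l _ _ d2 d1 hU0) (by omega) fun C' t8 e8 => ?_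
      have hnow : (q.now m).length = (q.now m).Ai.length + (q.now m).Di.length +
        (q.now m).Aj.length + (q.now m).Dj.length := rfl
      have hU' : ∀ k ≤ (q.now m).length, unit (N + k) ≤ U := fun k hk =>
        (RBT.unit_mono (by omega)).trans hU
      refine Spec.bind (Twin.insert_loop_spec (q.now m).Ai d1 (hU' _ (by omega))) (by omega)
        (by omega) (by omega) fun Ai'' t9 ⟨i1, j1, e9⟩ => ?_
      refine Spec.bind (Twin.insert_loop_spec (q.now m).Di d2 (hU' _ (by omega))) (by omega)
        (by omega) (by omega) fun Di'' t10 ⟨i2, j2, e10⟩ => ?_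
      refine Spec.bind (Twin.insert_loop_spec (q.now m).Aj d3 (hU' _ (by omega))) (by omega)
        (by omega) (by omega) fun Aj'' t11 ⟨i3, j3, e11⟩ => ?_
      refine Spec.bind (Twin.insert_loop_spec (q.now m).Dj d4 (hU' _ (by omega))) (by omega)
        (by omega) (by omega) fun Dj'' t12 ⟨i4, j4, e12⟩ => ?_
      refine (ih (q.later m).length (by omega) (q.later m) ⟨Ai'', Di'', Aj'', Dj''⟩ C'
        (N := N + (q.now m).length)
        ⟨i1.mono (by omega), i2.mono (by omega), i3.mono (by omega), i4.mono (by omega)⟩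
        ((RBT.unit_mono (by omega)).trans hU) rfl).mono (by omega) (by omega) ?_
      rintro r t13 ⟨⟨f1, f2, f3, f4⟩, e13⟩
      refine ⟨⟨f1.mono (by omega), f2.mono (by omega), f3.mono (by omega), f4.mono (by omega)⟩,
        ?_⟩
      -- The round is not empty, because `q.later m` is strictly shorter than `q`.
      have hpos : U * 1 ≤ U * (q.now m).length := Nat.mul_le_mul_left _ (by omega)
      simp only [Trees.card, j1, j2, j3, j4] at e13 ⊢
      rw [← hn, ← hsum]
      rw [hnow] at hpos ⊢
      linarith

/-- The sweep contributes 100UN + 1, as the trees start without any potential, and disposing of the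
four twins at most 4(2N + 1). -/
theorem setCross_spec (l : Bool) (δ : T) (Si Sj : WedgeSet T)
    (hN : Si.A.length + Si.D.length + Sj.A.length + Sj.D.length = N) (hU : unit N ≤ U) :
    Spec (setCross l δ Si Sj) (2 * N + (4 * U + 2)) (2 * N) (fun _ τ => τ ≤ U * (108 * N + 5)) := by
  have hU1 : 1 ≤ U := (unit_pos _).trans hU
  have hq : Quad.length ⟨Si.A, Si.D, Sj.A, Sj.D⟩ = N := hN
  have hg : ({} : Trees T).Good 0 :=
    ⟨Twin.good_empty 0, Twin.good_empty 0, Twin.good_empty 0, Twin.good_empty 0⟩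
  refine Spec.bind (setCrossLoop_spec (U := U) l δ ⟨Si.A, Si.D, Sj.A, Sj.D⟩ {} 0 hg
    (by rw [hq, Nat.zero_add]; exact hU)) (by rw [hq]) (by rw [hq]) (by omega) ?_
  rintro ⟨h, C⟩ t0 ⟨⟨g1, g2, g3, g4⟩, e0⟩
  rw [hq, Nat.zero_add] at g1 g2 g3 g4
  rw [hq] at e0
  refine Spec.bind₀ (Twin.dispose_spec g1 _) le_rfl fun _ t1 e1 => ?_
  refine Spec.bind₀ (Twin.dispose_spec g2 _) le_rfl fun _ t2 e2 => ?_
  refine Spec.bind₀ (Twin.dispose_spec g3 _) le_rfl fun _ t3 e3 => ?_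
  refine Spec.bind₀ (Twin.dispose_spec g4 _) le_rfl fun _ t4 e4 => ?_
  refine Spec.ret ?_
  have hc : Trees.card ({} : Trees T) = 0 := rfl
  have hUN : N ≤ U * N := Nat.le_mul_of_pos_left _ hU1
  rw [hc] at e0
  linarith

end Trees

theorem sum_map_le_sum_map {α : Type} {l : List α} {f g : α → ℕ} (h : ∀ x ∈ l, f x ≤ g x) :
    (l.map f).sum ≤ (l.map g).sum :=
  List.sum_le_sum h

theorem sum_map_mul_left {α : Type} (l : List α) (f : α → ℕ) (k : ℕ) :
    (l.map fun x => k * f x).sum = k * (l.map f).sum :=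
  List.sum_map_mul_left l f k

theorem sum_map_le_of_sublist {α : Type} {l₁ l₂ : List α} (f : α → ℕ) (h : l₁.Sublist l₂) :
    (l₁.map f).sum ≤ (l₂.map f).sum :=
  (h.map f).sum_le_sum (fun _ _ => Nat.zero_le _)

/-! ### Hash maps -/

namespace HMap

variable {V β : Type}

/-- The listed keys are exactly the keys that have an entry. -/
structure WF (H : HMap V β) : Prop where
  nodup : H.keys.Nodup
  mem_keys : ∀ w, w ∈ H.keys ↔ (H.find w).isSome

theorem WF.empty : (HMap.empty : HMap V β).WF :=
  ⟨List.nodup_nil, fun w => by simp [HMap.empty]⟩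

theorem get_spec (H : HMap V β) (w : V) (s : ℕ) :
    Spec (H.get w) s 0 (fun r τ => r = H.find w ∧ τ = 1) :=
  Spec.tick_bind (Spec.ret ⟨rfl, rfl⟩)

/-- The weight of the entry of `w` with respect to a size function. -/
def weight (sz : β → ℕ) (H : HMap V β) (w : V) : ℕ := (H.find w).elim 0 fun b => sz b + 1

variable [DecidableEq V]

theorem modify_spec (H : HMap V β) (w : V) (new : β) (f : β → β) :
    Spec (H.modify w new f) 1 1 (fun H' τ =>
      H'.find = Function.update H.find w (some (f ((H.find w).getD new))) ∧
      (H.WF → H'.WF) ∧ τ = 1) := by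
  refine Spec.tick_bind ?_
  split
  · next b hb =>
    refine Spec.ret ⟨by rw [hb, Option.getD_some], fun h => ⟨h.nodup, fun x => ?_⟩, rfl⟩
    by_cases hx : x = w
    · subst hx
      simp [h.mem_keys, hb]
    · simp [Function.update_of_ne hx, h.mem_keys]
  · next hb =>
    refine Spec.alloc_bind le_rfl le_rfl (Spec.ret ⟨by rw [hb, Option.getD_none], fun h => ⟨?_, ?_⟩, rfl⟩)
    · refine List.nodup_cons.2 ⟨?_, h.nodup⟩
      rw [h.mem_keys, hb]
      simp
    · intro x
      by_cases hx : x = w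
      · subst hx
        simp
      · simp [h.mem_keys, hx]

theorem modify_present_spec (H : HMap V β) (w : V) (new b : β) (f : β → β) (s : ℕ)
    (hb : H.find w = some b) :
    Spec (H.modify w new f) s 0 (fun H' τ =>
      H'.find = Function.update H.find w (some (f b)) ∧ τ = 1) := by
  refine Spec.tick_bind ?_
  rw [hb]
  exact Spec.ret ⟨rfl, rfl⟩

variable [Fintype V]

/-- Stated as an equation between sums, with the old value on the left, so that no truncated
subtraction occurs. -/
theorem sum_update_weight (F : V → Option β) (g : Option β → ℕ) (w : V) (o : Option β) :
    ∑ x, g (Function.update F w o x) + g (F w) = ∑ x, g (F x) + g o := by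
  rw [← Finset.add_sum_erase _ _ (Finset.mem_univ w), ← Finset.add_sum_erase _ _ (Finset.mem_univ w),
    Function.update_self]
  have : ∑ x ∈ Finset.univ.erase w, g (Function.update F w o x) =
      ∑ x ∈ Finset.univ.erase w, g (F x) :=
    Finset.sum_congr rfl fun x hx => by rw [Function.update_of_ne (Finset.ne_of_mem_erase hx)]
  rw [this]
  omega

end HMap

/-! ### The cost of STBC -/

section STBCCost

variable {V T : Type}

/-- `D x` bounds the size of the array of `x`, and the total of these bounds over the entries of
the array of `u` is at most `n`. -/
structure Store.Fits (S : Store V T) (D : V → ℕ) (r : Req V T) (n : ℕ) : Prop where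
  size_le : ∀ x, (S x).size ≤ D x
  pos : ∀ p ∈ (S r.u).toList, 1 ≤ D p.1
  sum_le : ((S r.u).toList.map fun p => D p.1).sum ≤ n
  mid_le : D r.v ≤ n
  one_le : 1 ≤ n

theorem Store.Fits.start_le {S : Store V T} {D : V → ℕ} {r : Req V T} {n : ℕ} (h : S.Fits D r n) :
    (S r.u).size ≤ n := by
  refine le_trans ?_ h.sum_le
  have h1 := sum_map_le_sum_map (f := fun _ => 1) h.pos
  have h2 : ((S r.u).toList.map fun _ => 1).sum = (S r.u).size := by simp
  omega

variable [LinearOrder T]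

/-- The number of wedges. -/
def WedgePair.card (s : WedgePair T) : ℕ :=
  s.other.A.length + s.other.D.length + s.mid.A.length + s.mid.D.length

theorem WedgeSet.add_length (s : WedgeSet T) (t₁ t₂ : T) :
    (s.add t₁ t₂).A.length + (s.add t₁ t₂).D.length ≤ s.A.length + s.D.length + 1 := by
  unfold WedgeSet.add
  split_ifs
  · simp only [List.length_cons]
    omega
  · simp only [List.length_cons]
    omega
  · omega

variable [DecidableEq V] [Fintype V]

/-- The total weight of the entries of a hash map of wedges. -/
def wedgeTotal (H : HMap V (WedgePair T)) : ℕ := ∑ w, H.weight WedgePair.card w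

/-- The weight grows by one for the wedge and by another one if the entry is new. The same two
records are the cells that are allocated. -/
theorem addWedge_spec (w : V) (isMid : Bool) (t₁ t₂ : T) (H : HMap V (WedgePair T)) (h : H.WF) :
    Spec (addWedge w isMid t₁ t₂ H) 2 2 (fun H' τ =>
      H'.WF ∧ wedgeTotal H' ≤ wedgeTotal H + 2 ∧ τ ≤ 1) := by
  refine Spec.alloc_bind (by omega) (by omega) ((HMap.modify_spec H w _ _).weaken ?_)
  rintro H' τ ⟨h1, h2, rfl⟩
  refine ⟨h2 h, ?_, le_rfl⟩
  have key := HMap.sum_update_weight H.find (fun o => o.elim 0 fun b => WedgePair.card b + 1) w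
    (some (if isMid then { (H.find w).getD {} with mid := ((H.find w).getD {}).mid.add t₁ t₂ }
      else { (H.find w).getD {} with other := ((H.find w).getD {}).other.add t₁ t₂ }))
  rw [← h1] at key
  change wedgeTotal H' + _ = wedgeTotal H + _ at key
  have hle : ∀ s : WedgePair T, WedgePair.card (if isMid then { s with mid := s.mid.add t₁ t₂ }
      else { s with other := s.other.add t₁ t₂ }) ≤ s.card + 1 := by
    intro s
    have h1 := s.mid.add_length t₁ t₂
    have h2 := s.other.add_length t₁ t₂
    split_ifs <;> simp only [WedgePair.card] <;> omega
  have := hle ((H.find w).getD {})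
  have hempty : WedgePair.card ({} : WedgePair T) = 0 := rfl
  cases hw : H.find w with
  | none =>
    rw [hw] at key this
    simp only [Option.elim_none, Option.elim_some, Option.getD_none] at key this
    omega
  | some s =>
    rw [hw] at key this
    simp only [Option.elim_some, Option.getD_some] at key this
    omega

/-- A loop over edges that adds at most one wedge per edge. -/
theorem addWedge_loop_spec (fs : List (V × T)) (p : V × T → Prop) [DecidablePred p] (isMid : Bool)
    (t₁ : T) (H : HMap V (WedgePair T)) (h : H.WF) :
    Spec (forEach fs (fun H f => if p f then addWedge f.1 isMid t₁ f.2 H else pure H) H)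
      (2 * fs.length) (2 * fs.length) (fun H' τ =>
      H'.WF ∧ wedgeTotal H' ≤ wedgeTotal H + 2 * fs.length ∧ τ ≤ 2 * fs.length + 1) := by
  refine (Spec.forEach (s₁ := 0) (A := fun _ => 2) (τ := fun _ => 1)
    (fun pre H' => H'.WF ∧ wedgeTotal H' ≤ wedgeTotal H + 2 * pre.length) ⟨h, by simp⟩ ?_
    ?_ ?_).weaken ?_
  · rintro pre x post b - ⟨h1, h2⟩
    simp only [List.length_append, List.length_cons, List.length_nil]
    split_ifs
    · refine (addWedge_spec _ _ _ _ _ h1).mono (by omega) le_rfl ?_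
      rintro H' τ ⟨k1, k2, k3⟩
      exact ⟨⟨k1, by omega⟩, k3⟩
    · exact Spec.ret ⟨⟨h1, by omega⟩, by omega⟩
  · simp only [List.map_const', List.sum_replicate, smul_eq_mul]
    omega
  · simp only [List.map_const', List.sum_replicate, smul_eq_mul]
    omega
  · rintro H' τ ⟨⟨h1, h2⟩, h3⟩
    simp only [List.map_const', List.sum_replicate, smul_eq_mul] at h3
    exact ⟨h1, h2, by omega⟩

variable [AddCommGroup T]

/-- For an entry e of E(u), the two binary searches and the inner loop cost at most 9D(e.1), using
log D ≤ D and D ≥ 1; summation over E(u) gives a linear bound. At most n wedges of each kind, of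
weight at most 2 each, make up 4n. -/
theorem stbcWedges_spec {S : Store V T} {D : V → ℕ} {n : ℕ} (δ : T) (r : Req V T)
    (hF : S.Fits D r n) :
    Spec (stbcWedges S δ r) (4 * n) (4 * n) (fun H τ =>
      H.WF ∧ wedgeTotal H ≤ 4 * n ∧ τ ≤ 30 * n) := by
  have hlog : ∀ x, Nat.log 2 (S x).size ≤ D x := fun x =>
    (Nat.log_le_self _ _).trans (hF.size_le x)
  have hu := hF.start_le
  have hlogu := (Nat.log_le_self 2 (S r.u).size).trans hu
  have hv := hF.mid_le
  have hlogv := hlog r.v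
  have hn := hF.one_le
  refine Spec.bind₀ (window_spec _ _ _ _ _) le_rfl ?_
  rintro es t1 ⟨hes, e1⟩
  have hsum : (es.map fun p => D p.1).sum ≤ n := (sum_map_le_of_sublist _ hes).trans hF.sum_le
  refine Spec.bind (Spec.forEach (s₁ := 0) (A := fun e => 2 * D e.1) (τ := fun e => 9 * D e.1)
    (s := 2 * n) (a := 2 * n)
    (fun pre H' => H'.WF ∧ wedgeTotal H' ≤ 2 * (pre.map fun p => D p.1).sum)
    ⟨HMap.WF.empty, by simp [wedgeTotal, HMap.weight, HMap.empty]⟩ ?_ ?_ ?_) (by omega) (by omega)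
    (by omega) ?_
  · rintro pre e post H hl ⟨h1, h2⟩
    have hmem : e ∈ es := by rw [hl]; simp
    have hpos := hF.pos e (hes.subset hmem)
    simp only [List.map_append, List.map_cons, List.map_nil, List.sum_append, List.sum_cons,
      List.sum_nil]
    split_ifs
    · refine Spec.bind₀ (window_spec _ _ _ _ _) le_rfl ?_
      rintro fs t2 ⟨hfs, e2⟩
      have hlen : fs.length ≤ D e.1 := hfs.length_le.trans (by simpa using hF.size_le e.1)
      have hl := hlog e.1
      refine (addWedge_loop_spec fs _ false e.2 H h1).mono (by omega) (by omega) ?_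
      rintro H' t3 ⟨k1, k2, k3⟩
      exact ⟨⟨k1, by omega⟩, by omega⟩
    · exact Spec.ret ⟨⟨h1, by omega⟩, Nat.zero_le _⟩
  · rw [sum_map_mul_left]
    omega
  · rw [sum_map_mul_left]
    omega
  · rintro H t4 ⟨⟨h1, h2⟩, e4⟩
    refine Spec.bind₀ (window_spec _ _ _ _ _) le_rfl ?_
    rintro fs t5 ⟨hfs, e5⟩
    have hlen : fs.length ≤ n := hfs.length_le.trans (by simpa using (hF.size_le r.v).trans hv)
    refine (addWedge_loop_spec fs _ true r.t H h1).mono (by omega) (by omega) ?_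
    rintro H' t6 ⟨k1, k2, k3⟩
    refine ⟨k1, by omega, ?_⟩
    have hE : (es.map fun e => 9 * D e.1 + 1).sum ≤ 10 * n := by
      refine le_trans (sum_map_le_sum_map (g := fun e => 10 * D e.1) fun e he => ?_) ?_
      · have := hF.pos e (hes.subset he)
        omega
      · rw [sum_map_mul_left]
        omega
    omega

theorem unit_le_self (N : ℕ) : unit N ≤ N + 1 := by
  unfold unit
  have := Nat.log_lt_self 2 (x := N + 1) (by omega)
  omega

theorem unit_four_mul_le {n : ℕ} : unit (4 * n) ≤ 3 * unit n := by
  unfold unit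
  have h : Nat.log 2 (4 * n + 1) ≤ Nat.log 2 ((n + 1) * 2 * 2) := Nat.log_mono_right (by omega)
  rw [Nat.log_mul_base (by norm_num) (by omega), Nat.log_mul_base (by norm_num) (by omega)] at h
  omega

theorem sum_weight_le {β : Type} (sz : β → ℕ) (H : HMap V β) (h : H.WF) :
    (H.keys.map (H.weight sz)).sum ≤ ∑ w, H.weight sz w := by
  rw [← List.sum_toFinset _ h.nodup]
  exact Finset.sum_le_sum_of_subset (Finset.subset_univ _)

/-- With weight = wedges + 1, the work on an entry of the hash map is at most 140U times its weight:
7 per wedge for sorting, 108 for the sweep, and constants absorbed by the +1. Summing over entries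
of total weight at most 4n, with U = `unit (4 * n)` ≤ 3 `unit n`, yields the bound. -/
theorem stbcCount_spec {S : Store V T} {D : V → ℕ} {n : ℕ} (upper : V → Bool) (δ : T)
    (r : Req V T) (hF : S.Fits D r n) :
    Spec (stbcCount upper S δ r) (70 * n) (12 * n) (fun _ τ => τ ≤ 2000 * (n * unit n)) := by
  have hn := hF.one_le
  set U := unit (4 * n) with hU
  have hU1 : 1 ≤ U := unit_pos _
  have hUn : U ≤ 4 * n + 1 := unit_le_self _
  refine Spec.bind (stbcWedges_spec δ r hF) (by omega) (by omega) (by omega) ?_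
  rintro H t1 ⟨h1, h2, e1⟩
  have hW := (sum_weight_le WedgePair.card H h1).trans h2
  -- Sorting the wedges of one entry takes at most 16n + 1 cells of scratch space, and the sweep 4U
  -- + 2 beyond its tree nodes. The tree nodes are booked as leftover `A`, without credit for their
  -- disposal.
  refine (Spec.forEach (s₁ := 16 * n + 1 + (4 * U + 2)) (A := fun w => 2 * H.weight WedgePair.card w)
    (τ := fun w => U * (140 * H.weight WedgePair.card w))
    (fun _ _ => True) trivial ?_ ?_ ?_).weaken ?_
  · rintro pre w post C hl -
    have hw : w ∈ H.keys := by rw [hl]; simp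
    refine Spec.bind₀ (H.get_spec w _) le_rfl ?_
    rintro o _ ⟨rfl, rfl⟩
    rw [h1.mem_keys] at hw
    obtain ⟨s, hs⟩ := Option.isSome_iff_exists.1 hw
    have hwt : H.weight WedgePair.card w = s.card + 1 := by rw [HMap.weight, hs]; rfl
    have hwle : H.weight WedgePair.card w ≤ 4 * n :=
      (Finset.single_le_sum (fun _ _ => Nat.zero_le _) (Finset.mem_univ w)).trans h2
    rw [hs]
    have hbase : 1 ≤ U * (140 * (s.card + 1)) := Nat.mul_pos (by omega) (by omega)
    simp only [hwt] at hwle ⊢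
    have hcard : s.card = s.other.A.length + s.other.D.length + s.mid.A.length +
      s.mid.D.length := rfl
    split_ifs
    · exact Spec.ret ⟨trivial, hbase⟩
    · refine Spec.bind₀ (s.other.sort_spec (U := U) (RBT.unit_mono (by omega))) (by omega) ?_
      rintro other t2 ⟨a1, a2, a3⟩
      refine Spec.bind₀ (s.mid.sort_spec (U := U) (RBT.unit_mono (by omega))) (by omega) ?_
      rintro mid t3 ⟨b1, b2, b3⟩
      refine Spec.bind (setCross_spec (U := U) (N := s.card) (!upper r.u) δ other mid
        (by rw [a1, a2, b1, b2, hcard]) (RBT.unit_mono (by omega))) (by omega) (by omega)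
        (by omega) ?_
      rintro D t4 e4
      refine Spec.tick_bind (Spec.ret ⟨trivial, ?_⟩)
      rw [hcard] at e4 ⊢
      linarith
  · rw [sum_map_mul_left]
    omega
  · rw [sum_map_mul_left]
    omega
  · rintro _ t2 ⟨-, e2⟩
    clear_value U
    have e3 : (H.keys.map fun w => U * (140 * H.weight WedgePair.card w) + 1).sum ≤
        (141 * U) * (4 * n) := by
      refine le_trans (sum_map_le_sum_map (g := fun w => 141 * U * H.weight WedgePair.card w)
        fun w hw => ?_) ?_
      · rw [h1.mem_keys] at hw
        obtain ⟨s, hs⟩ := Option.isSome_iff_exists.1 hw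
        have hwt : H.weight WedgePair.card w = s.card + 1 := by rw [HMap.weight, hs]; rfl
        rw [hwt]
        nlinarith
      · rw [sum_map_mul_left]
        exact Nat.mul_le_mul_left _ hW
    have hU3 : U ≤ 3 * unit n := hU ▸ unit_four_mul_le
    have h5 : U * n ≤ 3 * unit n * n := Nat.mul_le_mul_right _ hU3
    have h6 : n ≤ n * unit n := Nat.le_mul_of_pos_right _ (unit_pos n)
    nlinarith

end STBCCost

/-! ### Rank queries in the sorted arrays of STBC⁺ -/

section PlusArrays

variable {T : Type}

/-- The arrays hold the first and the second components of the pairs in `L`. -/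
structure TimeArrays.Holds (a : TimeArrays T) (L : List (T × T)) : Prop where
  vs : a.VS.toList.Perm (L.map Prod.fst)
  va : a.VA.toList.Perm (L.map Prod.snd)

/-- Both arrays are sorted. -/
structure TimeArrays.Sorted [LinearOrder T] (a : TimeArrays T) : Prop where
  vs : a.VS.toList.Pairwise (· ≤ ·)
  va : a.VA.toList.Pairwise (· ≤ ·)

theorem TimeArrays.Holds.size_vs {a : TimeArrays T} {L : List (T × T)} (h : a.Holds L) :
    a.VS.size = L.length := by
  simpa using h.vs.length_eq

theorem TimeArrays.Holds.size_va {a : TimeArrays T} {L : List (T × T)} (h : a.Holds L) :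
    a.VA.size = L.length := by
  simpa using h.va.length_eq

theorem TimeArrays.Holds.push {a : TimeArrays T} {L : List (T × T)} (h : a.Holds L) (x y : T) :
    (a.push x y).Holds (L ++ [(x, y)]) :=
  ⟨by simpa [TimeArrays.push] using h.vs.append_right [x],
    by simpa [TimeArrays.push] using h.va.append_right [y]⟩

variable [LinearOrder T] {U : ℕ}

theorem sortArray_spec (a : Array T) (hU : unit a.size ≤ U) :
    Spec (sortArray a) (4 * a.size + 1) 0 (fun b τ => b.toList.Perm a.toList ∧
      b.toList.Pairwise (· ≤ ·) ∧ τ ≤ U * (8 * a.size + 3)) := by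
  have hU1 : 1 ≤ U := (unit_pos _).trans hU
  refine Spec.tick_bind (Spec.bind₀ (msort_unit_spec (U := U) _ a.toList (by simpa using hU))
    (by simp) ?_)
  rintro l t ⟨h1, h2, h3⟩
  refine Spec.ret ⟨h1, ?_, ?_⟩
  · have := h3 (fun x y => by simpa using le_total x y)
      (fun x y z => by simpa using le_trans)
    simpa using this
  · simp only [Array.length_toList] at h2
    nlinarith

theorem TimeArrays.sort_spec {a : TimeArrays T} {L : List (T × T)} (ha : a.Holds L)
    (hU : unit L.length ≤ U) :
    Spec a.sort (4 * L.length + 1) 0 (fun b τ => b.Holds L ∧ b.Sorted ∧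
      τ ≤ U * (16 * L.length + 6)) := by
  refine Spec.bind₀ (sortArray_spec (U := U) a.VS (by rwa [ha.size_vs])) (by rw [ha.size_vs]) ?_
  rintro VS t1 ⟨a1, a2, a3⟩
  refine Spec.bind₀ (sortArray_spec (U := U) a.VA (by rwa [ha.size_va])) (by rw [ha.size_va]) ?_
  rintro VA t2 ⟨b1, b2, b3⟩
  rw [ha.size_vs] at a3
  rw [ha.size_va] at b3
  exact Spec.ret ⟨⟨a1.trans ha.vs, b1.trans ha.va⟩, ⟨a2, b2⟩, by linarith⟩

theorem log_add_two_le_unit {k : ℕ} (hU : unit k ≤ U) : Nat.log 2 k + 2 ≤ 2 * U := by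
  have : Nat.log 2 k ≤ Nat.log 2 (k + 1) := Nat.log_mono_right (by omega)
  unfold unit at hU
  omega

/-- The value is expressed by the unsorted list `l`, since a count is invariant under permutation.
The specification of a query can thus speak of the wedges in the order of their enumeration. -/
theorem countLt_spec {a : Array T} {l : List T} (x : T) (s : ℕ) (hs : a.toList.Pairwise (· ≤ ·))
    (hl : a.toList.Perm l) (hU : unit l.length ≤ U) :
    Spec (countLt a x) s 0 (fun k τ => k = (l.countP (fun y => decide (y < x)) : ℤ) ∧
      τ ≤ 2 * U) := by
  refine Spec.bind₀ (bsearch_full_spec a _ (hs.imp fun {y z} h => ?_) s 0) le_rfl ?_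
  · simpa using fun hz => h.trans_lt hz
  · rintro k t ⟨rfl, h⟩
    have hlen : a.size = l.length := by simpa using hl.length_eq
    have := log_add_two_le_unit hU
    rw [hlen] at h
    exact Spec.ret ⟨by rw [hl.countP_eq], by omega⟩

theorem countLe_spec {a : Array T} {l : List T} (x : T) (s : ℕ) (hs : a.toList.Pairwise (· ≤ ·))
    (hl : a.toList.Perm l) (hU : unit l.length ≤ U) :
    Spec (countLe a x) s 0 (fun k τ => k = (l.countP (fun y => decide (y ≤ x)) : ℤ) ∧
      τ ≤ 2 * U) := by
  refine Spec.bind₀ (bsearch_full_spec a _ (hs.imp fun {y z} h => ?_) s 0) le_rfl ?_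
  · simpa using fun hz => h.trans hz
  · rintro k t ⟨rfl, h⟩
    have hlen : a.size = l.length := by simpa using hl.length_eq
    have := log_add_two_le_unit hU
    rw [hlen] at h
    exact Spec.ret ⟨by rw [hl.countP_eq], by omega⟩

theorem countGe_spec {a : Array T} {l : List T} (x : T) (s : ℕ) (hs : a.toList.Pairwise (· ≤ ·))
    (hl : a.toList.Perm l) (hU : unit l.length ≤ U) :
    Spec (countGe a x) s 0 (fun k τ => k = (l.countP (fun y => decide (x ≤ y)) : ℤ) ∧
      τ ≤ 2 * U) := by
  refine Spec.bind₀ (countLt_spec x s hs hl hU) le_rfl ?_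
  rintro k t ⟨rfl, h⟩
  refine Spec.ret ⟨?_, h⟩
  have hlen : a.size = l.length := by simpa using hl.length_eq
  have := l.length_eq_countP_add_countP (fun y => decide (y < x))
  have e : l.countP (fun y => decide (¬decide (y < x) = true)) =
      l.countP (fun y => decide (x ≤ y)) := List.countP_congr fun y _ => by simp
  rw [e] at this
  omega

theorem countGt_spec {a : Array T} {l : List T} (x : T) (s : ℕ) (hs : a.toList.Pairwise (· ≤ ·))
    (hl : a.toList.Perm l) (hU : unit l.length ≤ U) :
    Spec (countGt a x) s 0 (fun k τ => k = (l.countP (fun y => decide (x < y)) : ℤ) ∧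
      τ ≤ 2 * U) := by
  refine Spec.bind₀ (countLe_spec x s hs hl hU) le_rfl ?_
  rintro k t ⟨rfl, h⟩
  refine Spec.ret ⟨?_, h⟩
  have hlen : a.size = l.length := by simpa using hl.length_eq
  have := l.length_eq_countP_add_countP (fun y => decide (y ≤ x))
  have e : l.countP (fun y => decide (¬decide (y ≤ x) = true)) =
      l.countP (fun y => decide (x < y)) := List.countP_congr fun y _ => by simp
  rw [e] at this
  omega

/-- The numbers of time spans in `L` that lie behind `x`, contain `x`, and lie before `x`. -/
def numAfter (x : T) (L : List (T × T)) : ℕ := L.countP fun p => decide (x < p.1)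

def numAround (x : T) (L : List (T × T)) : ℕ := L.countP fun p => decide (p.1 < x ∧ x < p.2)

def numBefore (x : T) (L : List (T × T)) : ℕ := L.countP fun p => decide (p.2 < x)

theorem countP_sub_countP {α : Type} {p q r : α → Bool} {l : List α}
    (h : ∀ a ∈ l, p a = true ↔ (q a = true ∨ r a = true))
    (hd : ∀ a ∈ l, ¬(q a = true ∧ r a = true)) :
    (l.countP p : ℤ) - l.countP q = l.countP r := by
  induction l with
  | nil => simp
  | cons a l ih =>
    have ih := ih (fun b hb => h b (List.mem_cons_of_mem _ hb))
      (fun b hb => hd b (List.mem_cons_of_mem _ hb))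
    have h1 := h a List.mem_cons_self
    have h2 := hd a List.mem_cons_self
    simp only [List.countP_cons]
    split_ifs with i j k j k <;> (push_cast; simp_all; try omega)

/-- A span that ends after x either starts at or after x or contains x in its interior, and
conversely, because its start precedes its end. So the two arrays may be sorted independently. -/
theorem numAround_eq_ends {L : List (T × T)} (x : T) (h : ∀ p ∈ L, p.1 < p.2) :
    ((L.map Prod.snd).countP (fun y => decide (x < y)) : ℤ) -
      (L.map Prod.fst).countP (fun y => decide (x ≤ y)) = numAround x L := by
  rw [List.countP_map, List.countP_map]
  refine countP_sub_countP (fun p hp => ?_) (fun p hp => ?_)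
  · have := h p hp
    simp only [Function.comp, decide_eq_true_eq]
    constructor
    · intro h1
      rcases lt_or_ge p.1 x with h2 | h2
      · exact Or.inr ⟨h2, h1⟩
      · exact Or.inl h2
    · rintro (h1 | h1)
      · exact h1.trans_lt this
      · exact h1.2
  · simp only [Function.comp, decide_eq_true_eq]
    exact fun ⟨h1, h2⟩ => absurd h1 (not_le.2 h2.1)

/-- Mirror image of `numAround_eq_ends`: a span that starts before x either ends at or before x or
contains x. -/
theorem numAround_eq_starts {L : List (T × T)} (x : T) (h : ∀ p ∈ L, p.1 < p.2) :
    ((L.map Prod.fst).countP (fun y => decide (y < x)) : ℤ) -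
      (L.map Prod.snd).countP (fun y => decide (y ≤ x)) = numAround x L := by
  rw [List.countP_map, List.countP_map]
  refine countP_sub_countP (fun p hp => ?_) (fun p hp => ?_)
  · have := h p hp
    simp only [Function.comp, decide_eq_true_eq]
    constructor
    · intro h1
      rcases lt_or_ge x p.2 with h2 | h2
      · exact Or.inr ⟨h1, h2⟩
      · exact Or.inl h2
    · rintro (h1 | h1)
      · exact this.trans_le h1
      · exact h1.1
  · simp only [Function.comp, decide_eq_true_eq]
    exact fun ⟨h1, h2⟩ => absurd h1 (not_le.2 h2.2)

/-- Six consecutive additions to the counts. -/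
theorem update_six (l : Bool) (C : Counts) (a : Fin 6 → ℤ) (k : Fin 6) :
    (let C₁ := Function.update C (convType l 0) (C (convType l 0) + a 0)
     let C₂ := Function.update C₁ (convType l 1) (C₁ (convType l 1) + a 1)
     let C₃ := Function.update C₂ (convType l 2) (C₂ (convType l 2) + a 2)
     let C₄ := Function.update C₃ (convType l 3) (C₃ (convType l 3) + a 3)
     let C₅ := Function.update C₄ (convType l 4) (C₄ (convType l 4) + a 4)
     Function.update C₅ (convType l 5) (C₅ (convType l 5) + a 5)) (convType l k) =
      C (convType l k) + a k := by
  -- `convType l` permutes the six types, so the additions go to six different counters.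
  cases l <;> fin_cases k <;> simp [convType]

/-- The eight binary searches cost at most 2U each, the six updates of counters one step each. -/
theorem queryMin_spec (l : Bool) {same opp : TimeArrays T} {L₁ L₂ : List (T × T)} (x : T)
    (C : Counts) (s : ℕ) (h₁ : same.Holds L₁) (h₂ : opp.Holds L₂) (s₁ : same.Sorted)
    (s₂ : opp.Sorted) (lt₁ : ∀ p ∈ L₁, p.1 < p.2) (lt₂ : ∀ p ∈ L₂, p.1 < p.2)
    (hU₁ : unit L₁.length ≤ U) (hU₂ : unit L₂.length ≤ U) :
    Spec (queryMin l same opp x C) s 0 (fun C' τ =>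
      (∀ k, C' (convType l k) = C (convType l k) + (![numAfter x L₁, numAround x L₁,
        numBefore x L₁, numAfter x L₂, numAround x L₂, numBefore x L₂] k : ℕ)) ∧
      τ ≤ U * 22) := by
  have hU1 : 1 ≤ U := (unit_pos _).trans hU₁
  have f₁ : unit (L₁.map Prod.fst).length ≤ U := by rwa [List.length_map]
  have g₁ : unit (L₁.map Prod.snd).length ≤ U := by rwa [List.length_map]
  have f₂ : unit (L₂.map Prod.fst).length ≤ U := by rwa [List.length_map]
  have g₂ : unit (L₂.map Prod.snd).length ≤ U := by rwa [List.length_map]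
  refine Spec.bind₀ (countGt_spec x s s₁.vs h₁.vs f₁) le_rfl fun k1 t1 ⟨e1, u1⟩ => ?_
  refine Spec.bind₀ (bump_spec _ _ _ _ _) le_rfl fun C1 t2 ⟨b1, u2⟩ => ?_
  refine Spec.bind₀ (countGt_spec x s s₁.va h₁.va g₁) le_rfl fun k2 t3 ⟨e2, u3⟩ => ?_
  refine Spec.bind₀ (countGe_spec x s s₁.vs h₁.vs f₁) le_rfl fun k3 t4 ⟨e3, u4⟩ => ?_
  refine Spec.bind₀ (bump_spec _ _ _ _ _) le_rfl fun C2 t5 ⟨b2, u5⟩ => ?_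
  refine Spec.bind₀ (countLt_spec x s s₁.va h₁.va g₁) le_rfl fun k4 t6 ⟨e4, u6⟩ => ?_
  refine Spec.bind₀ (bump_spec _ _ _ _ _) le_rfl fun C3 t7 ⟨b3, u7⟩ => ?_
  refine Spec.bind₀ (countGt_spec x s s₂.vs h₂.vs f₂) le_rfl fun k5 t8 ⟨e5, u8⟩ => ?_
  refine Spec.bind₀ (bump_spec _ _ _ _ _) le_rfl fun C4 t9 ⟨b4, u9⟩ => ?_
  refine Spec.bind₀ (countGt_spec x s s₂.va h₂.va g₂) le_rfl fun k6 t10 ⟨e6, u10⟩ => ?_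
  refine Spec.bind₀ (countGe_spec x s s₂.vs h₂.vs f₂) le_rfl fun k7 t11 ⟨e7, u11⟩ => ?_
  refine Spec.bind₀ (bump_spec _ _ _ _ _) le_rfl fun C5 t12 ⟨b5, u12⟩ => ?_
  refine Spec.bind₀ (countLt_spec x s s₂.va h₂.va g₂) le_rfl fun k8 t13 ⟨e8, u13⟩ => ?_
  refine (bump_spec _ _ _ _ _).weaken fun C6 t14 ⟨b6, u14⟩ => ⟨fun k => ?_, by omega⟩
  rw [List.countP_map] at e1 e4 e5 e8
  have a1 : k1 = numAfter x L₁ := e1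
  have a2 : k2 - k3 = numAround x L₁ := by rw [e2, e3, numAround_eq_ends x lt₁]
  have a3 : k4 = numBefore x L₁ := e4
  have a4 : k5 = numAfter x L₂ := e5
  have a5 : k6 - k7 = numAround x L₂ := by rw [e6, e7, numAround_eq_ends x lt₂]
  have a6 : k8 = numBefore x L₂ := e8
  rw [b6, a6, b5, a5, b4, a4, b3, a3, b2, a2, b1, a1]
  exact update_six l C (fun k => (![numAfter x L₁, numAround x L₁,
        numBefore x L₁, numAfter x L₂, numAround x L₂, numBefore x L₂] k : ℕ)) k

theorem queryMax_spec (l : Bool) {same opp : TimeArrays T} {L₁ L₂ : List (T × T)} (x : T)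
    (C : Counts) (s : ℕ) (h₁ : same.Holds L₁) (h₂ : opp.Holds L₂) (s₁ : same.Sorted)
    (s₂ : opp.Sorted) (lt₁ : ∀ p ∈ L₁, p.1 < p.2) (lt₂ : ∀ p ∈ L₂, p.1 < p.2)
    (hU₁ : unit L₁.length ≤ U) (hU₂ : unit L₂.length ≤ U) :
    Spec (queryMax l same opp x C) s 0 (fun C' τ =>
      (∀ k, C' (convType l k) = C (convType l k) + (![numBefore x L₁, numAround x L₁,
        numAfter x L₁, numBefore x L₂, numAround x L₂, numAfter x L₂] k : ℕ)) ∧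
      τ ≤ U * 22) := by
  have hU1 : 1 ≤ U := (unit_pos _).trans hU₁
  have f₁ : unit (L₁.map Prod.fst).length ≤ U := by rwa [List.length_map]
  have g₁ : unit (L₁.map Prod.snd).length ≤ U := by rwa [List.length_map]
  have f₂ : unit (L₂.map Prod.fst).length ≤ U := by rwa [List.length_map]
  have g₂ : unit (L₂.map Prod.snd).length ≤ U := by rwa [List.length_map]
  refine Spec.bind₀ (countLt_spec x s s₁.va h₁.va g₁) le_rfl fun k1 t1 ⟨e1, u1⟩ => ?_
  refine Spec.bind₀ (bump_spec _ _ _ _ _) le_rfl fun C1 t2 ⟨b1, u2⟩ => ?_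
  refine Spec.bind₀ (countLt_spec x s s₁.vs h₁.vs f₁) le_rfl fun k2 t3 ⟨e2, u3⟩ => ?_
  refine Spec.bind₀ (countLe_spec x s s₁.va h₁.va g₁) le_rfl fun k3 t4 ⟨e3, u4⟩ => ?_
  refine Spec.bind₀ (bump_spec _ _ _ _ _) le_rfl fun C2 t5 ⟨b2, u5⟩ => ?_
  refine Spec.bind₀ (countGt_spec x s s₁.vs h₁.vs f₁) le_rfl fun k4 t6 ⟨e4, u6⟩ => ?_
  refine Spec.bind₀ (bump_spec _ _ _ _ _) le_rfl fun C3 t7 ⟨b3, u7⟩ => ?_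
  refine Spec.bind₀ (countLt_spec x s s₂.va h₂.va g₂) le_rfl fun k5 t8 ⟨e5, u8⟩ => ?_
  refine Spec.bind₀ (bump_spec _ _ _ _ _) le_rfl fun C4 t9 ⟨b4, u9⟩ => ?_
  refine Spec.bind₀ (countLt_spec x s s₂.vs h₂.vs f₂) le_rfl fun k6 t10 ⟨e6, u10⟩ => ?_
  refine Spec.bind₀ (countLe_spec x s s₂.va h₂.va g₂) le_rfl fun k7 t11 ⟨e7, u11⟩ => ?_
  refine Spec.bind₀ (bump_spec _ _ _ _ _) le_rfl fun C5 t12 ⟨b5, u12⟩ => ?_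
  refine Spec.bind₀ (countGt_spec x s s₂.vs h₂.vs f₂) le_rfl fun k8 t13 ⟨e8, u13⟩ => ?_
  refine (bump_spec _ _ _ _ _).weaken fun C6 t14 ⟨b6, u14⟩ => ⟨fun k => ?_, by omega⟩
  rw [List.countP_map] at e1 e4 e5 e8
  have a1 : k1 = numBefore x L₁ := e1
  have a2 : k2 - k3 = numAround x L₁ := by rw [e2, e3, numAround_eq_starts x lt₁]
  have a3 : k4 = numAfter x L₁ := e4
  have a4 : k5 = numBefore x L₂ := e5
  have a5 : k6 - k7 = numAround x L₂ := by rw [e6, e7, numAround_eq_starts x lt₂]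
  have a6 : k8 = numAfter x L₂ := e8
  rw [b6, a6, b5, a5, b4, a4, b3, a3, b2, a2, b1, a1]
  exact update_six l C (fun k => (![numBefore x L₁, numAround x L₁,
        numAfter x L₁, numBefore x L₂, numAround x L₂, numAfter x L₂] k : ℕ)) k

end PlusArrays

/-! ### Entries of the hash map and the potential that pays for sorting -/

section PlusEntries

variable {V T : Type} [DecidableEq V]

/-- The entry of `w`, which is empty if there is none. -/
def plusEntry (H : HMap V (PlusEntry T)) (w : V) : PlusEntry T := (H.find w).getD {}

theorem plusEntry_update {H H' : HMap V (PlusEntry T)} {w : V} {s : PlusEntry T}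
    (h : H'.find = Function.update H.find w (some s)) (x : V) :
    plusEntry H' x = if x = w then s else plusEntry H x := by
  unfold plusEntry
  rw [h, Function.update_apply]
  split_ifs <;> rfl

/-- The weight of an entry: its number of wedges plus one, as long as it is not sorted. -/
def unsortedWeight (s : PlusEntry T) : ℕ :=
  if s.sorted then 0 else s.A.VS.size + s.D.VS.size + 1

/-- The total weight of the unsorted entries. -/
def unsortedTotal [Fintype V] (H : HMap V (PlusEntry T)) : ℕ :=
  ∑ w, (H.find w).elim 0 unsortedWeight

theorem unsortedTotal_update [Fintype V] {H H' : HMap V (PlusEntry T)} {w : V} {s : PlusEntry T}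
    (h : H'.find = Function.update H.find w (some s)) :
    unsortedTotal H' + (H.find w).elim 0 unsortedWeight = unsortedTotal H + unsortedWeight s := by
  have := HMap.sum_update_weight H.find (fun o => o.elim 0 unsortedWeight) w (some s)
  rwa [← h] at this

end PlusEntries

/-! ### The work of one thread of STBC⁺ -/

section PlusCount

variable {V T : Type} [LinearOrder T]

/-- The six orders of the timestamp `t'` of the remaining edge and the timestamps `t₁`, `t₂` of the
first and of the second edge of a wedge that lead to the six types of butterflies. -/
def Mode.pattern (mode : Mode) (k : Fin 6) (t' t₁ t₂ : T) : Bool :=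
  match mode with
  | .delete => ![decide (t' < t₁ ∧ t₁ < t₂), decide (t₁ < t' ∧ t' < t₂), decide (t₁ < t₂ ∧ t₂ < t'),
      decide (t' < t₂ ∧ t₂ < t₁), decide (t₂ < t' ∧ t' < t₁), decide (t₂ < t₁ ∧ t₁ < t')] k
  | .insert => ![decide (t₂ < t₁ ∧ t₁ < t'), decide (t₂ < t' ∧ t' < t₁), decide (t' < t₂ ∧ t₂ < t₁),
      decide (t₁ < t₂ ∧ t₂ < t'), decide (t₁ < t' ∧ t' < t₂), decide (t' < t₁ ∧ t₁ < t₂)] k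

/-- The traversal range. -/
def Mode.InRange [AddCommGroup T] (mode : Mode) (δ t s : T) : Prop :=
  match mode with
  | .delete => t < s ∧ s ≤ t + δ
  | .insert => t - δ ≤ s ∧ s < t

theorem plusWindow_spec [AddCommGroup T] (mode : Mode) (S : Store V T) (δ t : T) (x : V) (s : ℕ)
    (hS : (S x).toList.Pairwise fun p q => p.2 ≤ q.2) :
    Spec (plusWindow mode S δ t x) s 0 (fun l τ => l.Sublist (S x).toList ∧
      (∀ p, p ∈ l ↔ p ∈ (S x).toList ∧ mode.InRange δ t p.2) ∧
      τ ≤ 2 * Nat.log 2 (S x).size + 4) := by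
  cases mode with
  | delete =>
    refine (window_mem_spec (S x) _ _ s 0 (hS.imp fun {p q} h => ?_)
      (hS.imp fun {p q} h => ?_)).weaken ?_
    · simpa using fun hq => h.trans hq
    · simpa using fun hq => h.trans hq
    · rintro l τ ⟨h1, h2, h3⟩
      exact ⟨h1, fun p => by simpa [Mode.InRange] using h2 p, h3⟩
  | insert =>
    refine (window_mem_spec (S x) _ _ s 0 (hS.imp fun {p q} h => ?_)
      (hS.imp fun {p q} h => ?_)).weaken ?_
    · simpa using fun hq => h.trans_lt hq
    · simpa using fun hq => h.trans_lt hq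
    · rintro l τ ⟨h1, h2, h3⟩
      exact ⟨h1, fun p => by simpa [Mode.InRange] using h2 p, h3⟩

variable [DecidableEq V]

/-- The time spans of the forward wedges with end-vertex `w` in a list of wedges. -/
def forwardSpans (W : List ((V × T) × (V × T))) (w : V) : List (T × T) :=
  (W.filter fun q => decide (q.2.1 = w ∧ q.1.2 < q.2.2)).map fun q => (q.1.2, q.2.2)

/-- The time spans of the backward wedges with end-vertex `w` in a list of wedges. -/
def backwardSpans (W : List ((V × T) × (V × T))) (w : V) : List (T × T) :=
  (W.filter fun q => decide (q.2.1 = w ∧ q.2.2 < q.1.2)).map fun q => (q.2.2, q.1.2)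

theorem forwardSpans_lt {W : List ((V × T) × (V × T))} {w : V} :
    ∀ p ∈ forwardSpans W w, p.1 < p.2 := by
  intro p hp
  simp only [forwardSpans, List.mem_map, List.mem_filter, decide_eq_true_eq] at hp
  obtain ⟨q, ⟨-, -, h⟩, rfl⟩ := hp
  exact h

theorem backwardSpans_lt {W : List ((V × T) × (V × T))} {w : V} :
    ∀ p ∈ backwardSpans W w, p.1 < p.2 := by
  intro p hp
  simp only [backwardSpans, List.mem_map, List.mem_filter, decide_eq_true_eq] at hp
  obtain ⟨q, ⟨-, -, h⟩, rfl⟩ := hp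
  exact h

theorem length_spans_le (W : List ((V × T) × (V × T))) (w : V) :
    (forwardSpans W w).length + (backwardSpans W w).length ≤ W.length := by
  simp only [forwardSpans, backwardSpans, List.length_map, ← List.countP_eq_length_filter]
  induction W with
  | nil => simp
  | cons q W ih =>
    simp only [List.countP_cons, List.length_cons, decide_eq_true_eq]
    by_cases h : q.1.2 < q.2.2
    · have : ¬q.2.2 < q.1.2 := not_lt.2 h.le
      simp only [this, and_false, if_false]
      split_ifs <;> omega
    · simp only [h, and_false, if_false]
      split_ifs <;> omega

/-- The number of wedges in `W` that make a butterfly of pattern `k` with the edge to `f`. -/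
def numMatches (mode : Mode) (W : List ((V × T) × (V × T))) (f : V × T) (k : Fin 6) : ℕ :=
  W.countP fun q => decide (q.2.1 = f.1) && mode.pattern k f.2 q.1.2 q.2.2

/-- Forward spans give the patterns 0, 1, 2 and backward spans the patterns 3, 4, 5, according to
whether they lie behind, around or before the timestamp of `f`. -/
theorem numMatches_delete (W : List ((V × T) × (V × T))) (f : V × T) (k : Fin 6) :
    (![numAfter f.2 (forwardSpans W f.1), numAround f.2 (forwardSpans W f.1),
      numBefore f.2 (forwardSpans W f.1), numAfter f.2 (backwardSpans W f.1),
      numAround f.2 (backwardSpans W f.1), numBefore f.2 (backwardSpans W f.1)] k : ℕ) =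
      numMatches .delete W f k := by
  fin_cases k <;>
  · simp only [numAfter, numAround, numBefore, forwardSpans, backwardSpans, List.countP_map,
      List.countP_filter, numMatches, Mode.pattern]
    refine List.countP_congr fun q _ => ?_
    simp
    first
      | done
      | (constructor
         · rintro ⟨h1, h2, h3⟩
           first
             | exact ⟨h2, h1, h3⟩
             | exact ⟨h2, h3, h1⟩
         · rintro ⟨h1, h2, h3⟩
           first
             | exact ⟨h2, h1, h3⟩
             | exact ⟨h3, h1, h2⟩)
      -- The patterns 1 and 4 do not mention the order of the two wedge edges; it follows by
      -- transitivity through the timestamp of `f`.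
      | (constructor
         · rintro ⟨⟨h1, h2⟩, h3, h4⟩
           exact ⟨h3, h1, h2⟩
         · rintro ⟨h1, h2, h3⟩
           exact ⟨⟨h2, h3⟩, h1, h2.trans h3⟩)

/-- Reversal of time exchanges forward with backward spans and before with after. -/
theorem numMatches_insert (W : List ((V × T) × (V × T))) (f : V × T) (k : Fin 6) :
    (![numBefore f.2 (backwardSpans W f.1), numAround f.2 (backwardSpans W f.1),
      numAfter f.2 (backwardSpans W f.1), numBefore f.2 (forwardSpans W f.1),
      numAround f.2 (forwardSpans W f.1), numAfter f.2 (forwardSpans W f.1)] k : ℕ) =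
      numMatches .insert W f k := by
  fin_cases k <;>
  · simp only [numAfter, numAround, numBefore, forwardSpans, backwardSpans, List.countP_map,
      List.countP_filter, numMatches, Mode.pattern]
    refine List.countP_congr fun q _ => ?_
    simp
    first
      | done
      | (constructor
         · rintro ⟨h1, h2, h3⟩
           first
             | exact ⟨h2, h1, h3⟩
             | exact ⟨h2, h3, h1⟩
         · rintro ⟨h1, h2, h3⟩
           first
             | exact ⟨h2, h1, h3⟩
             | exact ⟨h3, h1, h2⟩)
      | (constructor
         · rintro ⟨⟨h1, h2⟩, h3, h4⟩
           exact ⟨h3, h1, h2⟩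
         · rintro ⟨h1, h2, h3⟩
           exact ⟨⟨h2, h3⟩, h1, h2.trans h3⟩)

/-- The hash map holds the wedges in `W`. -/
structure HoldsWedges (H : HMap V (PlusEntry T)) (W : List ((V × T) × (V × T))) : Prop where
  A : ∀ w, (plusEntry H w).A.Holds (forwardSpans W w)
  D : ∀ w, (plusEntry H w).D.Holds (backwardSpans W w)

theorem forwardSpans_append (W : List ((V × T) × (V × T))) (q : (V × T) × (V × T)) (w : V) :
    forwardSpans (W ++ [q]) w = forwardSpans W w ++
      (if q.2.1 = w ∧ q.1.2 < q.2.2 then [(q.1.2, q.2.2)] else []) := by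
  unfold forwardSpans
  rw [List.filter_append, List.map_append]
  split_ifs with h <;> simp [h]

theorem backwardSpans_append (W : List ((V × T) × (V × T))) (q : (V × T) × (V × T)) (w : V) :
    backwardSpans (W ++ [q]) w = backwardSpans W w ++
      (if q.2.1 = w ∧ q.2.2 < q.1.2 then [(q.2.2, q.1.2)] else []) := by
  unfold backwardSpans
  rw [List.filter_append, List.map_append]
  split_ifs with h <;> simp [h]

theorem PlusEntry.sort_spec {s : PlusEntry T} {L₁ L₂ : List (T × T)} {n : ℕ} (h₁ : s.A.Holds L₁)
    (h₂ : s.D.Holds L₂) (hn : L₁.length + L₂.length ≤ n) :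
    Spec s.sort (4 * n + 1) 0 (fun s' τ => s'.A.Holds L₁ ∧ s'.D.Holds L₂ ∧ s'.A.Sorted ∧
      s'.D.Sorted ∧ s'.sorted = true ∧ τ ≤ unit n * (16 * (L₁.length + L₂.length + 1))) := by
  have hU1 : 1 ≤ unit n := unit_pos n
  refine Spec.bind₀ (TimeArrays.sort_spec (U := unit n) h₁ (RBT.unit_mono (by omega))) (by omega) ?_
  rintro A t1 ⟨a1, a2, a3⟩
  refine Spec.bind₀ (TimeArrays.sort_spec (U := unit n) h₂ (RBT.unit_mono (by omega))) (by omega) ?_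
  rintro D t2 ⟨b1, b2, b3⟩
  exact Spec.ret ⟨a1, b1, a2, b2, rfl, by nlinarith⟩

theorem plusQuery_spec (mode : Mode) (l : Bool) {s : PlusEntry T}
    {W : List ((V × T) × (V × T))} {n : ℕ} (f : V × T) (C : Counts) (k : ℕ)
    (hA : s.A.Holds (forwardSpans W f.1)) (hD : s.D.Holds (backwardSpans W f.1))
    (sA : s.A.Sorted) (sD : s.D.Sorted) (hn : W.length ≤ n) :
    Spec (match mode with
      | .delete => queryMin l s.A s.D f.2 C
      | .insert => queryMax l s.D s.A f.2 C) k 0 (fun C' τ =>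
      (∀ i, C' (convType l i) = C (convType l i) + numMatches mode W f i) ∧
      τ ≤ unit n * 22) := by
  have hlen := length_spans_le W f.1
  have hUA : unit (forwardSpans W f.1).length ≤ unit n := RBT.unit_mono (by omega)
  have hUD : unit (backwardSpans W f.1).length ≤ unit n := RBT.unit_mono (by omega)
  cases mode with
  | delete =>
    refine (queryMin_spec l f.2 C k hA hD sA sD forwardSpans_lt backwardSpans_lt hUA hUD).weaken ?_
    rintro C' τ ⟨h1, h2⟩
    exact ⟨fun i => by rw [h1, numMatches_delete], h2⟩
  | insert =>
    refine (queryMax_spec l f.2 C k hD hA sD sA backwardSpans_lt forwardSpans_lt hUD hUA).weaken ?_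
    rintro C' τ ⟨h1, h2⟩
    exact ⟨fun i => by rw [h1, numMatches_insert], h2⟩

variable [Fintype V]

/-- The state of the hash map while wedges are being collected. -/
structure Collecting (H : HMap V (PlusEntry T)) (W : List ((V × T) × (V × T))) : Prop where
  holds : HoldsWedges H W
  unsorted : ∀ w, (plusEntry H w).sorted = false
  total_le : unsortedTotal H ≤ 2 * W.length

theorem Collecting.empty : Collecting (HMap.empty : HMap V (PlusEntry T)) [] :=
  ⟨⟨fun _ => ⟨.refl _, .refl _⟩, fun _ => ⟨.refl _, .refl _⟩⟩, fun _ => rfl,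
    by simp [unsortedTotal, HMap.empty]⟩

/-- Three cells: one in either time array and possibly a new hash-map entry. -/
theorem addWedgePlus_spec {H : HMap V (PlusEntry T)} {W : List ((V × T) × (V × T))}
    (q : (V × T) × (V × T)) (h : Collecting H W) :
    Spec (addWedgePlus q.2.1 q.1.2 q.2.2 H) 3 3 (fun H' τ => Collecting H' (W ++ [q]) ∧ τ ≤ 2) := by
  have total {H' : HMap V (PlusEntry T)} {s : PlusEntry T}
      (hf : H'.find = Function.update H.find q.2.1 (some s))
      (hs : unsortedWeight s ≤ unsortedWeight (plusEntry H q.2.1) + 1) :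
      unsortedTotal H' ≤ 2 * (W ++ [q]).length := by
    have h1 := unsortedTotal_update hf
    have h2 := h.total_le
    -- A missing entry weighs 0 in the total but becomes the default entry, of weight 1; with the
    -- new wedge this makes the increase of at most 2.
    have h3 : unsortedWeight (plusEntry H q.2.1) ≤ (H.find q.2.1).elim 0 unsortedWeight + 1 := by
      unfold plusEntry
      cases H.find q.2.1 <;> simp [unsortedWeight]
    rw [List.length_append, List.length_singleton]
    omega
  refine Spec.tick_bind ?_
  split_ifs with h1 h2
  · refine Spec.alloc_bind (by omega) (by omega) ((HMap.modify_spec _ _ _ _).weaken ?_)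
    rintro H' τ ⟨hf, -, rfl⟩
    refine ⟨⟨⟨fun w => ?_, fun w => ?_⟩, fun w => ?_, total hf ?_⟩, le_rfl⟩
    · rw [plusEntry_update hf, forwardSpans_append]
      by_cases hw : w = q.2.1
      · rw [if_pos hw, if_pos ⟨hw.symm, h1⟩, hw]
        exact (h.holds.A q.2.1).push _ _
      · rw [if_neg hw, if_neg (fun h => hw h.1.symm), List.append_nil]
        exact h.holds.A w
    · rw [plusEntry_update hf, backwardSpans_append,
        if_neg (c := q.2.1 = w ∧ _) (fun h => not_lt.2 h1.le h.2),
        List.append_nil]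
      split_ifs with hw
      · rw [hw]
        exact h.holds.D q.2.1
      · exact h.holds.D w
    · rw [plusEntry_update hf]
      split_ifs with hw
      · exact h.unsorted q.2.1
      · exact h.unsorted w
    · have := h.unsorted q.2.1
      change unsortedWeight { plusEntry H q.2.1 with A := (plusEntry H q.2.1).A.push q.1.2 q.2.2 } ≤ _
      simp only [unsortedWeight, this, TimeArrays.push, Array.size_push]
      simp
      omega
  · refine Spec.alloc_bind (by omega) (by omega) ((HMap.modify_spec _ _ _ _).weaken ?_)
    rintro H' τ ⟨hf, -, rfl⟩
    refine ⟨⟨⟨fun w => ?_, fun w => ?_⟩, fun w => ?_, total hf ?_⟩, le_rfl⟩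
    · rw [plusEntry_update hf, forwardSpans_append, if_neg (c := q.2.1 = w ∧ _) (fun h => h1 h.2),
        List.append_nil]
      split_ifs with hw
      · rw [hw]
        exact h.holds.A q.2.1
      · exact h.holds.A w
    · rw [plusEntry_update hf, backwardSpans_append]
      by_cases hw : w = q.2.1
      · rw [if_pos hw, if_pos ⟨hw.symm, h2⟩, hw]
        exact (h.holds.D q.2.1).push _ _
      · rw [if_neg hw, if_neg (fun h => hw h.1.symm), List.append_nil]
        exact h.holds.D w
    · rw [plusEntry_update hf]
      split_ifs with hw
      · exact h.unsorted q.2.1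
      · exact h.unsorted w
    · have := h.unsorted q.2.1
      change unsortedWeight { plusEntry H q.2.1 with D := (plusEntry H q.2.1).D.push q.2.2 q.1.2 } ≤ _
      simp only [unsortedWeight, this, TimeArrays.push, Array.size_push]
      simp
      omega
  -- Equal timestamps: nothing is stored, and yet `q` may be appended to `W`, since it yields
  -- neither a forward nor a backward span.
  · refine Spec.ret ⟨⟨⟨fun w => ?_, fun w => ?_⟩, h.unsorted, ?_⟩, by omega⟩
    · rw [forwardSpans_append, if_neg (fun h => h1 h.2), List.append_nil]
      exact h.holds.A w
    · rw [backwardSpans_append, if_neg (fun h => h2 h.2), List.append_nil]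
      exact h.holds.D w
    · have := h.total_le
      rw [List.length_append]
      omega

theorem addWedgePlus_loop_spec {H : HMap V (PlusEntry T)} {W : List ((V × T) × (V × T))} (u : V)
    (e : V × T) (fs : List (V × T)) (h : Collecting H W) :
    Spec (forEach fs (fun H f => if f.1 ≠ u then addWedgePlus f.1 e.2 f.2 H else pure H) H)
      (3 * fs.length) (3 * fs.length) (fun H' τ =>
      Collecting H' (W ++ (fs.filter fun f => decide (f.1 ≠ u)).map fun f => (e, f)) ∧
      τ ≤ 3 * fs.length + 1) := by
  refine (Spec.forEach (s₁ := 0) (A := fun _ => 3) (τ := fun _ => 2)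
    (fun pre H' => Collecting H' (W ++ (pre.filter fun f => decide (f.1 ≠ u)).map fun f => (e, f)))
    (by simpa using h) ?_ ?_ ?_).weaken ?_
  · rintro pre x post b - h1
    rw [List.filter_append, List.map_append, ← List.append_assoc]
    split_ifs with hx
    · refine (addWedgePlus_spec (e, x) h1).mono (by omega) le_rfl ?_
      rintro H' τ ⟨k1, k2⟩
      exact ⟨by simpa [hx] using k1, k2⟩
    · exact Spec.ret ⟨by simpa [hx] using h1, by omega⟩
  · simp only [List.map_const', List.sum_replicate, smul_eq_mul]
    omega
  · simp only [List.map_const', List.sum_replicate, smul_eq_mul]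
    omega
  · rintro H' τ ⟨h1, h3⟩
    simp only [List.map_const', List.sum_replicate, smul_eq_mul] at h3
    exact ⟨h1, by omega⟩

/-- The wedges that are enumerated from the entries in `es`. -/
structure Enumerates [AddCommGroup T] (mode : Mode) (S : Store V T) (δ : T) (r : Req V T)
    (es : List (V × T)) (W : List ((V × T) × (V × T))) : Prop where
  nodup : W.Nodup
  mem_iff : ∀ q, q ∈ W ↔ q.1 ∈ es ∧ q.1.1 ≠ r.v ∧ q.2 ∈ (S q.1.1).toList ∧
    mode.InRange δ r.t q.2.2 ∧ q.2.1 ≠ r.u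

/-- The state of the hash map while the entries are being used. -/
structure Querying (H : HMap V (PlusEntry T)) (W : List ((V × T) × (V × T))) : Prop where
  holds : HoldsWedges H W
  sorted : ∀ w, (plusEntry H w).sorted = true →
    (plusEntry H w).A.Sorted ∧ (plusEntry H w).D.Sorted

/-- The unsorted entries carry a potential of 16 `unit n` per unit of weight. The first query to an
entry sorts it and uses up its share; every further edge costs at most 25 `unit n`, namely 22 for
the query and three single steps. Initially the total weight is at most 2n, which explains the term
32n. -/
theorem plusQueries_spec (mode : Mode) (l : Bool) (u : V) {H₀ : HMap V (PlusEntry T)}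
    {W : List ((V × T) × (V × T))} {n : ℕ} (fs : List (V × T)) (hH : Collecting H₀ W)
    (hn : W.length ≤ n) :
    Spec (forEach fs (fun (H, C) f => do
      if f.1 ≠ u then
        match ← H.get f.1 with
        | none => return (H, C)
        | some s =>
          let s' ← if s.sorted then pure s else s.sort
          let H' ← H.modify f.1 {} (fun _ => s')
          let C' ← match mode with
            | .delete => queryMin l s'.A s'.D f.2 C
            | .insert => queryMax l s'.D s'.A f.2 C
          return (H', C')
      else
        return (H, C)) (H₀, (0 : Counts))) (4 * n + 1) 0 (fun r τ =>
      (∀ i, r.2 (convType l i) =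
        ((((fs.filter fun f => decide (f.1 ≠ u)).map fun f => numMatches mode W f i).sum : ℕ) : ℤ)) ∧
      τ ≤ unit n * (32 * n + 25 * fs.length + 1)) := by
  have hU1 : 1 ≤ unit n := unit_pos n
  refine (Spec.forEach_inv (s₁ := 4 * n + 1) (A := fun _ => 0)
    (fun pre r t => Querying r.1 W ∧
      (∀ i, r.2 (convType l i) =
        ((((pre.filter fun f => decide (f.1 ≠ u)).map fun f => numMatches mode W f i).sum : ℕ) : ℤ)) ∧
      t + unit n * (16 * unsortedTotal r.1) ≤
        unit n * (16 * unsortedTotal H₀ + 25 * pre.length + 1))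
    ⟨⟨hH.holds, fun w hw => ?_⟩, fun _ => rfl, ?_⟩ ?_ (by simp) (by simp)).weaken ?_
  · rw [hH.unsorted] at hw
    exact absurd hw (by simp)
  · simp only [List.length_nil]
    nlinarith
  · rintro pre f post ⟨H, C⟩ t - ⟨h1, h2, h3⟩
    rw [List.filter_append, List.length_append, List.length_singleton]
    simp only at h1 h2 h3 ⊢
    split_ifs with hf
    · have hsum : ∀ i, ((((pre.filter fun f => decide (f.1 ≠ u)) ++
          [f].filter fun f => decide (f.1 ≠ u)).map fun f => numMatches mode W f i).sum : ℕ) =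
          ((pre.filter fun f => decide (f.1 ≠ u)).map fun f => numMatches mode W f i).sum +
            numMatches mode W f i := by
        intro i
        simp [hf]
      refine Spec.bind₀ (H.get_spec f.1 _) le_rfl ?_
      rintro o _ ⟨rfl, rfl⟩
      cases ho : H.find f.1 with
      | none =>
        refine Spec.ret ⟨h1, fun i => ?_, by nlinarith⟩
        have he : plusEntry H f.1 = {} := by rw [plusEntry, ho]; rfl
        have a1 := (h1.holds.A f.1).size_vs
        have a2 := (h1.holds.D f.1).size_vs
        rw [he] at a1 a2
        have b1 : forwardSpans W f.1 = [] := List.eq_nil_of_length_eq_zero a1.symm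
        have b2 : backwardSpans W f.1 = [] := List.eq_nil_of_length_eq_zero a2.symm
        -- An absent key means that no wedge with distinct timestamps ends in `f.1`, so skipping `f`
        -- loses nothing.
        have b3 : numMatches mode W f i = 0 := by
          cases mode
          · rw [← numMatches_delete, b1, b2]
            fin_cases i <;> rfl
          · rw [← numMatches_insert, b1, b2]
            fin_cases i <;> rfl
        rw [hsum, b3, Nat.add_zero]
        exact h2 i
      | some s =>
        have he : plusEntry H f.1 = s := by rw [plusEntry, ho]; rfl
        have hA := h1.holds.A f.1
        have hD := h1.holds.D f.1
        rw [he] at hA hD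
        have hlen := length_spans_le W f.1
        -- What follows after the entry has been made sorted, stated for any program `q` that meets
        -- the specification of a query. It covers both modes as well as both the sorted and the
        -- unsorted case; `t1` is the cost of sorting.
        have rest : ∀ (s' : PlusEntry T) (t1 : ℕ), s'.A.Holds (forwardSpans W f.1) →
            s'.D.Holds (backwardSpans W f.1) → s'.A.Sorted → s'.D.Sorted → s'.sorted = true →
            t1 ≤ unit n * (16 * unsortedWeight s) → ∀ q : Cost Counts,
            Spec q (4 * n + 1) 0 (fun C' τ => (∀ i, C' (convType l i) =
              C (convType l i) + numMatches mode W f i) ∧ τ ≤ unit n * 22) →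
            Spec (H.modify f.1 {} (fun _ => s') >>= fun H' => q >>= fun C' => pure (H', C'))
              (4 * n + 1) 0 (fun r t' => Querying r.1 W ∧ (∀ i, r.2 (convType l i) =
                ((((pre.filter fun f => decide (f.1 ≠ u)) ++ [f].filter fun f =>
                  decide (f.1 ≠ u)).map fun f => numMatches mode W f i).sum : ℕ)) ∧
                t + 1 + (1 + (t1 + t')) + unit n * (16 * unsortedTotal r.1) ≤
                  unit n * (16 * unsortedTotal H₀ + 25 * (pre.length + 1) + 1)) := by
          intro s' t1 c1 c2 c3 c4 c5 e1 q hq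
          refine Spec.bind₀ (H.modify_present_spec f.1 {} s _ _ ho) le_rfl ?_
          rintro H' _ ⟨hf', rfl⟩
          refine Spec.bind₀ hq le_rfl ?_
          rintro C' t2 ⟨d1, e2⟩
          have htot := unsortedTotal_update hf'
          rw [ho, Option.elim_some] at htot
          have hz : unsortedWeight s' = 0 := by rw [unsortedWeight, if_pos c5]
          rw [hz, Nat.add_zero] at htot
          refine Spec.ret ⟨⟨⟨fun w => ?_, fun w => ?_⟩, fun w => ?_⟩, fun i => ?_, ?_⟩
          · rw [plusEntry_update hf']
            split_ifs with hw
            · rw [hw]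
              exact c1
            · exact h1.holds.A w
          · rw [plusEntry_update hf']
            split_ifs with hw
            · rw [hw]
              exact c2
            · exact h1.holds.D w
          · rw [plusEntry_update hf']
            split_ifs with hw
            · exact fun _ => ⟨c3, c4⟩
            · exact h1.sorted w
          · rw [hsum]
            exact (d1 i).trans (by rw [h2]; push_cast; rfl)
          · rw [← htot] at h3
            simp only
            nlinarith
        dsimp only
        split_ifs with hs
        · refine Spec.bind₀ (Q := fun s' τ => s' = s ∧ τ = 0) (Spec.ret ⟨rfl, rfl⟩) le_rfl ?_
          rintro _ _ ⟨rfl, rfl⟩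
          have hsd := h1.sorted f.1
          rw [he] at hsd
          obtain ⟨c3, c4⟩ := hsd hs
          have hq := plusQuery_spec mode l f C (4 * n + 1) hA hD c3 c4 hn
          cases mode <;> exact rest _ _ hA hD c3 c4 hs (Nat.zero_le _) _ hq
        · refine Spec.bind₀ (PlusEntry.sort_spec (n := n) hA hD (by omega)) le_rfl ?_
          rintro s' t1 ⟨c1, c2, c3, c4, c5, c6⟩
          have hq := plusQuery_spec mode l f C (4 * n + 1) c1 c2 c3 c4 hn
          have e1 : t1 ≤ unit n * (16 * unsortedWeight s) := by
            rwa [unsortedWeight, if_neg hs, hA.size_vs, hD.size_vs]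
          cases mode <;> exact rest _ _ c1 c2 c3 c4 c5 e1 _ hq
    · refine Spec.ret ⟨h1, fun i => (h2 i).trans ?_, by nlinarith⟩
      simp [hf]
  · rintro ⟨H, C⟩ t ⟨h1, h2, h3⟩
    refine ⟨h2, ?_⟩
    have := hH.total_le
    have h4 : unit n * unsortedTotal H₀ ≤ unit n * (2 * n) := Nat.mul_le_mul_left _ (by omega)
    nlinarith

variable [AddCommGroup T]

/-- `W` is a ghost list that records the enumerated wedges. It has no repetitions because the
entries in `es` are distinct and so are those of each window; counting wedges with `countP` then
amounts to a cardinality. -/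
theorem plusEnumerate_spec {S : Store V T} {D : V → ℕ} {n : ℕ} (mode : Mode) (δ : T) (r : Req V T)
    (es : List (V × T)) (hF : S.Fits D r n)
    (hS : ∀ x, (S x).toList.Pairwise (fun p q => p.2 ≤ q.2) ∧ (S x).toList.Nodup)
    (hes : es.Sublist (S r.u).toList) :
    Spec (forEach es (fun H e => do
      if e.1 ≠ r.v then
        let fs ← plusWindow mode S δ r.t e.1
        forEach fs (fun H f => if f.1 ≠ r.u then addWedgePlus f.1 e.2 f.2 H else pure H) H
      else
        return H) HMap.empty) (3 * n) (3 * n) (fun H τ => τ ≤ 12 * n ∧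
      ∃ W, Collecting H W ∧ Enumerates mode S δ r es W ∧ W.length ≤ n) := by
  have hsum : (es.map fun p => D p.1).sum ≤ n := (sum_map_le_of_sublist _ hes).trans hF.sum_le
  have hnd : es.Nodup := (hS r.u).2.sublist hes
  refine (Spec.forEach (s₁ := 0) (A := fun e => 3 * D e.1) (τ := fun e => 10 * D e.1)
    (fun pre H => ∃ W, Collecting H W ∧ Enumerates mode S δ r pre W ∧
      W.length ≤ (pre.map fun p => D p.1).sum)
    ⟨[], Collecting.empty, ⟨List.nodup_nil, by simp⟩, by simp⟩ ?_ ?_ ?_).weaken ?_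
  · rintro pre e post H hl ⟨W, h1, h2, h3⟩
    have hmem : e ∈ es := by rw [hl]; simp
    have hpos := hF.pos e (hes.subset hmem)
    have hpre : e ∉ pre := by
      rw [hl] at hnd
      have := (List.nodup_append.1 hnd).2.2
      exact fun h => this e h e List.mem_cons_self rfl
    simp only [List.map_append, List.map_cons, List.map_nil, List.sum_append, List.sum_cons,
      List.sum_nil]
    split_ifs with hv
    · refine Spec.bind₀ (plusWindow_spec mode S δ r.t e.1 _ (hS e.1).1) le_rfl ?_
      rintro fs t2 ⟨hfs, hfm, e2⟩
      have hlen : fs.length ≤ D e.1 := hfs.length_le.trans (by simpa using hF.size_le e.1)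
      have hlog : Nat.log 2 (S e.1).size ≤ D e.1 := (Nat.log_le_self _ _).trans (hF.size_le e.1)
      refine (addWedgePlus_loop_spec r.u e fs h1).mono (by omega) (by omega) ?_
      rintro H' t3 ⟨k1, k2⟩
      refine ⟨⟨_, k1, ⟨?_, ?_⟩, ?_⟩, by omega⟩
      · rw [List.nodup_append]
        refine ⟨h2.nodup, ?_, ?_⟩
        · exact (((hS e.1).2.sublist hfs).filter _).map fun a b h => (Prod.mk.inj h).2
        · rintro q hq _ hq' rfl
          rw [List.mem_map] at hq'
          obtain ⟨f, -, rfl⟩ := hq'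
          exact hpre ((h2.mem_iff _).1 hq).1
      · intro q
        rw [List.mem_append, h2.mem_iff, List.mem_map]
        constructor
        · rintro (⟨a1, a2⟩ | ⟨f, hf, rfl⟩)
          · exact ⟨List.mem_append_left _ a1, a2⟩
          · rw [List.mem_filter, hfm, decide_eq_true_eq] at hf
            exact ⟨by simp, hv, hf.1.1, hf.1.2, hf.2⟩
        · rintro ⟨a1, a2, a3, a4, a5⟩
          rw [List.mem_append, List.mem_singleton] at a1
          rcases a1 with a1 | a1
          · exact Or.inl ⟨a1, a2, a3, a4, a5⟩
          · refine Or.inr ⟨q.2, ?_, by rw [← a1]⟩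
            rw [List.mem_filter, hfm, decide_eq_true_eq, ← a1]
            exact ⟨⟨a3, a4⟩, a5⟩
      · have := List.length_filter_le (fun f => decide (f.1 ≠ r.u)) fs
        rw [List.length_append, List.length_map]
        omega
    · refine Spec.ret ⟨⟨W, h1, ⟨h2.nodup, fun q => ?_⟩, by omega⟩, Nat.zero_le _⟩
      rw [h2.mem_iff, List.mem_append, List.mem_singleton]
      constructor
      · exact fun ⟨a1, a2⟩ => ⟨Or.inl a1, a2⟩
      · rintro ⟨a1 | a1, a2⟩
        · exact ⟨a1, a2⟩
        · rw [a1] at a2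
          exact absurd a2.1 hv
  · rw [sum_map_mul_left]
    omega
  · rw [sum_map_mul_left]
    omega
  · rintro H t ⟨⟨W, h1, h2, h3⟩, e4⟩
    refine ⟨?_, W, h1, h2, h3.trans hsum⟩
    have hn := hF.one_le
    have hE : (es.map fun e => 10 * D e.1 + 1).sum ≤ 11 * n := by
      refine le_trans (sum_map_le_sum_map (g := fun e => 11 * D e.1) fun e he => ?_) ?_
      · have := hF.pos e (hes.subset he)
        omega
      · rw [sum_map_mul_left]
        omega
    omega

/-- The work of a thread: its cost, and what it counts. -/
theorem plusCount_spec {S : Store V T} {D : V → ℕ} {n : ℕ} (mode : Mode) (upper : V → Bool) (δ : T)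
    (r : Req V T) (hF : S.Fits D r n)
    (hS : ∀ x, (S x).toList.Pairwise (fun p q => p.2 ≤ q.2) ∧ (S x).toList.Nodup) :
    Spec (plusCount mode upper S δ r) (8 * n) (3 * n) (fun C τ =>
      τ ≤ 200 * (n * unit n) ∧
      ∃ (es fs : List (V × T)) (W : List ((V × T) × (V × T))),
        (∀ p, p ∈ es ↔ p ∈ (S r.u).toList ∧ mode.InRange δ r.t p.2) ∧
        fs.Nodup ∧ (∀ p, p ∈ fs ↔ p ∈ (S r.v).toList ∧ mode.InRange δ r.t p.2) ∧
        Enumerates mode S δ r es W ∧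
        ∀ i, C (convType (!upper r.u) i) =
          ((((fs.filter fun f => decide (f.1 ≠ r.u)).map fun f => numMatches mode W f i).sum : ℕ) :
            ℤ)) := by
  have hn := hF.one_le
  refine Spec.bind₀ (plusWindow_spec mode S δ r.t r.u _ (hS r.u).1) le_rfl ?_
  rintro es t1 ⟨hes, hem, e1⟩
  refine Spec.bind (plusEnumerate_spec mode δ r es hF hS hes) (by omega) le_rfl (by omega) ?_
  rintro H t2 ⟨e2, W, hW, hE, hlen⟩
  refine Spec.bind₀ (plusWindow_spec mode S δ r.t r.v _ (hS r.v).1) le_rfl ?_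
  rintro fs t3 ⟨hfs, hfm, e3⟩
  refine Spec.bind₀ (plusQueries_spec mode (!upper r.u) r.u fs hW hlen) (by omega) ?_
  rintro ⟨H', C⟩ t4 ⟨hC, e4⟩
  refine Spec.tick_bind (Spec.ret ⟨?_, es, fs, W, hem, (hS r.v).2.sublist hfs, hfm, hE, hC⟩)
  have hu := (Nat.log_le_self 2 (S r.u).size).trans hF.start_le
  have hv := (Nat.log_le_self 2 (S r.v).size).trans ((hF.size_le r.v).trans hF.mid_le)
  have hfl : fs.length ≤ n := hfs.length_le.trans
    (by simpa using (hF.size_le r.v).trans hF.mid_le)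
  have h5 : unit n * fs.length ≤ unit n * n := Nat.mul_le_mul_left _ hfl
  have h6 : n ≤ n * unit n := Nat.le_mul_of_pos_right _ (unit_pos n)
  have h7 : unit n ≤ n * unit n := Nat.le_mul_of_pos_left _ hn
  nlinarith

end PlusCount

/-! ### The six chronological orders -/

section Orders

/-- The positions, in the six chronological orders, of the edges `0 = uv`, `1 = ux`, `2 = xw`
and `3 = vw` of a butterfly whose first, respectively last, edge is `uv`. -/
def Mode.order (mode : Mode) (k : Fin 6) : Fin 4 → Fin 4 :=
  match mode with
  | .delete => ![![0, 3, 1, 2], ![0, 1, 3, 2], ![0, 1, 2, 3], ![0, 3, 2, 1], ![0, 2, 3, 1],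
      ![0, 2, 1, 3]] k
  | .insert => ![![2, 1, 3, 0], ![2, 3, 1, 0], ![3, 2, 1, 0], ![1, 2, 3, 0], ![1, 3, 2, 0],
      ![3, 1, 2, 0]] k

/-- The position of the edge `uv`. -/
def Mode.pos (mode : Mode) : Fin 4 :=
  match mode with
  | .delete => 0
  | .insert => 3

theorem Mode.order_surjective (mode : Mode) (k : Fin 6) : Function.Surjective (mode.order k) := by
  cases mode <;> revert k <;> decide

theorem Mode.order_pos (mode : Mode) (k : Fin 6) : mode.order k mode.pos = 0 := by
  cases mode <;> revert k <;> decide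

/-- With uv fixed at one end, the other three edges can be arranged in 3! = 6 ways, and all of them
are among the orders. -/
theorem Mode.exists_order (mode : Mode) (i₁ i₂ i₃ : Fin 4) (h : [mode.pos, i₁, i₂, i₃].Nodup) :
    (∃ k, mode.order k i₁ = 1 ∧ mode.order k i₂ = 2 ∧ mode.order k i₃ = 3) ∧
      ∀ i, i ∈ [mode.pos, i₁, i₂, i₃] := by
  cases mode <;> revert i₁ i₂ i₃ <;> decide

/-- In an increasing chain it suffices to bound the last element, whereas a thread tests every edge
against the traversal range separately. Both restrictions agree. -/
theorem increasing_above_iff {T : Type} [LinearOrder T] {t B a b c : T} :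
    ((t < a ∧ a < b ∧ b < c) ∧ c ≤ B) ↔
      ((a < b ∧ b < c) ∧ (t < a ∧ a ≤ B) ∧ (t < b ∧ b ≤ B) ∧ t < c ∧ c ≤ B) := by
  constructor
  · rintro ⟨⟨h1, h2, h3⟩, h4⟩
    have hb := h3.le.trans h4
    exact ⟨⟨h2, h3⟩, ⟨h1, h2.le.trans hb⟩, ⟨h1.trans h2, hb⟩, (h1.trans h2).trans h3, h4⟩
  · rintro ⟨⟨h1, h2⟩, ⟨a1, -⟩, -, -, c2⟩
    exact ⟨⟨a1, h1, h2⟩, c2⟩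

theorem increasing_below_iff {T : Type} [LinearOrder T] {t B a b c : T} :
    ((a < b ∧ b < c ∧ c < t) ∧ B ≤ a) ↔
      ((a < b ∧ b < c) ∧ (B ≤ a ∧ a < t) ∧ (B ≤ b ∧ b < t) ∧ B ≤ c ∧ c < t) := by
  constructor
  · rintro ⟨⟨h1, h2, h3⟩, h4⟩
    have hb := h4.trans h1.le
    exact ⟨⟨h1, h2⟩, ⟨h4, h1.trans (h2.trans h3)⟩, ⟨hb, h2.trans h3⟩, hb.trans h2.le, h3⟩
  · rintro ⟨⟨h1, h2⟩, ⟨a1, -⟩, -, -, c2⟩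
    exact ⟨⟨h1, h2, c2⟩, a1⟩

variable {T : Type} [AddCommGroup T] [LinearOrder T] [IsOrderedAddMonoid T]

/-- As uv is the first or the last edge, the limit on the duration is a limit on the distance from
`t`, which is what the traversal range expresses. -/
theorem Mode.chronological_iff (mode : Mode) (k : Fin 6) (δ t t₁ t₂ t' : T) :
    (StrictMono (fun i => (![t, t₁, t₂, t'] (mode.order k i) : T)) ∧
      (![t, t₁, t₂, t'] (mode.order k 3) : T) - ![t, t₁, t₂, t'] (mode.order k 0) ≤ δ) ↔
    (mode.pattern k t' t₁ t₂ = true ∧ mode.InRange δ t t₁ ∧ mode.InRange δ t t₂ ∧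
      mode.InRange δ t t') := by
  rw [Fin.strictMono_iff_lt_succ]
  cases mode with
  | delete =>
    have key (x : T) : x - t ≤ δ ↔ x ≤ t + δ := sub_le_iff_le_add'
    fin_cases k <;>
      simp [Fin.forall_fin_succ, Mode.order, Mode.pattern, Mode.InRange, key,
        increasing_above_iff] <;> tauto
  | insert =>
    have key (x : T) : t - x ≤ δ ↔ t - δ ≤ x := sub_le_comm
    fin_cases k <;>
      simp [Fin.forall_fin_succ, Mode.order, Mode.pattern, Mode.InRange, key,
        increasing_below_iff, -tsub_le_iff_right] <;> tauto

end Orders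

/-! ### Edges read in either direction -/

section Edges

variable {V T : Type}

/-- The edge between `x` and `y` with timestamp `s`, given in either direction. -/
def edgeOf (upper : V → Bool) (x y : V) (s : T) : TEdge V T := Req.edge upper ⟨x, y, s⟩

@[simp] theorem edgeOf_time (upper : V → Bool) (x y : V) (s : T) : (edgeOf upper x y s).time = s := by
  unfold edgeOf Req.edge
  split_ifs <;> rfl

theorem edgeOf_of_upper {upper : V → Bool} {x : V} (h : upper x = true) (y : V) (s : T) :
    edgeOf upper x y s = ⟨x, y, s⟩ := if_pos h

theorem edgeOf_of_lower {upper : V → Bool} {x : V} (h : upper x = false) (y : V) (s : T) :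
    edgeOf upper x y s = ⟨y, x, s⟩ := if_neg (by simp [h])

theorem edgeOf_inj {upper : V → Bool} {x y y' : V} {s s' : T}
    (h : edgeOf upper x y s = edgeOf upper x y' s') : y = y' ∧ s = s' := by
  unfold edgeOf Req.edge at h
  split_ifs at h
  · exact ⟨congrArg TEdge.low h, congrArg TEdge.time h⟩
  · exact ⟨congrArg TEdge.up h, congrArg TEdge.time h⟩

namespace TGraph

variable {G : TGraph V T} {x y : V} {s : T}

theorem Adj.symm (h : G.Adj x y s) : G.Adj y x s := h.elim Or.inr Or.inl

theorem Adj.upper_eq (h : G.Adj x y s) : G.upper y = !G.upper x := by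
  rcases h with h | h
  · have := G.bipartite _ h
    rw [this.1, this.2]
    rfl
  · have := G.bipartite _ h
    rw [this.1, this.2]
    rfl

/-- Of the two directions only one is compatible with the layers, so adjacency is membership of a
single, canonically oriented edge. -/
theorem adj_iff : G.Adj x y s ↔ edgeOf G.upper x y s ∈ G.edges := by
  constructor
  · intro h
    cases hx : G.upper x with
    | true =>
      rw [edgeOf_of_upper hx]
      refine h.resolve_right fun h' => ?_
      have := (G.bipartite _ h').2
      simp only at this
      rw [hx] at this
      exact absurd this (by simp)
    | false =>
      rw [edgeOf_of_lower hx]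
      refine h.resolve_left fun h' => ?_
      have := (G.bipartite _ h').1
      simp only at this
      rw [hx] at this
      exact absurd this (by simp)
  · intro h
    unfold edgeOf Req.edge at h
    split_ifs at h
    · exact Or.inl h
    · exact Or.inr h

theorem Adj.edgeOf_comm (h : G.Adj x y s) : edgeOf G.upper x y s = edgeOf G.upper y x s := by
  have hy := h.upper_eq
  cases hx : G.upper x <;> rw [hx] at hy
  · rw [edgeOf_of_lower hx, edgeOf_of_upper hy]
  · rw [edgeOf_of_upper hx, edgeOf_of_lower hy]

theorem Adj.ne (h : G.Adj x y s) : x ≠ y := by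
  rintro rfl
  have := h.upper_eq
  cases hx : G.upper x <;> rw [hx] at this <;> exact absurd this (by simp)

end TGraph

end Edges

/-! ### Butterflies on an edge as pairs of a wedge and an edge at v -/

section Bijection

variable {V T : Type}

/-- The edges `uv`, `ux`, `xw` and `vw` that are given by the edge `r`, a wedge `q` and an
entry `f` of `v`. -/
def parts (upper : V → Bool) (r : Req V T) (d : ((V × T) × (V × T)) × (V × T)) :
    Fin 4 → TEdge V T :=
  ![edgeOf upper r.u r.v r.t, edgeOf upper r.u d.1.1.1 d.1.1.2,
    edgeOf upper d.1.1.1 d.1.2.1 d.1.2.2, edgeOf upper r.v d.2.1 d.2.2]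

/-- An edge and one endpoint determine the other: u gives x, then x gives w, and v gives the other
end of the last edge. -/
theorem parts_injective (upper : V → Bool) (r : Req V T) : Function.Injective (parts upper r) := by
  rintro ⟨⟨⟨x, t₁⟩, w, t₂⟩, w', t'⟩ ⟨⟨⟨x₂, s₁⟩, w₂, s₂⟩, w₂', s'⟩ h
  have h1 := edgeOf_inj (congrFun h 1)
  have h3 := edgeOf_inj (congrFun h 3)
  have h2 := congrFun h 2
  simp only at h1 h3
  obtain ⟨rfl, rfl⟩ := h1
  obtain ⟨rfl, rfl⟩ := h3
  have h2 := edgeOf_inj h2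
  simp only at h2
  obtain ⟨rfl, rfl⟩ := h2
  rfl

theorem parts_time (upper : V → Bool) (r : Req V T) (d : ((V × T) × (V × T)) × (V × T))
    (i : Fin 4) : (parts upper r d i).time = (![r.t, d.1.1.2, d.1.2.2, d.2.2] : Fin 4 → T) i := by
  fin_cases i <;> exact edgeOf_time _ _ _ _

/-- `q` and `f` make a butterfly of pattern `k` with the edge `r`. -/
structure Matches [LinearOrder T] [AddCommGroup T] (G : TGraph V T) (mode : Mode) (δ : T)
    (r : Req V T) (k : Fin 6) (d : ((V × T) × (V × T)) × (V × T)) : Prop where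
  start : G.Adj r.u d.1.1.1 d.1.1.2
  next : G.Adj d.1.1.1 d.1.2.1 d.1.2.2
  mid : G.Adj r.v d.2.1 d.2.2
  closed : d.1.2.1 = d.2.1
  ne_mid : d.1.1.1 ≠ r.v
  ne_start : d.1.2.1 ≠ r.u
  start_range : mode.InRange δ r.t d.1.1.2
  next_range : mode.InRange δ r.t d.1.2.2
  mid_range : mode.InRange δ r.t d.2.2
  pattern : mode.pattern k d.2.2 d.1.1.2 d.1.2.2 = true

/-- By symmetry of the biclique any of its edges may be taken as the corner, here the edge of the
update. -/
theorem biclique_with_corner {a b x y p q : V} (hab : a ≠ b) (hxy : x ≠ y)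
    (h : (p, q) ∈ ({(a, x), (a, y), (b, x), (b, y)} : Set (V × V))) :
    ∃ p' q', p' ≠ p ∧ q' ≠ q ∧ ({(a, x), (a, y), (b, x), (b, y)} : Set (V × V)) =
      {(p, q), (p, q'), (p', q), (p', q')} := by
  simp only [Set.mem_insert_iff, Set.mem_singleton_iff, Prod.mk.injEq] at h
  rcases h with ⟨rfl, rfl⟩ | ⟨rfl, rfl⟩ | ⟨rfl, rfl⟩ | ⟨rfl, rfl⟩
  · exact ⟨b, y, hab.symm, hxy.symm, rfl⟩
  · refine ⟨b, x, hab.symm, hxy, ?_⟩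
    ext z
    simp only [Set.mem_insert_iff, Set.mem_singleton_iff]
    tauto
  · refine ⟨a, y, hab, hxy.symm, ?_⟩
    ext z
    simp only [Set.mem_insert_iff, Set.mem_singleton_iff]
    tauto
  · refine ⟨a, x, hab, hxy, ?_⟩
    ext z
    simp only [Set.mem_insert_iff, Set.mem_singleton_iff]
    tauto

variable [AddCommGroup T] [LinearOrder T]

/-- Types refer to wedges with upper end-vertices, while the thread cuts the four-cycle at u and w.
For lower u these are the other two opposite vertices, and `convType` accounts for the different
cut. The rest is a check of the six orders. -/
theorem Matches.butterflyType_eq [DecidableEq V] {G : TGraph V T} {mode : Mode} {δ : T}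
    {r : Req V T} {k : Fin 6} {d : ((V × T) × (V × T)) × (V × T)} (hr : G.Adj r.u r.v r.t)
    (h : Matches G mode δ r k d) :
    butterflyType (parts G.upper r d ∘ mode.order k) = convType (!G.upper r.u) k := by
  have hv := hr.upper_eq
  have hx := h.start.upper_eq
  have n1 := h.ne_mid
  have n2 := h.ne_start
  have n1' := h.ne_mid.symm
  have n2' := h.ne_start.symm
  cases hu : G.upper r.u <;> rw [hu] at hv hx
  · simp only [parts, edgeOf_of_lower hu, edgeOf_of_upper hv, edgeOf_of_upper hx, ← h.closed]
    cases mode <;> fin_cases k <;>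
      simp [butterflyType, Mode.order, convType, n1, n2, n1', n2']
  · simp only [parts, edgeOf_of_upper hu, edgeOf_of_lower hv, edgeOf_of_lower hx, ← h.closed]
    cases mode <;> fin_cases k <;>
      simp [butterflyType, Mode.order, convType, n1, n2, n1', n2']

variable [IsOrderedAddMonoid T]

theorem Matches.isButterfly {G : TGraph V T} {mode : Mode} {δ : T} {r : Req V T} {k : Fin 6}
    {d : ((V × T) × (V × T)) × (V × T)} (hr : G.Adj r.u r.v r.t) (h : Matches G mode δ r k d) :
    G.IsButterfly δ (parts G.upper r d ∘ mode.order k) := by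
  have chron := (Mode.chronological_iff mode k δ r.t d.1.1.2 d.1.2.2 d.2.2).2
    ⟨h.pattern, h.start_range, h.next_range, h.mid_range⟩
  refine ⟨fun i => ?_, ?_, ?_, ?_⟩
  · have : ∀ j, parts G.upper r d j ∈ G.edges := by
      intro j
      fin_cases j
      · exact TGraph.adj_iff.1 hr
      · exact TGraph.adj_iff.1 h.start
      · exact TGraph.adj_iff.1 h.next
      · exact TGraph.adj_iff.1 h.mid
    exact this _
  · simpa only [Function.comp, parts_time] using chron.1
  · simpa only [Function.comp, parts_time] using chron.2
  · have hrange : Set.range (fun i => ((( parts G.upper r d ∘ mode.order k) i).up,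
        ((parts G.upper r d ∘ mode.order k) i).low)) =
        Set.range fun i => ((parts G.upper r d i).up, (parts G.upper r d i).low) :=
      (mode.order_surjective k).range_comp
        (fun i => ((parts G.upper r d i).up, (parts G.upper r d i).low))
    rw [hrange]
    have hv := hr.upper_eq
    have hx := h.start.upper_eq
    have hset : Set.range (fun i => ((parts G.upper r d i).up, (parts G.upper r d i).low)) =
        {((parts G.upper r d 0).up, (parts G.upper r d 0).low),
          ((parts G.upper r d 1).up, (parts G.upper r d 1).low),
          ((parts G.upper r d 2).up, (parts G.upper r d 2).low),
          ((parts G.upper r d 3).up, (parts G.upper r d 3).low)} := by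
      ext z
      simp only [Set.mem_range, Fin.exists_fin_succ, Set.mem_insert_iff, Set.mem_singleton_iff]
      simp [eq_comm]
    rw [hset]
    cases hu : G.upper r.u with
    | true =>
      rw [hu] at hv hx
      refine ⟨r.u, d.1.2.1, r.v, d.1.1.1, h.ne_start.symm, h.ne_mid.symm, ?_⟩
      simp only [parts, Matrix.cons_val, edgeOf_of_upper hu, edgeOf_of_lower hv,
        edgeOf_of_lower hx, ← h.closed]
      ext z
      simp only [Set.mem_insert_iff, Set.mem_singleton_iff]
      tauto
    | false =>
      rw [hu] at hv hx
      refine ⟨r.v, d.1.1.1, r.u, d.1.2.1, h.ne_mid.symm, h.ne_start.symm, ?_⟩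
      simp only [parts, Matrix.cons_val, edgeOf_of_lower hu, edgeOf_of_upper hv,
        edgeOf_of_upper hx, ← h.closed]
      ext z
      simp only [Set.mem_insert_iff, Set.mem_singleton_iff]
      tauto

/-- Surjectivity of the correspondence. The corner at uv names x and w, the biclique provides
indices of the edges ux, xw and vw, and these indices are distinct because the static edges are;
hence they form one of the six orders. -/
theorem exists_matches {G : TGraph V T} (mode : Mode) {δ : T} {r : Req V T}
    (hr : G.Adj r.u r.v r.t) {β : Fin 4 → TEdge V T} (hβ : G.IsButterfly δ β)
    (hpos : β mode.pos = r.edge G.upper) :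
    ∃ k d, Matches G mode δ r k d ∧ β = parts G.upper r d ∘ mode.order k := by
  obtain ⟨hE, hmono, hdur, a, b, x, y, hab, hxy, hset⟩ := hβ
  have hv := hr.upper_eq
  have hpos' : β mode.pos = edgeOf G.upper r.u r.v r.t := hpos
  -- the three other edges
  have key : ∃ w x i₁ i₂ i₃, w ≠ r.u ∧ x ≠ r.v ∧
      β i₁ = edgeOf G.upper r.u x (β i₁).time ∧ β i₂ = edgeOf G.upper x w (β i₂).time ∧
      β i₃ = edgeOf G.upper r.v w (β i₃).time ∧ [mode.pos, i₁, i₂, i₃].Nodup := by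
    have hmem : ((β mode.pos).up, (β mode.pos).low) ∈
        ({(a, x), (a, y), (b, x), (b, y)} : Set (V × V)) := hset ▸ ⟨_, rfl⟩
    have nodup : ∀ {p p' q q' : V} {i i₁ i₂ i₃ : Fin 4}, p' ≠ p → q' ≠ q →
        ((β i).up, (β i).low) = (p, q) → ((β i₁).up, (β i₁).low) = (p, q') →
        ((β i₂).up, (β i₂).low) = (p', q') → ((β i₃).up, (β i₃).low) = (p', q) →
        [i, i₁, i₂, i₃].Nodup := by
      intro p p' q q' i i₁ i₂ i₃ hp hq e0 e1 e2 e3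
      simp only [Prod.mk.injEq] at e0 e1 e2 e3
      simp only [List.nodup_cons, List.mem_cons, List.not_mem_nil, or_false, not_or]
      refine ⟨⟨?_, ?_, ?_⟩, ⟨?_, ?_⟩, ?_, by simp⟩ <;> rintro rfl
      · exact hq (e1.2.symm.trans e0.2)
      · exact hq (e2.2.symm.trans e0.2)
      · exact hp (e3.1.symm.trans e0.1)
      · exact hp (e2.1.symm.trans e1.1)
      · exact hp (e3.1.symm.trans e1.1)
      · exact hq (e2.2.symm.trans e3.2)
    cases hu : G.upper r.u with
    | true =>
      rw [hu] at hv
      rw [edgeOf_of_upper hu] at hpos'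
      rw [hpos'] at hmem
      obtain ⟨w, x', hw, hx', hset'⟩ := biclique_with_corner hab hxy hmem
      rw [hset'] at hset
      have hm : ∀ z ∈ ({(r.u, r.v), (r.u, x'), (w, r.v), (w, x')} : Set (V × V)), ∃ i,
          ((β i).up, (β i).low) = z := fun z hz => by rw [← hset] at hz; exact hz
      obtain ⟨i₁, h1⟩ := hm (r.u, x') (by simp)
      obtain ⟨i₂, h2⟩ := hm (w, x') (by simp)
      obtain ⟨i₃, h3⟩ := hm (w, r.v) (by simp)
      have hnd := nodup (i := mode.pos) hw hx' (by rw [hpos']) h1 h2 h3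
      simp only [Prod.mk.injEq] at h1 h2 h3
      have hxl : G.upper x' = false := h1.2 ▸ (G.bipartite _ (hE i₁)).2
      refine ⟨w, x', i₁, i₂, i₃, hw, hx', ?_, ?_, ?_, hnd⟩
      · rw [edgeOf_of_upper hu, ← h1.1, ← h1.2]
      · rw [edgeOf_of_lower hxl, ← h2.1, ← h2.2]
      · rw [edgeOf_of_lower hv, ← h3.1, ← h3.2]
    | false =>
      rw [hu] at hv
      rw [edgeOf_of_lower hu] at hpos'
      rw [hpos'] at hmem
      obtain ⟨x', w, hx', hw, hset'⟩ := biclique_with_corner hab hxy hmem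
      rw [hset'] at hset
      have hm : ∀ z ∈ ({(r.v, r.u), (r.v, w), (x', r.u), (x', w)} : Set (V × V)), ∃ i,
          ((β i).up, (β i).low) = z := fun z hz => by rw [← hset] at hz; exact hz
      obtain ⟨i₁, h1⟩ := hm (x', r.u) (by simp)
      obtain ⟨i₂, h2⟩ := hm (x', w) (by simp)
      obtain ⟨i₃, h3⟩ := hm (r.v, w) (by simp)
      have hnd := nodup (i := mode.pos) hx' hw (by rw [hpos']) h3 h2 h1
      simp only [Prod.mk.injEq] at h1 h2 h3
      have hxu : G.upper x' = true := h1.1 ▸ (G.bipartite _ (hE i₁)).1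
      refine ⟨w, x', i₁, i₂, i₃, hw, hx', ?_, ?_, ?_, ?_⟩
      · rw [edgeOf_of_lower hu, ← h1.1, ← h1.2]
      · rw [edgeOf_of_upper hxu, ← h2.1, ← h2.2]
      · rw [edgeOf_of_upper hv, ← h3.1, ← h3.2]
      -- For lower u the coordinates are exchanged, so that `nodup` delivers the indices of ux and
      -- vw in the opposite places.
      · exact (((List.reverse_perm [i₁, i₂, i₃]).cons mode.pos).nodup_iff).1 hnd
  obtain ⟨w, x, i₁, i₂, i₃, hw, hx, h1, h2, h3, hnd⟩ := key
  obtain ⟨⟨k, k1, k2, k3⟩, hall⟩ := mode.exists_order i₁ i₂ i₃ hnd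
  have hβ' : β = parts G.upper r (((x, (β i₁).time), (w, (β i₂).time)), (w, (β i₃).time)) ∘
      mode.order k := by
    funext i
    have := hall i
    simp only [List.mem_cons, List.not_mem_nil, or_false] at this
    rcases this with rfl | rfl | rfl | rfl
    · rw [Function.comp, mode.order_pos]
      exact hpos
    · rw [Function.comp, k1]
      exact h1
    · rw [Function.comp, k2]
      exact h2
    · rw [Function.comp, k3]
      exact h3
  refine ⟨k, _, ?_, hβ'⟩
  have chron := (Mode.chronological_iff mode k δ r.t (β i₁).time (β i₂).time (β i₃).time).1 (by
    refine ⟨?_, ?_⟩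
    · rw [hβ'] at hmono
      simpa only [Function.comp, parts_time] using hmono
    · rw [hβ'] at hdur
      simpa only [Function.comp, parts_time] using hdur)
  exact ⟨TGraph.adj_iff.2 (h1 ▸ hE i₁), TGraph.adj_iff.2 (h2 ▸ hE i₂), TGraph.adj_iff.2 (h3 ▸ hE i₃),
    rfl, hx, hw, chron.2.1, chron.2.2.1, chron.2.2.2, chron.1⟩

theorem convType_injective (l : Bool) : Function.Injective (convType l) := by
  cases l <;> decide

theorem convType_convType (l : Bool) (i : Fin 6) : convType l (convType l i) = i := by
  cases l <;> revert i <;> decide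

/-- The butterflies of one type with first, respectively last, edge `r` are the images of the
matching pairs of a wedge and an entry. -/
theorem setOf_butterfly_eq_image [DecidableEq V] {G : TGraph V T} (mode : Mode) {δ : T}
    {r : Req V T} (hr : G.Adj r.u r.v r.t) (k : Fin 6) :
    {β | G.IsButterfly δ β ∧ butterflyType β = convType (!G.upper r.u) k ∧
      β mode.pos = r.edge G.upper} =
      (fun d => parts G.upper r d ∘ mode.order k) '' {d | Matches G mode δ r k d} := by
  ext β
  constructor
  · rintro ⟨hβ, htype, hpos⟩
    obtain ⟨j, d, hd, rfl⟩ := exists_matches mode hr hβ hpos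
    rw [hd.butterflyType_eq hr] at htype
    obtain rfl := convType_injective _ htype
    exact ⟨d, hd, rfl⟩
  · rintro ⟨d, hd, rfl⟩
    refine ⟨hd.isButterfly hr, hd.butterflyType_eq hr, ?_⟩
    change parts G.upper r d (mode.order k mode.pos) = _
    rw [mode.order_pos]
    rfl

/-- Summing, over the edges at v, the numbers of matching wedges counts matching pairs. -/
theorem sum_countP_eq_card {α γ : Type} [DecidableEq α] [DecidableEq γ] {W : List α} {F : List γ}
    (hW : W.Nodup) (hF : F.Nodup) (p : γ → α → Bool) :
    (F.map fun f => W.countP (p f)).sum =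
      ((W.toFinset ×ˢ F.toFinset).filter fun d => p d.2 d.1 = true).card := by
  rw [Finset.card_filter, Finset.sum_product_right, ← List.sum_toFinset _ hF]
  refine Finset.sum_congr rfl fun f _ => ?_
  rw [← Finset.card_filter, List.countP_eq_length_filter, ← List.toFinset_card_of_nodup (hW.filter _),
    List.toFinset_filter]

/-- The count of a thread is the number of butterflies whose first, respectively last, edge is
its edge. -/
theorem sum_numMatches_eq_count [DecidableEq V] {G : TGraph V T} (mode : Mode) {δ : T}
    {r : Req V T} (hr : G.Adj r.u r.v r.t) {S : Store V T} (hS : S.Represents G)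
    {es fs : List (V × T)} {W : List ((V × T) × (V × T))}
    (hes : ∀ p, p ∈ es ↔ p ∈ (S r.u).toList ∧ mode.InRange δ r.t p.2)
    (hfn : fs.Nodup) (hfs : ∀ p, p ∈ fs ↔ p ∈ (S r.v).toList ∧ mode.InRange δ r.t p.2)
    (hW : Enumerates mode S δ r es W) (k : Fin 6) :
    (((fs.filter fun f => decide (f.1 ≠ r.u)).map fun f => numMatches mode W f k).sum : ℤ) =
      G.count δ (convType (!G.upper r.u) k) (fun β => β mode.pos = r.edge G.upper) := by
  unfold TGraph.count numMatches
  rw [setOf_butterfly_eq_image mode hr k, Set.ncard_image_of_injective]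
  · norm_cast
    rw [sum_countP_eq_card hW.nodup (hfn.filter _), ← Set.ncard_coe_finset]
    congr 1
    ext ⟨q, f⟩
    have hmem : ∀ x p, p ∈ (S x).toList ↔ G.Adj x p.1 p.2 := fun x p => (hS x).2.2 p.1 p.2
    simp only [Finset.coe_filter, Finset.mem_product, List.mem_toFinset, Set.mem_ofPred_eq,
      hW.mem_iff, hes, hfs, List.mem_filter, hmem, Bool.and_eq_true, decide_eq_true_eq]
    constructor
    · rintro ⟨⟨⟨⟨a1, a2⟩, a3, a4, a5, a6⟩, ⟨b1, b2⟩, b3⟩, c1, c2⟩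
      exact ⟨a1, a4, b1, c1, a3, a6, a2, a5, b2, c2⟩
    · rintro ⟨a1, a4, b1, c1, a3, a6, a2, a5, b2, c2⟩
      -- The test that `f` does not lead back to u is implied: `f` and the wedge have the same end,
      -- which differs from u.
      exact ⟨⟨⟨⟨a1, a2⟩, a3, a4, a5, a6⟩, ⟨b1, b2⟩, fun h => a6 (c1.trans h)⟩, c1, c2⟩
  · intro d d' h
    exact parts_injective _ _ ((mode.order_surjective k).injective_comp_right h)

end Bijection

/-! ### From `unit` to the real logarithm -/

section Within

/-- For n ≥ 2 one has n + 1 ≤ n², hence log₂(n + 1) ≤ 2 log n / log 2, and 1 ≤ log n / log 2. As log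
2 > 0.69, the sum is below 5 log n. -/
theorem unit_le_log {n : ℕ} (hn : 2 ≤ n) : (unit n : ℝ) ≤ 5 * Real.log n := by
  have hlog2 : (0.69 : ℝ) < Real.log 2 := lt_trans (by norm_num) Real.log_two_gt_d9
  have hmono : Real.log 2 ≤ Real.log n := Real.log_le_log (by norm_num) (by exact_mod_cast hn)
  have h1 : (Nat.log 2 (n + 1) : ℝ) * Real.log 2 ≤ Real.log (n + 1) := by
    have h := Real.natLog_le_logb (n + 1) 2
    rw [Real.logb, le_div_iff₀ (by push_cast; linarith)] at h
    exact_mod_cast h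
  have h2 : Real.log ((n : ℝ) + 1) ≤ 2 * Real.log n := by
    have h : Real.log ((n : ℝ) + 1) ≤ Real.log ((n : ℝ) ^ 2) := by
      refine Real.log_le_log (by positivity) ?_
      have : (2 : ℝ) ≤ n := by exact_mod_cast hn
      nlinarith
    rwa [Real.log_pow] at h
  have h3 : (unit n : ℝ) = Nat.log 2 (n + 1) + 1 := by
    unfold unit
    push_cast
    rfl
  rw [h3]
  have h4 : 0.69 * (Nat.log 2 (n + 1) : ℝ) ≤ Nat.log 2 (n + 1) * Real.log 2 := by
    rw [mul_comm]
    exact mul_le_mul_of_nonneg_left hlog2.le (Nat.cast_nonneg _)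
  linarith

/-- Bounds on a meter in natural numbers, with `unit n` in place of `log n`. -/
structure Meter.Bounded (m : Meter) (K edges n : ℕ) : Prop where
  time_le : m.time ≤ K * (n * unit n)
  peak_le : m.peak ≤ 2 * edges + K * n

theorem Meter.Bounded.mono {m : Meter} {K K' edges n : ℕ} (h : m.Bounded K edges n)
    (hK : K ≤ K') : m.Bounded K' edges n :=
  ⟨h.time_le.trans (Nat.mul_le_mul_right _ hK),
    h.peak_le.trans (Nat.add_le_add_left (Nat.mul_le_mul_right _ hK) _)⟩

theorem Meter.Bounded.within {m : Meter} {K edges n : ℕ} (h : m.Bounded K edges n) (hK : 2 ≤ K) :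
    m.Within (5 * K) edges n := by
  have hK' : (2 : ℝ) ≤ K := by exact_mod_cast hK
  refine ⟨fun hn => ?_, ?_⟩
  · have h1 : (m.time : ℝ) ≤ K * (n * unit n) := by exact_mod_cast h.time_le
    have h2 : (K : ℝ) * (n * unit n) ≤ K * (n * (5 * Real.log n)) := by
      gcongr
      exact unit_le_log hn
    linarith
  · have h1 : (m.peak : ℝ) ≤ 2 * edges + K * n := by exact_mod_cast h.peak_le
    have h2 : (2 : ℝ) * edges ≤ K * edges := by gcongr
    have h3 : (0 : ℝ) ≤ K * (edges + n) := by positivity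
    linarith

theorem Meter.Bounded.andThen {m₁ m₂ : Meter} {K₁ K₂ edges n : ℕ} (h₁ : m₁.Bounded K₁ edges n)
    (h₂ : m₂.Bounded K₂ edges n) : (m₁.andThen m₂).Bounded (K₁ + K₂) edges n := by
  refine ⟨?_, ?_⟩
  · rw [add_mul]
    exact Nat.add_le_add h₁.time_le h₂.time_le
  · rw [add_mul]
    refine max_le (h₁.peak_le.trans ?_) (h₂.peak_le.trans ?_) <;> omega

/-- The initial `w` cells hold the graph, in which every edge may be stored at both of its
endpoints; hence 2|E|. -/
theorem Spec.bounded {α : Type} {p : Cost α} {s a : ℕ} {Q : α → ℕ → Prop} {K edges n w : ℕ}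
    (h : Spec p s a Q) (hw : w ≤ 2 * edges) (hs : s ≤ K * n)
    (hQ : ∀ x t, Q x t → t ≤ K * (n * unit n)) :
    ((p.run (Meter.start w)).2).Bounded K edges n := by
  obtain ⟨t, h1, h2, -, h4⟩ := h (Meter.start w)
  have h5 := hQ _ _ h1
  change _ ≤ 0 + t at h2
  change _ ≤ max w (w + s) at h4
  exact ⟨by omega, by omega⟩

theorem Spec.value {α : Type} {p : Cost α} {s a : ℕ} {Q : α → ℕ → Prop} (h : Spec p s a Q)
    (m : Meter) : ∃ t, Q (p.run m).1 t :=
  (h m).imp fun _ h => h.1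

end Within

/-! ### Stores that hold part of a graph -/

section Substore

variable {V T : Type}

theorem edgeOf_endpoint (upper : V → Bool) (x y : V) (s : T) :
    (edgeOf upper x y s).up = x ∨ (edgeOf upper x y s).low = x := by
  unfold edgeOf Req.edge
  split_ifs
  · exact Or.inl rfl
  · exact Or.inr rfl

theorem edgeOf_injective (upper : V → Bool) (x : V) :
    Function.Injective fun p : V × T => edgeOf upper x p.1 p.2 :=
  fun _ _ h => Prod.ext (edgeOf_inj h).1 (edgeOf_inj h).2

/-- The arrays list edges of `G`, each at most once. -/
structure Store.Sub (S : Store V T) (G : TGraph V T) : Prop where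
  nodup : ∀ x, (S x).toList.Nodup
  adj : ∀ x, ∀ p ∈ (S x).toList, G.Adj x p.1 p.2

theorem TGraph.Adj.other_edgeOf [DecidableEq V] {G : TGraph V T} {x y : V} {s : T} (h : G.Adj x y s) :
    (edgeOf G.upper x y s).other x = y := by
  unfold edgeOf Req.edge TEdge.other
  have hne := h.ne
  split_ifs with h1 h2 h2
  · rfl
  · exact absurd rfl h2
  · exact absurd h2.symm hne
  · rfl

theorem TGraph.Adj.mem_incident [DecidableEq V] {G : TGraph V T} {x y : V} {s : T} (h : G.Adj x y s) :
    edgeOf G.upper x y s ∈ G.incident x :=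
  Finset.mem_filter.2 ⟨TGraph.adj_iff.1 h, edgeOf_endpoint _ _ _ _⟩

variable [LinearOrder T]

theorem Store.Represents.sub {S : Store V T} {G : TGraph V T} (h : S.Represents G) : S.Sub G :=
  ⟨fun x => (h x).2.1, fun x p hp => ((h x).2.2 p.1 p.2).1 hp⟩

variable [DecidableEq V]

variable {S : Store V T} {G : TGraph V T}

theorem TGraph.remove_adj {F : Finset (TEdge V T)} {x y : V} {s : T} :
    (G.remove F).Adj x y s ↔ G.Adj x y s ∧ edgeOf G.upper x y s ∉ F := by
  rw [TGraph.adj_iff, TGraph.adj_iff]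
  exact Finset.mem_sdiff

theorem Store.Represents.sub_of_remove {F : Finset (TEdge V T)} (h : S.Represents (G.remove F)) :
    S.Sub G :=
  ⟨h.sub.nodup, fun x p hp => (TGraph.remove_adj.1 (h.sub.adj x p hp)).1⟩

theorem Store.Sub.image_subset (h : S.Sub G) (x : V) :
    ((S x).toList.toFinset.image fun p => edgeOf G.upper x p.1 p.2) ⊆ G.incident x := by
  intro e he
  obtain ⟨p, hp, rfl⟩ := Finset.mem_image.1 he
  exact (h.adj x p (List.mem_toFinset.1 hp)).mem_incident

theorem Store.Sub.size_le (h : S.Sub G) (x : V) : (S x).size ≤ (G.incident x).card := by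
  have h1 := Finset.card_le_card (h.image_subset x)
  rw [Finset.card_image_of_injective _ (edgeOf_injective _ _),
    List.toFinset_card_of_nodup (h.nodup x)] at h1
  simpa using h1

/-- Double counting: an edge is incident to at most two vertices. -/
theorem Store.Sub.words_le [Fintype V] (h : S.Sub G) : S.words ≤ 2 * G.edges.card := by
  have h1 : S.words ≤ ∑ x, (G.incident x).card := Finset.sum_le_sum fun x _ => h.size_le x
  refine h1.trans ?_
  simp only [TGraph.incident, Finset.card_filter]
  rw [Finset.sum_comm, mul_comm, ← smul_eq_mul]
  refine Finset.sum_le_card_nsmul _ _ _ fun e _ => ?_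
  rw [← Finset.card_filter]
  refine (Finset.card_le_card (t := {e.up, e.low}) fun x hx => ?_).trans Finset.card_le_two
  rcases (Finset.mem_filter.1 hx).2 with rfl | rfl <;> simp

/-- The link between the arrays and |E²(u)|. The bounds are degrees in G and not array sizes, so
they persist while edges are being deleted or are yet to be inserted. The presence of e in E(u)
makes |E(v)| a summand, whence both `mid_le` and `one_le`. -/
theorem Store.Sub.fits (h : S.Sub G) {r : Req V T} (hr : G.Adj r.u r.v r.t) :
    S.Fits (fun x => (G.incident x).card) r (G.sqDeg r.u) := by
  have hmid : (G.incident r.v).card ≤ G.sqDeg r.u := by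
    have h1 : (G.incident ((edgeOf G.upper r.u r.v r.t).other r.u)).card ≤ G.sqDeg r.u :=
      Finset.single_le_sum (f := fun e : TEdge V T => (G.incident (e.other r.u)).card)
        (fun _ _ => Nat.zero_le _) hr.mem_incident
    rwa [hr.other_edgeOf] at h1
  refine ⟨h.size_le, fun p hp => Finset.card_pos.2 ⟨_, (h.adj _ p hp).symm.mem_incident⟩, ?_, hmid,
    le_trans (Finset.card_pos.2 ⟨_, hr.symm.mem_incident⟩) hmid⟩
  rw [← List.sum_toFinset _ (h.nodup r.u)]
  refine le_trans (le_of_eq ?_) (Finset.sum_le_sum_of_subset (h.image_subset r.u))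
  rw [Finset.sum_image (edgeOf_injective _ _).injOn]
  refine Finset.sum_congr rfl fun p hp => ?_
  rw [(h.adj _ p (List.mem_toFinset.1 hp)).other_edgeOf]

end Substore

/-! ### Deleting and inserting edges -/

section Updates

/-- Update a store by a sequence of edges while an invariant of the store and the edges that are
still to come is maintained. -/
theorem updateGraph_induction {V T : Type} [Fintype V] {op : Req V T → Store V T → Cost (Store V T)}
    {I : List (Req V T) → Store V T → Prop} {P : Req V T → Meter → Prop}
    (step : ∀ r rs S, I (r :: rs) S → I rs ((op r S).run (Meter.start S.words)).1 ∧
      P r ((op r S).run (Meter.start S.words)).2) (B : List (Req V T)) {S : Store V T}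
    (h : I B S) : I [] (updateGraph op S B).1 ∧ List.Forall₂ P B (updateGraph op S B).2 := by
  induction B generalizing S with
  | nil => exact ⟨h, List.Forall₂.nil⟩
  | cons r rs ih =>
    obtain ⟨h1, h2⟩ := step r rs S h
    exact ⟨(ih h1).1, List.Forall₂.cons h2 (ih h1).2⟩

variable {V T : Type} [DecidableEq V] [LinearOrder T] {S : Store V T} {G : TGraph V T}

theorem removeEntry_spec (x : V) (p : V × T) (S : Store V T) :
    Spec (removeEntry x p S) 0 0 (fun S' t =>
      S' = Function.update S x ((S x).toList.erase p).toArray ∧ t = (S x).size + 1) :=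
  Spec.tick_bind (Spec.release_bind (Spec.ret ⟨rfl, rfl⟩))

theorem addEntry_spec (x : V) (p : V × T) (S : Store V T) :
    Spec (addEntry x p S) 1 1 (fun S' t =>
      S' = Function.update S x ((S x).toList.orderedInsert (fun p q => p.2 ≤ q.2) p).toArray ∧
        t = (S x).size + 1) :=
  Spec.tick_bind (Spec.alloc_bind le_rfl le_rfl (Spec.ret ⟨rfl, rfl⟩))

theorem Store.Sub.erase (h : S.Sub G) (x : V) (p : V × T) :
    Store.Sub (Function.update S x ((S x).toList.erase p).toArray) G := by
  refine ⟨fun y => ?_, fun y q hq => ?_⟩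
  · by_cases hy : y = x
    · subst hy
      simpa using (h.nodup y).erase p
    · simpa [hy] using h.nodup y
  · by_cases hy : y = x
    · subst hy
      refine h.adj y q (List.mem_of_mem_erase (a := q) (b := p) ?_)
      simpa using hq
    · exact h.adj y q (by simpa [hy] using hq)

/-- Two linear scans, of at most |E²(u)| + 1 steps each. That the arrays remain part of G is enough
for the later deletions, as the threads have already run. -/
theorem deleteEdge_spec (h : S.Sub G) {r : Req V T} (hr : G.Adj r.u r.v r.t) :
    Spec (deleteEdge r S) 0 0 (fun S' t => S'.Sub G ∧
      t ≤ 4 * (G.sqDeg r.u * unit (G.sqDeg r.u))) := by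
  refine Spec.bind₀ (removeEntry_spec _ _ _) le_rfl ?_
  rintro S' _ ⟨rfl, rfl⟩
  have h' := h.erase r.u (r.v, r.t)
  refine (removeEntry_spec _ _ _).weaken ?_
  rintro S'' _ ⟨rfl, rfl⟩
  refine ⟨h'.erase r.v (r.u, r.t), ?_⟩
  have h1 := (h.fits hr).start_le
  have h2 := ((h'.fits hr).size_le r.v).trans (h'.fits hr).mid_le
  have h3 := (h.fits hr).one_le
  have h4 := Nat.le_mul_of_pos_right (G.sqDeg r.u) (unit_pos (G.sqDeg r.u))
  omega

/-- `F` consists of the edges still to be inserted. The new entry is not yet in the array, because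
its edge belongs to the removed set. -/
theorem TGraph.orderedInsert_row {F : Finset (TEdge V T)} {x y : V} {t : T} (hxy : G.Adj x y t)
    (hF : edgeOf G.upper x y t ∉ F) {L : List (V × T)}
    (hs : L.Pairwise fun p q => p.2 ≤ q.2) (hn : L.Nodup)
    (hm : ∀ z s, (z, s) ∈ L ↔ (G.remove (insert (edgeOf G.upper x y t) F)).Adj x z s) :
    (L.orderedInsert (fun p q => p.2 ≤ q.2) (y, t)).Pairwise (fun p q => p.2 ≤ q.2) ∧
      (L.orderedInsert (fun p q => p.2 ≤ q.2) (y, t)).Nodup ∧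
      ∀ z s, (z, s) ∈ L.orderedInsert (fun p q => p.2 ≤ q.2) (y, t) ↔ (G.remove F).Adj x z s := by
  have : Std.Total fun p q : V × T => p.2 ≤ q.2 := ⟨fun p q => le_total _ _⟩
  have : IsTrans (V × T) fun p q => p.2 ≤ q.2 := ⟨fun p q r => le_trans⟩
  refine ⟨List.Pairwise.orderedInsert _ _ hs, ?_, fun z s => ?_⟩
  · rw [(List.perm_orderedInsert _ _ _).nodup_iff, List.nodup_cons]
    refine ⟨fun h => ?_, hn⟩
    exact (TGraph.remove_adj.1 ((hm _ _).1 h)).2 (Finset.mem_insert_self _ _)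
  · rw [List.mem_orderedInsert, hm, TGraph.remove_adj, TGraph.remove_adj, Finset.mem_insert]
    constructor
    · rintro (h | h)
      · obtain ⟨rfl, rfl⟩ := Prod.mk.injEq .. ▸ h
        exact ⟨hxy, hF⟩
      · exact ⟨h.1, fun h' => h.2 (Or.inr h')⟩
    · rintro ⟨h1, h2⟩
      by_cases he : edgeOf G.upper x z s = edgeOf G.upper x y t
      · exact Or.inl (Prod.ext (edgeOf_inj he).1 (edgeOf_inj he).2)
      · exact Or.inr ⟨h1, fun h => h.elim he h2⟩

/-- Unlike for deletion, exact representation must be maintained, as the threads count in the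
resulting store. -/
theorem insertEdge_spec {F : Finset (TEdge V T)} {r : Req V T} (hr : G.Adj r.u r.v r.t)
    (hF : r.edge G.upper ∉ F) (h : S.Represents (G.remove (insert (r.edge G.upper) F))) :
    Spec (insertEdge r S) 2 2 (fun S' t => S'.Represents (G.remove F) ∧
      t ≤ 4 * (G.sqDeg r.u * unit (G.sqDeg r.u))) := by
  refine Spec.bind (addEntry_spec _ _ _) (by omega) (by omega) (by omega) ?_
  rintro S' _ ⟨rfl, rfl⟩
  refine (addEntry_spec _ _ _).weaken ?_
  rintro S'' _ ⟨rfl, rfl⟩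
  have hne := hr.ne
  have hfit := h.sub_of_remove.fits hr
  rw [Function.update_of_ne hne.symm]
  constructor
  · intro x
    by_cases hv : x = r.v
    · subst hv
      -- In the array of v the same edge appears read from v.
      have he : r.edge G.upper = edgeOf G.upper r.v r.u r.t := hr.edgeOf_comm
      rw [Function.update_self]
      rw [he] at hF h
      exact TGraph.orderedInsert_row hr.symm hF (h _).1 (h _).2.1 (h _).2.2
    rw [Function.update_of_ne hv]
    by_cases hu : x = r.u
    · subst hu
      rw [Function.update_self]
      exact TGraph.orderedInsert_row hr hF (h _).1 (h _).2.1 (h _).2.2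
    rw [Function.update_of_ne hu]
    refine ⟨(h x).1, (h x).2.1, fun y s => ?_⟩
    rw [(h x).2.2, TGraph.remove_adj, TGraph.remove_adj, Finset.mem_insert, not_or]
    refine and_congr_right fun _ => and_iff_right fun he => ?_
    have h1 := edgeOf_endpoint G.upper x y s
    rw [he] at h1
    unfold Req.edge at h1
    split_ifs at h1
    · exact h1.elim (fun h => hu h.symm) fun h => hv h.symm
    · exact h1.elim (fun h => hv h.symm) fun h => hu h.symm
  · have h1 := hfit.start_le
    have h2 := (hfit.size_le r.v).trans hfit.mid_le
    have h3 := hfit.one_le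
    have h4 := Nat.le_mul_of_pos_right (G.sqDeg r.u) (unit_pos (G.sqDeg r.u))
    omega

variable [Fintype V]

theorem updateGraph_delete {B : List (Req V T)} (hB : ∀ r ∈ B, G.Adj r.u r.v r.t)
    (h : S.Sub G) : List.Forall₂ (fun r m => m.Bounded 4 G.edges.card (G.sqDeg r.u)) B
      (updateGraph deleteEdge S B).2 := by
  refine (updateGraph_induction (I := fun B S => (∀ r ∈ B, G.Adj r.u r.v r.t) ∧ S.Sub G) ?_ B
    ⟨hB, h⟩).2
  rintro r rs S ⟨hB, hS⟩
  have hr := hB r List.mem_cons_self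
  have hd := deleteEdge_spec hS hr
  obtain ⟨_, h1, -⟩ := hd.value (Meter.start S.words)
  exact ⟨⟨fun q hq => hB q (List.mem_cons_of_mem _ hq), h1⟩,
    hd.bounded hS.words_le (Nat.zero_le _) fun _ _ h => h.2⟩

theorem updateGraph_insert {B : List (Req V T)} (hB : ∀ r ∈ B, G.Adj r.u r.v r.t)
    (hn : (batch G.upper B).Nodup) (h : S.Represents (G.remove (batch G.upper B).toFinset)) :
    (updateGraph insertEdge S B).1.Represents G ∧
      List.Forall₂ (fun r m => m.Bounded 4 G.edges.card (G.sqDeg r.u)) B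
        (updateGraph insertEdge S B).2 := by
  have key := updateGraph_induction (op := insertEdge)
    (P := fun r m => m.Bounded 4 G.edges.card (G.sqDeg r.u))
    (I := fun B S => (∀ r ∈ B, G.Adj r.u r.v r.t) ∧ (batch G.upper B).Nodup ∧
      S.Represents (G.remove (batch G.upper B).toFinset)) ?_ B ⟨hB, hn, h⟩
  · refine ⟨fun x => ?_, key.2⟩
    have h1 := key.1.2.2 x
    simpa only [TGraph.remove_adj, batch, List.map_nil, List.toFinset_nil, Finset.notMem_empty,
      not_false_eq_true, and_true] using h1
  · rintro r rs S ⟨hB, hn, hS⟩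
    have hr := hB r List.mem_cons_self
    unfold batch at hn hS
    rw [List.map_cons] at hn hS
    rw [List.toFinset_cons] at hS
    rw [List.nodup_cons] at hn
    have hi := insertEdge_spec hr (mt List.mem_toFinset.1 hn.1) hS
    have hfit := hS.sub_of_remove.fits hr
    obtain ⟨_, h1, -⟩ := hi.value (Meter.start S.words)
    refine ⟨⟨fun q hq => hB q (List.mem_cons_of_mem _ hq), hn.2, h1⟩,
      hi.bounded hS.sub_of_remove.words_le ?_ fun _ _ h => h.2⟩
    have := hfit.one_le
    omega

end Updates

/-! ### First and last edges, and no double counting -/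

section Counting

theorem Req.edge_time {V T : Type} (upper : V → Bool) (r : Req V T) : (r.edge upper).time = r.t :=
  edgeOf_time upper r.u r.v r.t

variable {V T : Type} [AddCommGroup T] [LinearOrder T]

/-- Needed because `Set.ncard` is additive on disjoint sets only if these are finite. -/
theorem TGraph.finite_butterflies (G : TGraph V T) (δ : T) : {β | G.IsButterfly δ β}.Finite :=
  (Set.Finite.pi fun _ => G.edges.finite_toSet).subset fun _ h i _ => h.1 i

theorem TGraph.IsButterfly.existsUnique_first {G : TGraph V T} {δ : T} {β : Fin 4 → TEdge V T} {L : List (TEdge V T)}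
    (hβ : G.IsButterfly δ β) (h : β 0 ∈ L) :
    ∃! e, e ∈ L ∧ (∃ j, β j = e) ∧ ∀ j, e.time ≤ (β j).time := by
  refine ⟨β 0, ⟨h, ⟨0, rfl⟩, fun j => hβ.2.1.monotone (Fin.zero_le j)⟩, ?_⟩
  rintro _ ⟨-, ⟨j, rfl⟩, h1⟩
  rw [Fin.le_zero_iff.1 (hβ.2.1.le_iff_le.1 (h1 0))]

theorem TGraph.IsButterfly.existsUnique_last {G : TGraph V T} {δ : T} {β : Fin 4 → TEdge V T} {L : List (TEdge V T)}
    (hβ : G.IsButterfly δ β) (h : β 3 ∈ L) :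
    ∃! e, e ∈ L ∧ (∃ j, β j = e) ∧ ∀ j, (β j).time ≤ e.time := by
  refine ⟨β 3, ⟨h, ⟨3, rfl⟩, fun j => hβ.2.1.monotone (Fin.le_last j)⟩, ?_⟩
  rintro _ ⟨-, ⟨j, rfl⟩, h1⟩
  have h2 : j = 3 := Fin.last_le_iff.1 (hβ.2.1.le_iff_le.1 (h1 3))
  rw [h2]

variable [DecidableEq V] {G : TGraph V T} {δ : T}

theorem TGraph.count_congr {i : Fin 6} {P Q : (Fin 4 → TEdge V T) → Prop}
    (h : ∀ β, G.IsButterfly δ β → (P β ↔ Q β)) : G.count δ i P = G.count δ i Q := by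
  unfold TGraph.count
  congr 2
  ext β
  exact and_congr_right fun h1 => and_congr_right fun _ => h β h1

/-- Butterflies with different edges at position p are different, so the counts of distinct edges
add up. -/
theorem TGraph.sum_count (p : Fin 4) (i : Fin 6) {L : List (TEdge V T)} (hL : L.Nodup) :
    (L.map fun e => G.count δ i (fun β => β p = e)).sum = G.count δ i (fun β => β p ∈ L) := by
  induction L with
  | nil => simp [TGraph.count]
  | cons e L ih =>
    rw [List.nodup_cons] at hL
    rw [List.map_cons, List.sum_cons, ih hL.2]
    unfold TGraph.count
    have hfin (P : (Fin 4 → TEdge V T) → Prop) :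
        {β | G.IsButterfly δ β ∧ butterflyType β = i ∧ P β}.Finite :=
      (G.finite_butterflies δ).subset fun _ h => h.1
    rw [← Nat.cast_add, ← Set.ncard_union_eq _ (hfin _) (hfin _)]
    · congr 2
      ext β
      simp only [Set.mem_union, Set.mem_ofPred_eq, List.mem_cons]
      tauto
    · rw [Set.disjoint_left]
      rintro β ⟨-, -, h1⟩ ⟨-, -, h2⟩
      exact hL.1 (h1 ▸ h2)

/-- Otherwise the first edge would be a remaining one, and hence not earlier than the batch edge `β
j`. Strict monotonicity then forces j = 0, a contradiction. -/
theorem TGraph.IsButterfly.first_mem {β : Fin 4 → TEdge V T} {B : List (Req V T)}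
    (hβ : G.IsButterfly δ β)
    (hB : ∀ r ∈ B, ∀ f ∈ G.edges, f ∉ batch G.upper B → r.t ≤ f.time)
    (h : ∃ j, β j ∈ batch G.upper B) : β 0 ∈ batch G.upper B := by
  obtain ⟨j, hj⟩ := h
  by_contra h0
  obtain ⟨r, hr, he⟩ := List.mem_map.1 hj
  have h1 := hB r hr _ (hβ.1 0) h0
  rw [← r.edge_time G.upper, he] at h1
  have h2 : j = 0 := Fin.le_zero_iff.1 (hβ.2.1.le_iff_le.1 h1)
  exact h0 (h2 ▸ hj)

theorem TGraph.IsButterfly.last_mem {β : Fin 4 → TEdge V T} {B : List (Req V T)}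
    (hβ : G.IsButterfly δ β)
    (hB : ∀ r ∈ B, ∀ f ∈ G.edges, f ∉ batch G.upper B → f.time ≤ r.t)
    (h : ∃ j, β j ∈ batch G.upper B) : β 3 ∈ batch G.upper B := by
  obtain ⟨j, hj⟩ := h
  by_contra h0
  obtain ⟨r, hr, he⟩ := List.mem_map.1 hj
  have h1 := hB r hr _ (hβ.1 3) h0
  rw [← r.edge_time G.upper, he] at h1
  have h2 : j = 3 := Fin.last_le_iff.1 (hβ.2.1.le_iff_le.1 h1)
  exact h0 (h2 ▸ hj)

end Counting

/-! ### Summing up the threads -/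

section Folds

theorem foldl_sub_apply {α : Type} (f : α → Counts) (l : List α) (C : Counts) (i : Fin 6) :
    l.foldl (fun C a => C - f a) C i = C i - (l.map fun a => f a i).sum := by
  induction l generalizing C with
  | nil => simp
  | cons a l ih => rw [List.foldl_cons, ih, List.map_cons, List.sum_cons, Pi.sub_apply, sub_sub]

theorem foldl_add_apply {α : Type} (f : α → Counts) (l : List α) (C : Counts) (i : Fin 6) :
    l.foldl (fun C a => C + f a) C i = C i + (l.map fun a => f a i).sum := by
  induction l generalizing C with
  | nil => simp
  | cons a l ih => rw [List.foldl_cons, ih, List.map_cons, List.sum_cons, Pi.add_apply, add_assoc]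

theorem forall₂_zipWith_map {α β γ ε : Type} {P : α → γ → Prop} {Q : α → ε → Prop} {l : List α}
    {ms : List γ} {f : α → β} {g : β → γ → ε} (h : List.Forall₂ P l ms)
    (hg : ∀ a ∈ l, ∀ m, P a m → Q a (g (f a) m)) :
    List.Forall₂ Q l (List.zipWith g (l.map f) ms) := by
  induction h with
  | nil => exact List.Forall₂.nil
  | cons h _ ih =>
    exact List.Forall₂.cons (hg _ List.mem_cons_self _ h)
      (ih fun a ha => hg a (List.mem_cons_of_mem _ ha))

end Folds

/-! ### The bounds and counts of the algorithms -/

section Algorithms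

variable {V T : Type} [Fintype V] [DecidableEq V] [AddCommGroup T] [LinearOrder T]
  {G : TGraph V T} {S : Store V T} {r : Req V T} {δ : T}

theorem Store.Sub.stbcCount_spec (h : S.Sub G) (hr : G.Adj r.u r.v r.t) (upper : V → Bool) :
    Spec (stbcCount upper S δ r) (70 * G.sqDeg r.u) (12 * G.sqDeg r.u)
      (fun _ τ => τ ≤ 2000 * (G.sqDeg r.u * unit (G.sqDeg r.u))) :=
  TB.stbcCount_spec upper δ r (h.fits hr)

theorem stbcDelete_bounded (h : S.Represents G) (hr : G.Adj r.u r.v r.t) (C : Counts) :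
    ((stbcDelete G.upper δ r S C).run (Meter.start S.words)).2.Bounded 2010
      G.edges.card (G.sqDeg r.u) := by
  have hn := Nat.le_mul_of_pos_right (G.sqDeg r.u) (unit_pos (G.sqDeg r.u))
  have h1 := (h.sub.fits hr).one_le
  refine Spec.bounded (s := 70 * G.sqDeg r.u) (a := 12 * G.sqDeg r.u)
    (Q := fun _ t => t ≤ 2010 * (G.sqDeg r.u * unit (G.sqDeg r.u))) ?_ h.sub.words_le (by omega)
    fun _ _ h => h
  refine Spec.bind (h.sub.stbcCount_spec hr G.upper) le_rfl le_rfl (by omega) fun D t ht => ?_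
  refine Spec.tick_bind (Spec.bind₀ (deleteEdge_spec h.sub hr) (Nat.zero_le _) ?_)
  rintro S' t' ⟨-, ht'⟩
  exact Spec.ret (by omega)

theorem stbcInsert_bounded (h : S.Represents (G.remove {r.edge G.upper}))
    (hr : G.Adj r.u r.v r.t) (C : Counts) :
    ((stbcInsert G.upper δ r S C).run (Meter.start S.words)).2.Bounded 2010
      G.edges.card (G.sqDeg r.u) := by
  have hn := Nat.le_mul_of_pos_right (G.sqDeg r.u) (unit_pos (G.sqDeg r.u))
  have hsub := h.sub_of_remove
  have h1 := (hsub.fits hr).one_le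
  refine Spec.bounded (s := 70 * G.sqDeg r.u) (a := 12 * G.sqDeg r.u + 2)
    (Q := fun _ t => t ≤ 2010 * (G.sqDeg r.u * unit (G.sqDeg r.u))) ?_ hsub.words_le (by omega)
    fun _ _ h => h
  refine Spec.bind (hsub.stbcCount_spec hr G.upper) le_rfl (by omega) (by omega) fun D t ht => ?_
  -- With a single edge nothing remains to be inserted afterwards, and `{e}` is `insert e ∅` by
  -- definition.
  refine Spec.tick_bind (Spec.bind (insertEdge_spec (F := ∅) hr (Finset.notMem_empty _) h)
    (by omega) (by omega) (by omega) ?_)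
  rintro S' t' ⟨-, ht'⟩
  exact Spec.ret (by omega)

variable [IsOrderedAddMonoid T]

/-- A thread of STBC⁺ stays within its bounds and counts the butterflies whose first, respectively
last, edge is its edge. -/
theorem plusCount_correct (mode : Mode) (h : S.Represents G) (hr : G.Adj r.u r.v r.t) :
    ((plusCount mode G.upper S δ r).run (Meter.start S.words)).2.Bounded 200
        G.edges.card (G.sqDeg r.u) ∧
      ∀ i, ((plusCount mode G.upper S δ r).run (Meter.start S.words)).1 i =
        G.count δ i (fun β => β mode.pos = r.edge G.upper) := by
  have hs := plusCount_spec mode G.upper δ r (h.sub.fits hr) fun x => ⟨(h x).1, (h x).2.1⟩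
  refine ⟨hs.bounded h.sub.words_le (by omega) fun _ _ h => h.1, fun i => ?_⟩
  obtain ⟨_, -, es, fs, W, hes, hfn, hfs, hW, hC⟩ := hs.value (Meter.start S.words)
  rw [← convType_convType (!G.upper r.u) i, hC,
    ← sum_numMatches_eq_count mode hr h hes hfn hfs hW]

theorem stbcPlusDelete_runs {B : List (Req V T)} (h : S.Represents G)
    (hB : ∀ r ∈ B, G.Adj r.u r.v r.t) (C : Counts) :
    List.Forall₂ (fun r p => p.meter.Bounded 204 G.edges.card (G.sqDeg r.u) ∧
      ∀ i, p.contrib i = G.count δ i (fun β => β 0 = r.edge G.upper))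
      B (stbcPlusDelete G.upper δ B S C).runs :=
  forall₂_zipWith_map (updateGraph_delete hB h.sub) fun r hr _ hm =>
    have key := plusCount_correct (δ := δ) .delete h (hB r hr)
    ⟨key.1.andThen hm, key.2⟩

theorem stbcPlusInsert_runs {B : List (Req V T)}
    (h : S.Represents (G.remove (batch G.upper B).toFinset)) (hn : (batch G.upper B).Nodup)
    (hB : ∀ r ∈ B, G.Adj r.u r.v r.t) (C : Counts) :
    List.Forall₂ (fun r p => p.meter.Bounded 204 G.edges.card (G.sqDeg r.u) ∧
      ∀ i, p.contrib i = G.count δ i (fun β => β 3 = r.edge G.upper))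
      B (stbcPlusInsert G.upper δ B S C).runs :=
  have hu := updateGraph_insert hB hn h
  forall₂_zipWith_map hu.2 fun r hr _ hm =>
    have key := plusCount_correct (δ := δ) .insert hu.1 (hB r hr)
    ⟨hm.andThen key.1, key.2⟩

/-- Each thread counts the butterflies that have its edge at one fixed position; the batch edges are
distinct, so the sum counts the butterflies with that position in the batch. -/
theorem sum_contrib {B : List (Req V T)} (mode : Mode) (h : S.Represents G)
    (hn : (batch G.upper B).Nodup) (hB : ∀ r ∈ B, G.Adj r.u r.v r.t) (i : Fin 6) :
    ((B.map fun r => (plusCount mode G.upper S δ r).run (Meter.start S.words)).map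
      fun a => a.1 i).sum = G.count δ i (fun β => β mode.pos ∈ batch G.upper B) := by
  rw [← TGraph.sum_count _ _ hn, batch, List.map_map, List.map_map]
  congr 1
  exact List.map_congr_left fun r hr => (plusCount_correct mode h (hB r hr)).2 i

theorem stbcPlusDelete_counts {B : List (Req V T)} (h : S.Represents G)
    (hn : (batch G.upper B).Nodup) (hB : ∀ r ∈ B, G.Adj r.u r.v r.t) (C : Counts) (i : Fin 6) :
    (stbcPlusDelete G.upper δ B S C).counts i =
      C i - G.count δ i (fun β => β 0 ∈ batch G.upper B) := by
  exact (foldl_sub_apply (fun a : Counts × Meter => a.1) _ C i).trans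
    (congrArg (C i - ·) (sum_contrib .delete h hn hB i))

theorem stbcPlusInsert_counts {B : List (Req V T)}
    (h : S.Represents (G.remove (batch G.upper B).toFinset)) (hn : (batch G.upper B).Nodup)
    (hB : ∀ r ∈ B, G.Adj r.u r.v r.t) (C : Counts) (i : Fin 6) :
    (stbcPlusInsert G.upper δ B S C).counts i =
      C i + G.count δ i (fun β => β 3 ∈ batch G.upper B) := by
  exact (foldl_add_apply (fun a : Counts × Meter => a.1) _ C i).trans
    (congrArg (C i + ·) (sum_contrib .insert (updateGraph_insert hB hn h).1 hn hB i))

end Algorithms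

end TB

theorem mainTheorem5 : ∃ c : ℝ, ∀ (V T : Type) [Fintype V] [DecidableEq V]
    [AddCommGroup T] [LinearOrder T] [IsOrderedAddMonoid T] (G : TB.TGraph V T) (δ : T),
    -- STBC: deletion of an edge of `G`, and the insertion that leads to `G`
    (∀ (r : TB.Req V T) (S : TB.Store V T) (C : TB.Counts), G.Adj r.u r.v r.t →
      (S.Represents G →
        ((TB.stbcDelete G.upper δ r S C).run (TB.Meter.start S.words)).2.Within c
          G.edges.card (G.sqDeg r.u)) ∧
      (S.Represents (G.remove {r.edge G.upper}) →
        ((TB.stbcInsert G.upper δ r S C).run (TB.Meter.start S.words)).2.Within c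
          G.edges.card (G.sqDeg r.u))) ∧
    -- STBC⁺: batches of edges of `G`
    (∀ (B : List (TB.Req V T)) (S : TB.Store V T) (C : TB.Counts),
      (∀ r ∈ B, G.Adj r.u r.v r.t) → (TB.batch G.upper B).Nodup →
      -- deletion of the batch from `G`: bounds and contribution of every edge
      (S.Represents G →
        List.Forall₂ (fun r p => p.meter.Within c G.edges.card (G.sqDeg r.u) ∧
            ∀ i, p.contrib i = G.count δ i (fun β => β 0 = r.edge G.upper))
          B (TB.stbcPlusDelete G.upper δ B S C).runs ∧
        -- no double counting if the batch has the smallest timestamps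
        ((∀ r ∈ B, ∀ f ∈ G.edges, f ∉ TB.batch G.upper B → r.t ≤ f.time) →
          (∀ β, G.IsButterfly δ β → (∃ j, β j ∈ TB.batch G.upper B) →
            ∃! e, e ∈ TB.batch G.upper B ∧ (∃ j, β j = e) ∧ ∀ j, e.time ≤ (β j).time) ∧
          ∀ i, (TB.stbcPlusDelete G.upper δ B S C).counts i =
            C i - G.count δ i (fun β => ∃ j, β j ∈ TB.batch G.upper B))) ∧
      -- the insertion of the batch that leads to `G`
      (S.Represents (G.remove (TB.batch G.upper B).toFinset) →
        List.Forall₂ (fun r p => p.meter.Within c G.edges.card (G.sqDeg r.u) ∧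
            ∀ i, p.contrib i = G.count δ i (fun β => β 3 = r.edge G.upper))
          B (TB.stbcPlusInsert G.upper δ B S C).runs ∧
        -- no double counting if the batch has the largest timestamps
        ((∀ r ∈ B, ∀ f ∈ G.edges, f ∉ TB.batch G.upper B → f.time ≤ r.t) →
          (∀ β, G.IsButterfly δ β → (∃ j, β j ∈ TB.batch G.upper B) →
            ∃! e, e ∈ TB.batch G.upper B ∧ (∃ j, β j = e) ∧ ∀ j, (β j).time ≤ e.time) ∧
          ∀ i, (TB.stbcPlusInsert G.upper δ B S C).counts i =
            C i + G.count δ i (fun β => ∃ j, β j ∈ TB.batch G.upper B)))) := by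
  -- The factor 5 comes from `unit_le_log`. In 2010, the counting of STBC takes 2000, the six steps
  -- that update the counters at most 6, and the change of the graph 4; STBC⁺ needs only 204.
  refine ⟨5 * (2010 : ℕ), fun V T _ _ _ _ _ G δ => ⟨fun r S C hr => ⟨fun h => ?_, fun h => ?_⟩,
    fun B S C hB hn => ⟨fun h => ⟨?_, fun hmin => ⟨fun β hβ hj => ?_, fun i => ?_⟩⟩,
      fun h => ⟨?_, fun hmax => ⟨fun β hβ hj => ?_, fun i => ?_⟩⟩⟩⟩⟩
  · exact (TB.stbcDelete_bounded h hr C).within (by norm_num)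
  · exact (TB.stbcInsert_bounded h hr C).within (by norm_num)
  · exact (TB.stbcPlusDelete_runs h hB C).imp fun r p hp =>
      ⟨(hp.1.mono (by norm_num)).within (by norm_num), hp.2⟩
  · exact hβ.existsUnique_first (hβ.first_mem hmin hj)
  · rw [TB.stbcPlusDelete_counts h hn hB]
    congr 1
    -- Only here is the assumption on timestamps used for the counts: meeting the batch is the same
    -- as having the first edge in it.
    exact TB.TGraph.count_congr fun β hβ => ⟨fun h => ⟨0, h⟩, hβ.first_mem hmin⟩
  · exact (TB.stbcPlusInsert_runs h hn hB C).imp fun r p hp =>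
      ⟨(hp.1.mono (by norm_num)).within (by norm_num), hp.2⟩
  · exact hβ.existsUnique_last (hβ.last_mem hmax hj)
  · rw [TB.stbcPlusInsert_counts h hn hB]
    congr 1
    exact TB.TGraph.count_congr fun β hβ => ⟨fun h => ⟨3, h⟩, hβ.last_mem hmax⟩
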